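/- Fix a constant noise rate $\gamma>0$ and a constant $c$. Consider any family of instances, where an instance consists of a number of qubits $n$, an ideal circuit $\mathcal C$ on $n$ qubits (layers of two-qubit unitary gates acting on disjoint pairs of qubits), a Pauli observable $O\in\{1,X,Y,Z\}^{\otimes n}$, and a finite ensemble $\mathcal E=\{\rho\}$ of $n$-qubit states, uniformly weighted, that is low-average with purity $c$: $\lVert \frac{1}{|\mathcal E|}\sum_{\rho}\rho\rVert_\infty\le c/2^n$. Let $\varepsilon>0$ depend on the instance with $1/\varepsilon\le \mathrm{poly}(n)$. An error mitigation strategy proceeds as follows. From the classical description of the instance (the same data, possibly with further classical data such as real constants, are available to the classical algorithm below; $\rho$ is not part of it) and random bits, a program produces a list of circuits $\mathcal C'_1,\dots,\mathcal C'_M$, not depending on $\rho$, with uniform local depolarizing noise: every qubit is depolarized, $\sigma\mapsto e^{-\gamma'}\sigma+(1-e^{-\gamma'})\,\mathrm{tr}_j(\sigma)\otimes\tfrac12$, before the first layer and after every layer, with a rate $\gamma'\ge\gamma$ that may depend on the circuit. Then $O$ is measured once on each $\mathcal C'_m\{\rho\}$, and a second program computes an estimate of $\mathrm{tr}(\mathcal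 C\{\rho\}O)$ from the outcomes $r\in\{\pm1\}^M$. The strategy runs in polynomial time if the total time of both programs and of all the circuit executions is at most $\mathrm{poly}(n)$. Classical computation is counted in a real-number machine model in which arithmetic operations, comparisons, pointer operations and queries for a Pauli coefficient $\mathrm{tr}(\rho P)$ of the state each cost one step (the first program has no access to such queries). Suppose that a polynomial-time error mitigation strategy of this kind estimates $\mathrm{tr}(\mathcal C\{\rho\}O)$ to root-mean-square error at most $\varepsilon/2$ on every instance of the family, where the mean is over $\rho\in\mathcal E$, the random bits and the measurement outcomes. Then there is a randomized classical algorithm that, from the classical description of the instance, queries to the Pauli coefficients of $\rho$ and polynomially many random bits, computes $\mathrm{tr}(\mathcal C\{\rho\}O)$ in time $\mathrm{poly}(n)$ to root-mean-square error at most $\varepsilon$ on every instance, where the mean is over $\rho\in\mathcal E$ and the random bits. -/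

import Mathlib

open scoped Matrix ComplexOrder

namespace QEM

noncomputable section

/-! ### Qubits, Pauli operators, states and ensembles -/

/-- Labels of the computational basis of `n` qubits. -/
abbrev Bits (n : ℕ) : Type := Fin n → Fin 2

/-- Linear operators on `n` qubits, as matrices in the computational basis. -/
abbrev Op (n : ℕ) : Type := Matrix (Bits n) (Bits n) ℂ

/-- The single-qubit operators `1, X, Y, Z`, numbered `0, 1, 2, 3`. -/
def pauli : Fin 4 → Matrix (Fin 2) (Fin 2) ℂ :=
  ![!![1, 0; 0, 1], !![0, 1; 1, 0], !![0, -Complex.I; Complex.I, 0], !![1, 0; 0, -1]]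

/-- Names of the `n`-qubit Pauli operators. -/
abbrev PauliString (n : ℕ) : Type := Fin n → Fin 4

/-- The Pauli operator `P 0 ⊗ ⋯ ⊗ P (n-1)`. -/
def PauliString.op {n : ℕ} (P : PauliString n) : Op n :=
  fun x y => ∏ k, pauli (P k) (x k) (y k)

/-- Density operators. -/
def IsState {n : ℕ} (ρ : Op n) : Prop := ρ.PosSemidef ∧ ρ.trace = 1

/-- A finite nonempty ensemble of `n`-qubit states (drawn uniformly at random). -/
structure Ensemble (n : ℕ) where
  size : ℕ
  size_pos : 0 < size
  state : Fin size → Op n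
  isState : ∀ ω, IsState (state ω)

/-- The average of a real quantity over the ensemble. -/
def Ensemble.mean {n : ℕ} (E : Ensemble n) (f : Fin E.size → ℝ) : ℝ :=
  (E.size : ℝ)⁻¹ * ∑ ω, f ω

/-- The mixture of the ensemble. -/
def Ensemble.mixture {n : ℕ} (E : Ensemble n) : Op n :=
  (E.size : ℂ)⁻¹ • ∑ ω, E.state ω

/-- The ensemble is low-average with purity `c`: the operator norm of its mixture is at most
`c / 2 ^ n`. -/
def Ensemble.IsLowAverage {n : ℕ} (E : Ensemble n) (c : ℝ) : Prop :=
  ‖Matrix.toEuclideanCLM (n := Bits n) (𝕜 := ℂ) E.mixture‖ ≤ c / 2 ^ n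

/-! ### Circuits and noise -/

/-- A two-qubit gate: an arbitrary unitary on the (ordered) pair of distinct qubits `i, j`. -/
structure Gate (n : ℕ) where
  i : Fin n
  j : Fin n
  ne : i ≠ j
  u : Matrix (Fin 2 × Fin 2) (Fin 2 × Fin 2) ℂ
  unitary : u ∈ Matrix.unitaryGroup (Fin 2 × Fin 2) ℂ

/-- The gate as an operator on all `n` qubits, the identity on the other qubits. -/
def Gate.op {n : ℕ} (g : Gate n) : Op n := fun x y =>
  if ∀ k, k ≠ g.i → k ≠ g.j → x k = y k then g.u (x g.i, x g.j) (y g.i, y g.j) else 0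

/-- One circuit layer (a depth-1 unitary): two-qubit gates on disjoint pairs of qubits. -/
structure Layer (n : ℕ) where
  gates : List (Gate n)
  disjoint : gates.Pairwise fun g h => g.i ≠ h.i ∧ g.i ≠ h.j ∧ g.j ≠ h.i ∧ g.j ≠ h.j

/-- The unitary of a layer (its gates commute). -/
def Layer.op {n : ℕ} (L : Layer n) : Op n := (L.gates.map Gate.op).prod

/-- Conjugation of an operator by the unitary of a layer. -/
def Layer.apply {n : ℕ} (L : Layer n) (σ : Op n) : Op n := L.op * σ * L.opᴴ

/-- A circuit: its layers in the order in which they are applied. -/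
abbrev Circuit (n : ℕ) : Type := List (Layer n)

/-- The noiseless evolution of an operator under a circuit. -/
def Circuit.ideal {n : ℕ} (C : Circuit n) (ρ : Op n) : Op n :=
  C.foldl (fun σ L => L.apply σ) ρ

/-- Local depolarizing noise on qubit `j`: `σ ↦ a σ + (1 - a) tr_j(σ) ⊗ (1/2)_j`. -/
def depolarize {n : ℕ} (a : ℝ) (j : Fin n) (σ : Op n) : Op n := fun x y =>
  (a : ℂ) * σ x y +
    (1 - (a : ℂ)) *
      (if x j = y j then (∑ b, σ (Function.update x j b) (Function.update y j b)) / 2 else 0)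

/-- Local depolarizing noise on every qubit. -/
def depolarizeAll {n : ℕ} (a : ℝ) (σ : Op n) : Op n :=
  (List.finRange n).foldl (fun τ j => depolarize a j τ) σ

/-- A quantum circuit with uniform local depolarizing noise of strength at least `γ`. -/
structure NoisyCircuit (n : ℕ) (γ : ℝ) where
  layers : Circuit n
  rate : ℝ
  le_rate : γ ≤ rate

/-- The noisy evolution: every qubit is depolarized before the first layer and after every
layer (the last time is the read-out noise). -/
def NoisyCircuit.run {n : ℕ} {γ : ℝ} (C : NoisyCircuit n γ) (ρ : Op n) : Op n :=
  C.layers.foldl (fun σ L => depolarizeAll (Real.exp (-C.rate)) (L.apply σ))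
    (depolarizeAll (Real.exp (-C.rate)) ρ)

/-- The time to run a noisy circuit once: one unit for the measurement, one for each layer and
one for each gate. -/
def NoisyCircuit.cost {n : ℕ} {γ : ℝ} (C : NoisyCircuit n γ) : ℕ :=
  1 + (C.layers.map fun L => 1 + L.gates.length).sum

/-- The measurement outcome named by a bit. -/
def sign (b : Bool) : ℝ := if b then 1 else -1

/-- Born's rule: the probability of the outcome `± 1` when the Pauli operator `O` is measured in
the state `σ`, with the projector `(1 ± O) / 2`. -/
def bornProb {n : ℕ} (O : PauliString n) (σ : Op n) (b : Bool) : ℝ :=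
  (((1 / 2 : ℂ) • (1 + (sign b : ℂ) • O.op)) * σ).trace.re

/-! ### Classical computation: a real-number pointer machine with unit costs -/

/-- Data: real numbers and pairs of data. -/
inductive Data : Type where
  | nil : Data
  | num : ℝ → Data
  | node : Data → Data → Data

namespace Data

/-- The test used by branches and loops. -/
def Holds : Data → Prop
  | num x => 0 < x
  | _ => False

/-- First component of a pair. -/
def fst : Data → Data
  | node a _ => a
  | _ => nil

/-- Second component of a pair. -/
def snd : Data → Data
  | node _ b => b
  | _ => nil

/-- `1` on pairs and `0` on all other data. -/
def isNode : Data → Data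
  | node _ _ => num 1
  | _ => num 0

/-- `1` on numbers and `0` on all other data. -/
def isNum : Data → Data
  | num _ => num 1
  | _ => num 0

/-- A binary operation on numbers, applied to a pair of numbers. -/
def arith (f : ℝ → ℝ → ℝ) : Data → Data
  | node (num x) (num y) => num (f x y)
  | _ => nil

/-- Lists as data. -/
def ofList : List Data → Data
  | [] => nil
  | a :: l => node a (ofList l)

end Data

/-- Programs. All constants that occur in a program are rational. -/
inductive Prog : Type where
  | id : Prog
  | nil : Prog
  | const : ℚ → Prog
  | fst : Prog
  | snd : Prog
  | isNode : Prog
  | isNum : Prog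
  | add : Prog
  | sub : Prog
  | mul : Prog
  | div : Prog
  | query : Prog
  | comp : Prog → Prog → Prog
  | pair : Prog → Prog → Prog
  | cond : Prog → Prog → Prog → Prog
  | loop : Prog → Prog → Prog

/-- `Runs ask p d e t`: on input `d`, the program `p` halts with output `e` after `t` steps, where
`ask` answers the queries. Every elementary operation is one step. `comp g f` is `f` followed by
`g`; `loop c f` is: while `c` holds of the current data, apply `f` to it. -/
inductive Runs (ask : Data → Data) : Prog → Data → Data → ℕ → Prop where
  | id (d : Data) : Runs ask .id d d 1
  | nil (d : Data) : Runs ask .nil d .nil 1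
  | const (q : ℚ) (d : Data) : Runs ask (.const q) d (.num (q : ℝ)) 1
  | fst (d : Data) : Runs ask .fst d d.fst 1
  | snd (d : Data) : Runs ask .snd d d.snd 1
  | isNode (d : Data) : Runs ask .isNode d d.isNode 1
  | isNum (d : Data) : Runs ask .isNum d d.isNum 1
  | add (d : Data) : Runs ask .add d (d.arith fun x y => x + y) 1
  | sub (d : Data) : Runs ask .sub d (d.arith fun x y => x - y) 1
  | mul (d : Data) : Runs ask .mul d (d.arith fun x y => x * y) 1
  | div (d : Data) : Runs ask .div d (d.arith fun x y => x / y) 1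
  | query (d : Data) : Runs ask .query d (ask d) 1
  | comp {g f : Prog} {d e r : Data} {s t : ℕ} :
      Runs ask f d e s → Runs ask g e r t → Runs ask (.comp g f) d r (s + t + 1)
  | pair {f g : Prog} {d a b : Data} {s t : ℕ} :
      Runs ask f d a s → Runs ask g d b t → Runs ask (.pair f g) d (.node a b) (s + t + 1)
  | cond_true {c f g : Prog} {d b r : Data} {s t : ℕ} :
      Runs ask c d b s → b.Holds → Runs ask f d r t → Runs ask (.cond c f g) d r (s + t + 1)
  | cond_false {c f g : Prog} {d b r : Data} {s t : ℕ} :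
      Runs ask c d b s → ¬ b.Holds → Runs ask g d r t → Runs ask (.cond c f g) d r (s + t + 1)
  | loop_stop {c f : Prog} {d b : Data} {s : ℕ} :
      Runs ask c d b s → ¬ b.Holds → Runs ask (.loop c f) d d (s + 1)
  | loop_step {c f : Prog} {d b e r : Data} {s t u : ℕ} :
      Runs ask c d b s → b.Holds → Runs ask f d e t → Runs ask (.loop c f) e r u →
      Runs ask (.loop c f) d r (s + t + u + 1)

/-! ### Inputs of programs -/

/-- A Pauli operator as data. -/
def PauliString.data {n : ℕ} (P : PauliString n) : Data :=
  .ofList (List.ofFn fun k => .num ((P k : ℕ) : ℝ))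

/-- A string of bits as data. -/
def bitsData {m : ℕ} (s : Fin m → Bool) : Data :=
  .ofList (List.ofFn fun k => .num (if s k then 1 else 0))

/-- A sequence of measurement outcomes as data. -/
def outcomesData {m : ℕ} (r : Fin m → Bool) : Data :=
  .ofList (List.ofFn fun k => .num (sign (r k)))

/-- A complex number as data. -/
def complexData (z : ℂ) : Data := .node (.num z.re) (.num z.im)

/-- The basis of two qubits, in lexicographic order. -/
def twoBits : List (Fin 2 × Fin 2) := [(0, 0), (0, 1), (1, 0), (1, 1)]

/-- A gate as data: its two qubits and the rows of its matrix. -/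
def Gate.data {n : ℕ} (g : Gate n) : Data :=
  .node (.num ((g.i : ℕ) : ℝ)) (.node (.num ((g.j : ℕ) : ℝ))
    (.ofList (twoBits.map fun x => .ofList (twoBits.map fun y => complexData (g.u x y)))))

/-- A circuit as data: the list of its layers, each of which is a list of gates. -/
def Circuit.data {n : ℕ} (C : Circuit n) : Data :=
  .ofList (C.map fun L => .ofList (L.gates.map Gate.data))

/-- A noisy circuit as data: the damping factor of its noise and its layers. -/
def NoisyCircuit.data {n : ℕ} {γ : ℝ} (C : NoisyCircuit n γ) : Data :=
  .node (.num (Real.exp (-C.rate))) (Circuit.data C.layers)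

open Classical in
/-- Access to the Pauli coefficients of a state: a query that names a Pauli operator `P` is
answered by `tr (ρ P)`. -/
def coefficients {n : ℕ} (ρ : Op n) (d : Data) : Data :=
  if h : ∃ P : PauliString n, P.data = d then .num (ρ * h.choose.op).trace.re else .nil

/-- No access to any state: queries are not answered. -/
def noAccess : Data → Data := fun _ => .nil

/-- An instance of the problem of estimating `tr (C{ρ} O)` for an ideal circuit `C`, a Pauli
observable `O` and a state `ρ` from an ensemble; `aux` is any further classical data that
strategies and algorithms may use (for example real constants). -/
structure Problem where
  n : ℕ
  circuit : Circuit n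
  obs : PauliString n
  ensemble : Ensemble n
  aux : Data

/-- The ideal expectation value, for the state number `ω` of the ensemble. -/
def Problem.value (p : Problem) (ω : Fin p.ensemble.size) : ℝ :=
  (Circuit.ideal p.circuit (p.ensemble.state ω) * p.obs.op).trace.re

/-- The classical input: the number of qubits, the noise, the observable, the ideal circuit and
the further data. -/
def Problem.input (p : Problem) (γ : ℝ) : Data :=
  .ofList [.num (p.n : ℝ), .num (Real.exp (-γ)), p.obs.data, Circuit.data p.circuit, p.aux]

/-! ### Error mitigation and classical algorithms -/

/-- The average over uniformly distributed strings of `m` bits. -/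
def coinMean {m : ℕ} (f : (Fin m → Bool) → ℝ) : ℝ := (2 ^ m : ℝ)⁻¹ * ∑ s, f s

/-- A polynomial-time error mitigation strategy for the problems `p i`, using circuits with noise
rate at least `γ`: from the classical input and a string of `coins` random bits, the program `plan`
computes a list of noisy circuits (which does not depend on the state); the observable is measured
once on the output of each of them; from the outcomes, the program `conclude` computes an estimate.
The total time (of the two programs and of the experiments) is polynomial in the number of
qubits. -/
structure MitigationStrategy {ι : Type*} (p : ι → Problem) (γ : ℝ) where
  plan : Prog
  conclude : Prog
  coins : Polynomial ℕ
  time : Polynomial ℕ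
  circuits : ∀ i, (Fin (coins.eval (p i).n) → Bool) → List (NoisyCircuit (p i).n γ)
  estimate : ∀ i, Fin (p i).ensemble.size → (s : Fin (coins.eval (p i).n) → Bool) →
    (Fin (circuits i s).length → Bool) → ℝ
  spec : ∀ i ω s r, ∃ t₁ t₂ : ℕ,
    Runs noAccess plan (.node ((p i).input γ) (bitsData s))
      (.ofList ((circuits i s).map NoisyCircuit.data)) t₁ ∧
    Runs (coefficients ((p i).ensemble.state ω)) conclude
      (.node ((p i).input γ) (.node (bitsData s) (outcomesData r))) (.num (estimate i ω s r)) t₂ ∧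
    t₁ + ((circuits i s).map NoisyCircuit.cost).sum + t₂ ≤ time.eval (p i).n

/-- The probability of the outcomes `r` when `O` is measured once on each of the noisy circuits
`Cs` applied to `ρ`. -/
def outcomeProb {n : ℕ} {γ : ℝ} (O : PauliString n) (ρ : Op n) (Cs : List (NoisyCircuit n γ))
    (r : Fin Cs.length → Bool) : ℝ :=
  ∏ m, bornProb O ((Cs.get m).run ρ) (r m)

/-- The root-mean-square error of a mitigation strategy, over the ensemble of states, the random
bits and the measurement outcomes. -/
def MitigationStrategy.rmsError {ι : Type*} {p : ι → Problem} {γ : ℝ}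
    (S : MitigationStrategy p γ) (i : ι) : ℝ :=
  Real.sqrt ((p i).ensemble.mean fun ω => coinMean fun s =>
    ∑ r, outcomeProb (p i).obs ((p i).ensemble.state ω) (S.circuits i s) r *
      (S.estimate i ω s r - (p i).value ω) ^ 2)

/-- A polynomial-time (randomized) classical algorithm for the problems `p i`: a single program that
has access to the Pauli coefficients of the state and gets the classical input and a string of
`coins` random bits. -/
structure ClassicalAlgorithm {ι : Type*} (p : ι → Problem) (γ : ℝ) where
  prog : Prog
  coins : Polynomial ℕ
  time : Polynomial ℕ
  estimate : ∀ i, Fin (p i).ensemble.size → (Fin (coins.eval (p i).n) → Bool) → ℝ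
  spec : ∀ i ω s, ∃ t : ℕ,
    Runs (coefficients ((p i).ensemble.state ω)) prog (.node ((p i).input γ) (bitsData s))
      (.num (estimate i ω s)) t ∧
    t ≤ time.eval (p i).n

/-- The root-mean-square error of a classical algorithm, over the ensemble of states and the random
bits. -/
def ClassicalAlgorithm.rmsError {ι : Type*} {p : ι → Problem} {γ : ℝ}
    (A : ClassicalAlgorithm p γ) (i : ι) : ℝ :=
  Real.sqrt ((p i).ensemble.mean fun ω => coinMean fun s =>
    (A.estimate i ω s - (p i).value ω) ^ 2)

end

end QEM

open QEM

/-! On average over a low-average ensemble, circuits with constant noise are classically easy. A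
mitigation strategy can therefore be run with its experiments replaced by a simulation, at a small
cost in accuracy.

Simulation. In the Heisenberg picture the observable spreads into a sum over Pauli paths.
Depolarizing noise is diagonal in the Pauli basis: a layer of it multiplies a Pauli operator of
weight w by a^w, where a is the damping factor of the circuit. A path of total weight k thus
contributes its noiseless coefficient times a^k (`pathSum_paths`), and paths with a^k ≤ 1/R² are
dropped.

Truncation error. Group the noiseless coefficients by final Pauli operator and total weight. Gates
conserve the sum of squares at each weight and noise only shifts coefficients between weights, so
the sum of all squares is at most 1 (`pathNorm_paths_le`). By Cauchy–Schwarz over the weights, the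
dropped operator has squared Hilbert–Schmidt norm at most 2^n times O(1/R²). The low-average
condition supplies the factor c / 2^n that turns this into a bound on the mean square error
(`mean_sq_truncation_le`).

Number of paths. A gate splits a path, into 16, only if it touches the current Pauli operator, and
at most w disjoint gates touch an operator of weight w. So the sum of 16^(-k) over the paths after
each layer stays at most 1. Kept paths have k = O(log R), with a constant that depends on γ, hence
there are polynomially many (`Bounded.length_le`, `exists_pow_le_of_keepAbove`).

From simulation to estimate. The algorithm runs the first program, samples one outcome per circuit
from the truncated expectation values with R random bits each, runs the second program and clips its
estimate to [-1, 1]. The clipped squared error is at most 4, so replacing the outcome probabilities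
one at a time costs at most 4 times the sum of their errors (`outcomeMean_le_add`). The circuits do
not depend on the state, so these errors can be averaged over the ensemble for each circuit
separately. With T circuits the mean square error grows by O(T/R), and a polynomial R makes this at
most ε²/2.

Implementation. The new procedures are written in a language that iterates only over lists, where
values and costs are computed by recursion (`FProg.runsWithin_compile`). The parameter R is produced
in unary from the length of the observable. -/

namespace QEM

/-! ### A language with bounded iteration -/

/-- Loop-free programs extended by iteration over a list: `fold l z b` runs through the list `l`
from the left, starting with `z`; the body `b` sees the current entry, the accumulated value and the
surrounding environment. -/
inductive FProg : Type where
  | id : FProg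
  | nil : FProg
  | const : ℚ → FProg
  | fst : FProg
  | snd : FProg
  | add : FProg
  | sub : FProg
  | mul : FProg
  | query : FProg
  | comp : FProg → FProg → FProg
  | pair : FProg → FProg → FProg
  | cond : FProg → FProg → FProg → FProg
  | fold : FProg → FProg → FProg → FProg

/-- The entries of a list. -/
def Data.toList : Data → List Data
  | .node a l => a :: l.toList
  | _ => []

@[simp] theorem Data.toList_ofList (l : List Data) : (Data.ofList l).toList = l := by
  induction l with
  | nil => rfl
  | cons a l ih => simp [Data.ofList, Data.toList, ih]

namespace FProg

/-- Translation into programs. -/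
def compile : FProg → Prog
  | id => .id
  | nil => .nil
  | const q => .const q
  | fst => .fst
  | snd => .snd
  | add => .add
  | sub => .sub
  | mul => .mul
  | query => .query
  | comp g f => .comp g.compile f.compile
  | pair f g => .pair f.compile g.compile
  | cond c f g => .cond c.compile f.compile g.compile
  | fold l z b =>
      .comp (.comp .fst .snd)
        (.comp
          (.loop (.comp .isNode .fst)
            (.pair (.comp .snd .fst)
              (.pair (.comp b.compile (.pair (.comp .fst .fst) .snd)) (.comp .snd .snd))))
          (.pair l.compile (.pair z.compile .id)))

open Classical in
/-- The function computed by a program. -/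
noncomputable def eval (ask : Data → Data) : FProg → Data → Data
  | id, d => d
  | nil, _ => .nil
  | const q, _ => .num q
  | fst, d => d.fst
  | snd, d => d.snd
  | add, d => d.arith fun x y => x + y
  | sub, d => d.arith fun x y => x - y
  | mul, d => d.arith fun x y => x * y
  | query, d => ask d
  | comp g f, d => g.eval ask (f.eval ask d)
  | pair f g, d => .node (f.eval ask d) (g.eval ask d)
  | cond c f g, d => if (c.eval ask d).Holds then f.eval ask d else g.eval ask d
  | fold l z b, d =>
      (l.eval ask d).toList.foldl (fun acc a => b.eval ask (.node a (.node acc d))) (z.eval ask d)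

/-- The accumulated cost of an iteration. -/
def iterCost (f : Data → Data → Data) (c : Data → Data → ℕ) : List Data → Data → ℕ
  | [], _ => 0
  -- Besides the body, one pass of the compiled loop spends 3 steps on the test, 14 on taking the
  -- state apart and rebuilding it, and 1 on the loop itself.
  | a :: l, acc => c acc a + 18 + iterCost f c l (f acc a)

/-- A bound for the running time. -/
noncomputable def cost (ask : Data → Data) : FProg → Data → ℕ
  | comp g f, d => f.cost ask d + g.cost ask (f.eval ask d) + 1
  | pair f g, d => f.cost ask d + g.cost ask d + 1
  -- Both branches are charged, which makes the cost of an iteration-free program independent of its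
  -- input.
  | cond c f g, d => c.cost ask d + f.cost ask d + g.cost ask d + 1
  | fold l z b, d => l.cost ask d + z.cost ask d + 12 +
      iterCost (fun acc a => b.eval ask (.node a (.node acc d)))
        (fun acc a => b.cost ask (.node a (.node acc d))) (l.eval ask d).toList (z.eval ask d)
  | _, _ => 1

end FProg

/-- The program halts with the given output after at most `T` steps. -/
def RunsWithin (ask : Data → Data) (p : Prog) (d e : Data) (T : ℕ) : Prop :=
  ∃ t ≤ T, Runs ask p d e t

theorem RunsWithin.mono {ask : Data → Data} {p : Prog} {d e : Data} {T T' : ℕ}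
    (h : RunsWithin ask p d e T) (hT : T ≤ T') : RunsWithin ask p d e T' :=
  let ⟨t, ht, r⟩ := h
  ⟨t, ht.trans hT, r⟩

theorem RunsWithin.comp {ask : Data → Data} {g f : Prog} {d e r : Data} {S T : ℕ}
    (hf : RunsWithin ask f d e S) (hg : RunsWithin ask g e r T) :
    RunsWithin ask (.comp g f) d r (S + T + 1) := by
  obtain ⟨s, hs, rs⟩ := hf
  obtain ⟨t, ht, rt⟩ := hg
  exact ⟨s + t + 1, by omega, .comp rs rt⟩

theorem RunsWithin.pair {ask : Data → Data} {f g : Prog} {d a b : Data} {S T : ℕ}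
    (hf : RunsWithin ask f d a S) (hg : RunsWithin ask g d b T) :
    RunsWithin ask (.pair f g) d (.node a b) (S + T + 1) := by
  obtain ⟨s, hs, rs⟩ := hf
  obtain ⟨t, ht, rt⟩ := hg
  exact ⟨s + t + 1, by omega, .pair rs rt⟩

theorem Runs.loop_of_not_holds {ask : Data → Data} {c f : Prog} {d b : Data} {s : ℕ}
    (h : Runs ask c d b s) (hb : ¬ b.Holds) : Runs ask (.loop c f) d d (s + 1) := by
  constructor <;> assumption

theorem Data.holds_isNode_node (a l : Data) : (Data.isNode (.node a l)).Holds := by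
  simp [Data.isNode, Data.Holds]

/-- The state of the loop consists of the remaining list, the accumulator and the environment. The
final remainder `l'` is left open because a list may end in any datum that is not a pair. The 4 pays
for the last, failing test. -/
theorem runsWithin_loop {ask : Data → Data} {p : Prog} {f : Data → Data → Data}
    {c : Data → Data → ℕ} {d : Data}
    (hp : ∀ acc a, RunsWithin ask p (.node a (.node acc d)) (f acc a) (c acc a)) (l acc : Data) :
    ∃ l', RunsWithin ask
      (.loop (.comp .isNode .fst)
        (.pair (.comp .snd .fst)
          (.pair (.comp p (.pair (.comp .fst .fst) .snd)) (.comp .snd .snd))))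
      (.node l (.node acc d)) (.node l' (.node (l.toList.foldl f acc) d))
      (FProg.iterCost f c l.toList acc + 4) := by
  induction l generalizing acc with
  | nil =>
    exact ⟨.nil, 4, by simp [FProg.iterCost, Data.toList],
      .loop_of_not_holds (.comp (.fst _) (.isNode _)) (by simp [Data.isNode, Data.Holds, Data.fst])⟩
  | num x =>
    exact ⟨.num x, 4, by simp [FProg.iterCost, Data.toList],
      .loop_of_not_holds (.comp (.fst _) (.isNode _)) (by simp [Data.isNode, Data.Holds, Data.fst])⟩
  | node a l _ ih =>
    obtain ⟨l', t, ht, ih⟩ := ih (f acc a)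
    obtain ⟨s, hs, hp⟩ := hp acc a
    refine ⟨l', _, ?_, .loop_step (.comp (.fst _) (.isNode _)) (Data.holds_isNode_node a l)
      (.pair (.comp (.fst _) (.snd _))
        (.pair (.comp (.pair (.comp (.fst _) (.fst _)) (.snd _)) hp) (.comp (.snd _) (.snd _)))) ih⟩
    simp only [FProg.iterCost, Data.toList]
    omega

/-- This is the only link between the bounded language and the machine; afterwards, procedures are
analysed through `eval` and `cost` alone. -/
theorem FProg.runsWithin_compile (ask : Data → Data) (p : FProg) (d : Data) :
    RunsWithin ask p.compile d (p.eval ask d) (p.cost ask d) := by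
  induction p generalizing d with
  | id => exact ⟨1, le_rfl, .id d⟩
  | nil => exact ⟨1, le_rfl, .nil d⟩
  | const q => exact ⟨1, le_rfl, .const q d⟩
  | fst => exact ⟨1, le_rfl, .fst d⟩
  | snd => exact ⟨1, le_rfl, .snd d⟩
  | add => exact ⟨1, le_rfl, .add d⟩
  | sub => exact ⟨1, le_rfl, .sub d⟩
  | mul => exact ⟨1, le_rfl, .mul d⟩
  | query => exact ⟨1, le_rfl, .query d⟩
  | comp g f hg hf => exact (hf d).comp (hg _)
  | pair f g hf hg => exact (hf d).pair (hg d)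
  | cond c f g hc hf hg =>
    obtain ⟨s, hs, hc⟩ := hc d
    obtain ⟨t, ht, hf⟩ := hf d
    obtain ⟨u, hu, hg⟩ := hg d
    by_cases h : (c.eval ask d).Holds
    · exact ⟨s + t + 1, by simp only [cost]; omega, by
        rw [eval, if_pos h]
        exact .cond_true hc h hf⟩
    · exact ⟨s + u + 1, by simp only [cost]; omega, by
        rw [eval, if_neg h]
        exact .cond_false hc h hg⟩
  | fold l z b hl hz hb =>
    obtain ⟨l', h⟩ := runsWithin_loop (fun acc a => hb (.node a (.node acc d))) (l.eval ask d)
      (z.eval ask d)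
    have hid : RunsWithin ask .id d d 1 := ⟨1, le_rfl, .id d⟩
    have hout : ∀ e : Data, RunsWithin ask (.comp .fst .snd) e e.snd.fst 3 := fun e =>
      ⟨3, le_rfl, .comp (.snd _) (.fst _)⟩
    refine ((((hl d).pair ((hz d).pair hid)).comp h).comp (hout _)).mono ?_
    simp only [cost]
    omega

/-- The program that gives up its queries. -/
def Prog.withoutQueries : Prog → Prog
  | .query => .nil
  | .comp g f => .comp g.withoutQueries f.withoutQueries
  | .pair f g => .pair f.withoutQueries g.withoutQueries
  | .cond c f g => .cond c.withoutQueries f.withoutQueries g.withoutQueries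
  | .loop c f => .loop c.withoutQueries f.withoutQueries
  | p => p

/-- The planning program is specified without access to the state, but it becomes part of a program
that does have access. An unanswered query returns `nil` in one step, exactly like the instruction
`nil` that replaces it. -/
theorem Runs.withoutQueries {p : Prog} {d e : Data} {t : ℕ} (h : Runs noAccess p d e t)
    (ask : Data → Data) : Runs ask p.withoutQueries d e t := by
  induction h with
  | id d => exact .id d
  | nil d => exact .nil d
  | const q d => exact .const q d
  | fst d => exact .fst d
  | snd d => exact .snd d
  | isNode d => exact .isNode d
  | isNum d => exact .isNum d
  | add d => exact .add d
  | sub d => exact .sub d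
  | mul d => exact .mul d
  | div d => exact .div d
  | query d => exact .nil d
  | comp _ _ h₁ h₂ => exact .comp h₁ h₂
  | pair _ _ h₁ h₂ => exact .pair h₁ h₂
  | cond_true _ hb _ h₁ h₂ => exact .cond_true h₁ hb h₂
  | cond_false _ hb _ h₁ h₂ => exact .cond_false h₁ hb h₂
  | loop_step _ hb _ _ h₁ h₂ h₃ => exact .loop_step h₁ hb h₂ h₃
  | _ =>
    rename_i hb h₁
    exact .loop_of_not_holds h₁ hb

namespace FProg

/-! ### Costs -/

/-- The number of steps of a program without iteration. -/
def size : FProg → ℕ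
  | comp g f => f.size + g.size + 1
  | pair f g => f.size + g.size + 1
  | cond c f g => c.size + f.size + g.size + 1
  | _ => 1

/-- Programs without iteration. -/
def Flat : FProg → Prop
  | comp g f => f.Flat ∧ g.Flat
  | pair f g => f.Flat ∧ g.Flat
  | cond c f g => c.Flat ∧ f.Flat ∧ g.Flat
  | fold _ _ _ => False
  | _ => True

theorem Flat.cost_eq {p : FProg} (hp : p.Flat) (ask : Data → Data) (d : Data) :
    p.cost ask d = p.size := by
  induction p generalizing d with
  | comp g f hg hf => simp only [cost, size, hf hp.1, hg hp.2]
  | pair f g hf hg => simp only [cost, size, hf hp.1, hg hp.2]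
  | cond c f g hc hf hg => simp only [cost, size, hc hp.1, hf hp.2.1, hg hp.2.2]
  | fold l z b => exact hp.elim
  | _ => rfl

/-- The body need only be bounded at accumulators that are actually reached; at arbitrary ones its
cost may be unbounded. -/
theorem iterCost_le {f : Data → Data → Data} {c : Data → Data → ℕ} {l : List Data} {acc : Data}
    {B : ℕ} (h : ∀ pre a post, l = pre ++ a :: post → c (pre.foldl f acc) a ≤ B) :
    iterCost f c l acc ≤ l.length * (B + 18) := by
  induction l generalizing acc with
  | nil => simp [iterCost]
  | cons a l ih =>
    have h0 := h [] a l rfl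
    have h1 := ih (acc := f acc a) fun pre b post hl => h (a :: pre) b post (by simp [hl])
    simp only [List.foldl_nil] at h0
    simp only [iterCost, List.length_cons, Nat.add_mul, Nat.one_mul]
    omega

/-- Iteration, with the state and the list in decoded form. -/
theorem eval_fold_eq_of_prefix {σ α : Type*} (encS : σ → Data) (encA : α → Data) (step : σ → α → σ)
    {ask : Data → Data} {l z b : FProg} {d : Data} {xs : List α} {s₀ : σ}
    (hl : l.eval ask d = .ofList (xs.map encA)) (hz : z.eval ask d = encS s₀)
    (hb : ∀ pre a post, xs = pre ++ a :: post →
      b.eval ask (.node (encA a) (.node (encS (pre.foldl step s₀)) d)) =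
        encS (step (pre.foldl step s₀) a)) :
    (fold l z b).eval ask d = encS (xs.foldl step s₀) := by
  simp only [eval, hl, hz, Data.toList_ofList]
  clear hl hz
  induction xs generalizing s₀ with
  | nil => rfl
  | cons a xs ih =>
    have h0 := hb [] a xs rfl
    simp only [List.foldl_nil] at h0
    simp only [List.map_cons, List.foldl_cons, h0]
    exact ih fun pre a' post h => hb (a :: pre) a' post (by rw [h]; rfl)

theorem eval_fold_eq {σ α : Type*} (encS : σ → Data) (encA : α → Data) (step : σ → α → σ)
    {ask : Data → Data} {l z b : FProg} {d : Data} {xs : List α} {s₀ : σ}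
    (hl : l.eval ask d = .ofList (xs.map encA)) (hz : z.eval ask d = encS s₀)
    (hb : ∀ s a, a ∈ xs → b.eval ask (.node (encA a) (.node (encS s) d)) = encS (step s a)) :
    (fold l z b).eval ask d = encS (xs.foldl step s₀) :=
  eval_fold_eq_of_prefix encS encA step hl hz fun _ a _ h => hb _ a (by simp [h])

/-- Correctness of the body enters a cost bound because it identifies the data reached by the
iteration with encodings of the decoded states, where `B` applies. -/
theorem cost_fold_le {σ α : Type*} (encS : σ → Data) (encA : α → Data) (step : σ → α → σ)
    {ask : Data → Data} {l z b : FProg} {d : Data} {xs : List α} {s₀ : σ} {B : ℕ}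
    (hl : l.eval ask d = .ofList (xs.map encA)) (hz : z.eval ask d = encS s₀)
    (hb : ∀ pre a post, xs = pre ++ a :: post →
      b.eval ask (.node (encA a) (.node (encS (pre.foldl step s₀)) d)) =
        encS (step (pre.foldl step s₀) a))
    (hB : ∀ pre a post, xs = pre ++ a :: post →
      b.cost ask (.node (encA a) (.node (encS (pre.foldl step s₀)) d)) ≤ B) :
    (fold l z b).cost ask d ≤ l.cost ask d + z.cost ask d + 12 + xs.length * (B + 18) := by
  simp only [cost, hl, hz, Data.toList_ofList]
  refine Nat.add_le_add_left ((iterCost_le (B := B) ?_).trans_eq (by simp)) _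
  intro pre' a' post' h
  obtain ⟨pre, post, rfl, rfl, h2⟩ := List.map_eq_append_iff.1 h
  obtain ⟨a, post, rfl, rfl, rfl⟩ := List.map_eq_cons_iff.1 h2
  refine le_of_eq_of_le ?_ (hB pre a post rfl)
  congr 3
  have hb' : ∀ pre' a' post', pre = pre' ++ a' :: post' →
      b.eval ask (.node (encA a') (.node (encS (pre'.foldl step s₀)) d)) =
        encS (step (pre'.foldl step s₀) a') :=
    fun pre' a' post' h => hb pre' a' (post' ++ a :: post) (by rw [h]; simp)
  clear hB hl hz h hb h2
  induction pre generalizing s₀ with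
  | nil => rfl
  | cons a pre ih =>
    have h0 := hb' [] a pre rfl
    simp only [List.foldl_nil] at h0
    simp only [List.map_cons, List.foldl_cons, h0]
    exact ih fun pre' a' post h => hb' (a :: pre') a' post (by rw [h]; rfl)

end FProg

/-! ### Tensor products of single-qubit operators -/

/-- The tensor product of single-qubit operators. -/
def tens {n : ℕ} (B : Fin n → Matrix (Fin 2) (Fin 2) ℂ) : Op n :=
  fun x y => ∏ k, B k (x k) (y k)

theorem PauliString.op_eq_tens {n : ℕ} (P : PauliString n) : P.op = tens fun k => pauli (P k) := rfl

theorem tens_mul {n : ℕ} (B C : Fin n → Matrix (Fin 2) (Fin 2) ℂ) :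
    tens B * tens C = tens fun k => B k * C k := by
  ext x z
  simp only [tens, Matrix.mul_apply, ← Finset.prod_mul_distrib]
  rw [Finset.prod_univ_sum, Fintype.piFinset_univ]

theorem trace_tens {n : ℕ} (B : Fin n → Matrix (Fin 2) (Fin 2) ℂ) :
    (tens B).trace = ∏ k, (B k).trace := by
  simp only [Matrix.trace, Matrix.diag, tens]
  rw [Finset.prod_univ_sum, Fintype.piFinset_univ]

theorem tens_one {n : ℕ} : tens (fun _ : Fin n => (1 : Matrix (Fin 2) (Fin 2) ℂ)) = 1 := by
  ext x y
  simp only [tens, Matrix.one_apply, Finset.prod_ite_zero, Finset.prod_const_one, Finset.mem_univ,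
    true_implies, funext_iff]

theorem conjTranspose_tens {n : ℕ} (B : Fin n → Matrix (Fin 2) (Fin 2) ℂ) :
    (tens B)ᴴ = tens fun k => (B k)ᴴ := by
  ext x y
  simp [tens, Matrix.conjTranspose_apply]

/-! ### Single-qubit Pauli operators -/

theorem pauli_zero : pauli 0 = 1 := by
  ext i j; fin_cases i <;> fin_cases j <;> simp [pauli]

theorem conjTranspose_pauli (a : Fin 4) : (pauli a)ᴴ = pauli a := by
  fin_cases a <;> ext i j <;> fin_cases i <;> fin_cases j <;> simp [pauli]

theorem pauli_mul_self (a : Fin 4) : pauli a * pauli a = 1 := by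
  fin_cases a <;> ext i j <;> fin_cases i <;> fin_cases j <;>
    simp [pauli]

theorem trace_pauli_mul (a b : Fin 4) : (pauli a * pauli b).trace = if a = b then 2 else 0 := by
  fin_cases a <;> fin_cases b <;> simp [pauli, Matrix.trace, Fin.sum_univ_two] <;> norm_num

/-- Completeness of the single-qubit Pauli operators. -/
theorem sum_pauli_mul_pauli (x y z w : Fin 2) :
    ∑ a, pauli a x y * pauli a z w = if x = w ∧ y = z then 2 else 0 := by
  fin_cases x <;> fin_cases y <;> fin_cases z <;> fin_cases w <;>
    simp [pauli, Fin.sum_univ_four] <;> norm_num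

/-- Twirling over the single-qubit Pauli operators. -/
theorem sum_pauli_conj_pauli (b : Fin 4) :
    ∑ a, pauli a * pauli b * pauli a = if b = 0 then (4 : ℂ) • 1 else 0 := by
  ext x y
  fin_cases b <;> fin_cases x <;> fin_cases y <;>
    simp [pauli, Fin.sum_univ_four] <;> norm_num

/-! ### Pauli operators -/

theorem PauliString.conjTranspose_op {n : ℕ} (P : PauliString n) : P.opᴴ = P.op := by
  simp only [PauliString.op_eq_tens, conjTranspose_tens, conjTranspose_pauli]

theorem PauliString.op_mul_self {n : ℕ} (P : PauliString n) : P.op * P.op = 1 := by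
  simp only [PauliString.op_eq_tens, tens_mul, pauli_mul_self, tens_one]

theorem PauliString.trace_op_mul {n : ℕ} (P Q : PauliString n) :
    (P.op * Q.op).trace = if P = Q then 2 ^ n else 0 := by
  simp only [PauliString.op_eq_tens, tens_mul, trace_tens, trace_pauli_mul]
  by_cases h : P = Q
  · simp [h]
  · obtain ⟨k, hk⟩ := Function.ne_iff.1 h
    rw [if_neg h]
    exact Finset.prod_eq_zero (Finset.mem_univ k) (if_neg hk)

/-- The Hilbert–Schmidt norm of a real combination of Pauli operators. -/
theorem trace_sq_sum_pauli {n : ℕ} (F : PauliString n → ℝ) :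
    ((∑ P, (F P : ℂ) • P.op) * (∑ P, (F P : ℂ) • P.op)).trace = ((2 ^ n * ∑ P, F P ^ 2 : ℝ) : ℂ) := by
  simp only [Finset.sum_mul, Finset.mul_sum, Matrix.trace_sum, smul_mul_assoc, mul_smul_comm,
    Matrix.trace_smul, PauliString.trace_op_mul, smul_eq_mul, mul_ite, mul_zero]
  push_cast
  simp only [Finset.sum_ite_eq', Finset.mem_univ, if_true]
  exact Finset.sum_congr rfl fun P _ => by ring

/-! ### Single-qubit operators acting on one of many qubits -/

/-- A single-qubit operator acting on qubit `j`. -/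
def site {n : ℕ} (j : Fin n) (A : Matrix (Fin 2) (Fin 2) ℂ) : Op n :=
  tens (Function.update (fun _ => 1) j A)

theorem site_apply {n : ℕ} (j : Fin n) (A : Matrix (Fin 2) (Fin 2) ℂ) (x : Bits n) (z : Bits n) :
    site j A x z = if ∀ k, k ≠ j → x k = z k then A (x j) (z j) else 0 := by
  simp only [site, tens]
  rw [← Finset.mul_prod_erase _ _ (Finset.mem_univ j), Function.update_self]
  have : ∀ k ∈ Finset.univ.erase j, (Function.update (fun _ => (1 : Matrix (Fin 2) (Fin 2) ℂ)) j A) k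
      (x k) (z k) = if x k = z k then 1 else 0 := fun k hk => by
    rw [Function.update_of_ne (Finset.ne_of_mem_erase hk), Matrix.one_apply]
  rw [Finset.prod_congr rfl this, Finset.prod_ite_zero]
  simp

theorem site_mul_apply {n : ℕ} (j : Fin n) (A : Matrix (Fin 2) (Fin 2) ℂ) (σ : Op n) (x y : Bits n) :
    (site j A * σ) x y = ∑ b, A (x j) b * σ (Function.update x j b) y := by
  rw [Matrix.mul_apply]
  -- Only labels that agree with `x` away from `j` contribute, and these are parametrized by their
  -- bit at `j`.
  refine (Fintype.sum_of_injective (Function.update x j) (Function.update_injective x j) _ _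
    (fun z hz => ?_) fun b => ?_).symm
  · rw [site_apply, if_neg, zero_mul]
    rintro h
    exact hz ⟨z j, by
      ext k
      by_cases hk : k = j
      · subst hk; simp
      · simp [hk, h k hk]⟩
  · rw [site_apply, if_pos fun k hk => by simp [hk]]
    simp

theorem mul_site_apply {n : ℕ} (j : Fin n) (A : Matrix (Fin 2) (Fin 2) ℂ) (σ : Op n) (x y : Bits n) :
    (σ * site j A) x y = ∑ b, σ x (Function.update y j b) * A b (y j) := by
  rw [Matrix.mul_apply]
  refine (Fintype.sum_of_injective (Function.update y j) (Function.update_injective y j) _ _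
    (fun z hz => ?_) fun b => ?_).symm
  · rw [site_apply, if_neg, mul_zero]
    rintro h
    exact hz ⟨z j, by
      ext k
      by_cases hk : k = j
      · subst hk; simp
      · simp [hk, h k hk]⟩
  · rw [site_apply, if_pos fun k hk => by simp [hk]]
    simp

/-- Depolarizing noise as a mixture of Pauli errors. -/
theorem depolarize_eq {n : ℕ} (a : ℝ) (j : Fin n) (σ : Op n) :
    depolarize a j σ = (a : ℂ) • σ +
      ((1 - (a : ℂ)) / 4) • ∑ c, site j (pauli c) * σ * site j (pauli c) := by
  ext x y
  have h : (∑ c, site j (pauli c) * σ * site j (pauli c)) x y =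
      if x j = y j then 2 * ∑ b, σ (Function.update x j b) (Function.update y j b) else 0 := by
    simp only [Matrix.sum_apply, mul_site_apply, site_mul_apply, Finset.sum_mul]
    rw [Finset.sum_comm]
    simp_rw [Finset.sum_comm (s := (Finset.univ : Finset (Fin 4)))]
    have : ∀ b b' : Fin 2, ∑ c, pauli c (x j) b' * σ (Function.update x j b') (Function.update y j b) *
        pauli c b (y j) = if x j = y j ∧ b' = b then
          2 * σ (Function.update x j b') (Function.update y j b) else 0 := fun b b' => by
      have := sum_pauli_mul_pauli (x j) b' b (y j)
      calc _ = (∑ c, pauli c (x j) b' * pauli c b (y j)) *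
            σ (Function.update x j b') (Function.update y j b) := by
            rw [Finset.sum_mul]; exact Finset.sum_congr rfl fun c _ => by ring
        _ = _ := by rw [this]; split_ifs <;> simp
    simp_rw [this]
    by_cases hxy : x j = y j
    · simp [hxy, mul_add]
    · simp [hxy]
  simp only [depolarize, Matrix.add_apply, Matrix.smul_apply, smul_eq_mul, h]
  split_ifs <;> ring

theorem site_mul_op_mul_site {n : ℕ} (j : Fin n) (A B : Matrix (Fin 2) (Fin 2) ℂ)
    (P : PauliString n) : site j A * P.op * site j B =
      tens (Function.update (fun k => pauli (P k)) j (A * pauli (P j) * B)) := by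
  simp only [site, PauliString.op_eq_tens, tens_mul]
  congr 1
  ext k : 1
  by_cases hk : k = j
  · subst hk; simp
  · simp [hk]

theorem tens_update_sum {n : ℕ} {ι : Type*} (s : Finset ι) (B : Fin n → Matrix (Fin 2) (Fin 2) ℂ)
    (j : Fin n) (A : ι → Matrix (Fin 2) (Fin 2) ℂ) :
    tens (Function.update B j (∑ c ∈ s, A c)) = ∑ c ∈ s, tens (Function.update B j (A c)) := by
  ext x y
  simp only [Matrix.sum_apply, tens]
  have h : ∀ M : Matrix (Fin 2) (Fin 2) ℂ, ∏ k, Function.update B j M k (x k) (y k) =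
      M (x j) (y j) * ∏ k ∈ Finset.univ.erase j, B k (x k) (y k) := fun M => by
    rw [← Finset.mul_prod_erase _ _ (Finset.mem_univ j), Function.update_self]
    congr 1
    exact Finset.prod_congr rfl fun k hk => by
      rw [Function.update_of_ne (Finset.ne_of_mem_erase hk)]
  simp only [h, Matrix.sum_apply, Finset.sum_mul]

theorem tens_update_smul {n : ℕ} (B : Fin n → Matrix (Fin 2) (Fin 2) ℂ) (j : Fin n) (c : ℂ)
    (A : Matrix (Fin 2) (Fin 2) ℂ) :
    tens (Function.update B j (c • A)) = c • tens (Function.update B j A) := by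
  ext x y
  simp only [Matrix.smul_apply, tens]
  have h : ∀ M : Matrix (Fin 2) (Fin 2) ℂ, ∏ k, Function.update B j M k (x k) (y k) =
      M (x j) (y j) * ∏ k ∈ Finset.univ.erase j, B k (x k) (y k) := fun M => by
    rw [← Finset.mul_prod_erase _ _ (Finset.mem_univ j), Function.update_self]
    congr 1
    exact Finset.prod_congr rfl fun k hk => by
      rw [Function.update_of_ne (Finset.ne_of_mem_erase hk)]
  simp only [h, Matrix.smul_apply, smul_eq_mul, mul_assoc]

/-- Depolarizing noise in the Heisenberg picture. -/
theorem trace_depolarize_mul {n : ℕ} (a : ℝ) (j : Fin n) (σ : Op n) (P : PauliString n) :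
    (depolarize a j σ * P.op).trace = (if P j = 0 then 1 else (a : ℂ)) * (σ * P.op).trace := by
  -- Twirling qubit `j` annihilates a nontrivial Pauli factor there and multiplies the identity by
  -- 4.
  have h : ∑ c, site j (pauli c) * P.op * site j (pauli c) =
      (if P j = 0 then (4 : ℂ) else 0) • P.op := by
    simp only [site_mul_op_mul_site]
    rw [← tens_update_sum, sum_pauli_conj_pauli]
    split_ifs with h0
    · rw [tens_update_smul, ← pauli_zero, ← h0]
      congr 2
      exact Function.update_eq_self _ _
    · have := tens_update_smul (fun k => pauli (P k)) j 0 0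
      simpa using this
  have h2 : ((∑ c, site j (pauli c) * σ * site j (pauli c)) * P.op).trace =
      (if P j = 0 then (4 : ℂ) else 0) * (σ * P.op).trace := by
    rw [← smul_eq_mul (_ : ℂ), ← Matrix.trace_smul, ← mul_smul_comm, ← h, Finset.sum_mul, Finset.mul_sum,
      Matrix.trace_sum, Matrix.trace_sum]
    refine Finset.sum_congr rfl fun c _ => ?_
    rw [Matrix.mul_assoc, Matrix.mul_assoc, Matrix.trace_mul_comm]
    simp only [Matrix.mul_assoc]
  rw [depolarize_eq, add_mul, smul_mul_assoc, smul_mul_assoc, Matrix.trace_add, Matrix.trace_smul,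
    Matrix.trace_smul, h2]
  split_ifs <;> simp only [smul_eq_mul] <;> ring

/-- The number of qubits on which a Pauli operator is not the identity. -/
def PauliString.weight {n : ℕ} (P : PauliString n) : ℕ := (Finset.univ.filter fun k => P k ≠ 0).card

/-- Pauli operators are eigenvectors of the noise: each qubit of the support contributes one factor
`a`. This is why the total weight of a path governs its size. -/
theorem trace_depolarizeAll_mul {n : ℕ} (a : ℝ) (σ : Op n) (P : PauliString n) :
    (depolarizeAll a σ * P.op).trace = (a : ℂ) ^ P.weight * (σ * P.op).trace := by
  have h : ∀ (l : List (Fin n)) (σ : Op n),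
      (l.foldl (fun τ j => depolarize a j τ) σ * P.op).trace =
        (l.map fun j => if P j = 0 then 1 else (a : ℂ)).prod * (σ * P.op).trace := by
    intro l
    induction l with
    | nil => simp
    | cons j l ih =>
      intro σ
      simp only [List.foldl_cons, ih, trace_depolarize_mul, List.map_cons, List.prod_cons]
      ring
  rw [depolarizeAll, h, ← List.ofFn_eq_map, List.prod_ofFn, PauliString.weight, Finset.prod_ite]
  simp

theorem PauliString.op_zero {n : ℕ} : PauliString.op (0 : PauliString n) = 1 := by
  simp [PauliString.op_eq_tens, pauli_zero, tens_one]

theorem trace_depolarizeAll {n : ℕ} (a : ℝ) (σ : Op n) : (depolarizeAll a σ).trace = σ.trace := by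
  simpa [PauliString.op_zero, PauliString.weight] using trace_depolarizeAll_mul a σ 0

/-! ### Positivity -/

theorem posSemidef_depolarize {n : ℕ} {a : ℝ} (h0 : 0 ≤ a) (h1 : a ≤ 1) (j : Fin n) {σ : Op n}
    (hσ : σ.PosSemidef) : (depolarize a j σ).PosSemidef := by
  have hs : ∀ c, (site (n := n) j (pauli c))ᴴ = site j (pauli c) := fun c => by
    rw [site, conjTranspose_tens]
    congr 1
    ext k : 1
    by_cases hk : k = j
    · subst hk; simp [conjTranspose_pauli]
    · simp [hk]
  rw [depolarize_eq]
  refine (hσ.smul (by exact_mod_cast h0)).add (Matrix.PosSemidef.smul ?_ ?_)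
  · refine Matrix.posSemidef_sum _ fun c _ => ?_
    have := hσ.mul_mul_conjTranspose_same (site j (pauli c))
    rwa [hs] at this
  · have : (1 - (a : ℂ)) / 4 = (((1 - a) / 4 : ℝ) : ℂ) := by push_cast; rfl
    rw [this]
    exact_mod_cast by linarith

theorem posSemidef_depolarizeAll {n : ℕ} {a : ℝ} (h0 : 0 ≤ a) (h1 : a ≤ 1) {σ : Op n}
    (hσ : σ.PosSemidef) : (depolarizeAll a σ).PosSemidef := by
  unfold depolarizeAll
  induction List.finRange n generalizing σ with
  | nil => exact hσ
  | cons j l ih => exact ih (posSemidef_depolarize h0 h1 j hσ)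

theorem IsState.depolarizeAll {n : ℕ} {a : ℝ} (h0 : 0 ≤ a) (h1 : a ≤ 1) {σ : Op n}
    (hσ : IsState σ) : IsState (depolarizeAll a σ) :=
  ⟨posSemidef_depolarizeAll h0 h1 hσ.1, (trace_depolarizeAll a σ).trans hσ.2⟩

theorem IsState.conj {n : ℕ} {σ U : Op n} (hσ : IsState σ) (hU : Uᴴ * U = 1) :
    IsState (U * σ * Uᴴ) :=
  ⟨hσ.1.mul_mul_conjTranspose_same U, by
    rw [Matrix.trace_mul_comm, ← Matrix.mul_assoc, hU, Matrix.one_mul, hσ.2]⟩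

theorem trace_mul_conjTranspose_mul_nonneg {n : ℕ} {ρ : Op n} (hρ : ρ.PosSemidef) (A : Op n) :
    0 ≤ (ρ * (A * Aᴴ)).trace.re := by
  have h : (ρ * (A * Aᴴ)).trace = (Aᴴ * ρ * A).trace := by
    rw [← Matrix.mul_assoc, Matrix.trace_mul_comm, ← Matrix.mul_assoc]
  rw [h]
  exact (Complex.nonneg_iff.1 (hρ.conjTranspose_mul_mul_same A).trace_nonneg).1

/-- The square of an expectation value is at most the expectation value of the square. -/
theorem sq_trace_re_le {n : ℕ} {ρ : Op n} (hρ : IsState ρ) {A : Op n} (hA : Aᴴ = A) :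
    (ρ * A).trace.re ^ 2 ≤ (ρ * (A * A)).trace.re := by
  set t : ℝ := (ρ * A).trace.re with ht
  -- The variance of `A` in the state is nonnegative.
  have h := trace_mul_conjTranspose_mul_nonneg hρ.1 (A - (t : ℂ) • 1)
  have h2 : (ρ * ((A - (t : ℂ) • 1) * (A - (t : ℂ) • 1)ᴴ)).trace =
      (ρ * (A * A)).trace - (2 * t : ℝ) * (ρ * A).trace + (t ^ 2 : ℝ) := by
    rw [Matrix.conjTranspose_sub, Matrix.conjTranspose_smul, hA, Matrix.conjTranspose_one]
    simp only [sub_mul, mul_sub, Matrix.trace_sub, smul_mul_assoc, mul_smul_comm, Matrix.one_mul,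
      Matrix.mul_one, Matrix.trace_smul, hρ.2, smul_eq_mul, Complex.star_def, Complex.conj_ofReal]
    push_cast
    ring
  rw [h2, Complex.add_re, Complex.sub_re, Complex.re_ofReal_mul, Complex.ofReal_re, ← ht] at h
  nlinarith

theorem bornProb_eq {n : ℕ} (O : PauliString n) {σ : Op n} (hσ : σ.trace = 1) (b : Bool) :
    bornProb O σ b = (1 + sign b * (σ * O.op).trace.re) / 2 := by
  rw [bornProb, smul_mul_assoc, Matrix.trace_smul, add_mul, Matrix.one_mul, Matrix.trace_add, hσ,
    smul_mul_assoc, Matrix.trace_smul, Matrix.trace_mul_comm]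
  have : ((1 / 2 : ℂ) • (1 + (sign b : ℂ) • (σ * O.op).trace)).re =
      (((1 / 2 : ℝ) : ℂ) * (1 + (sign b : ℂ) * (σ * O.op).trace)).re := by
    push_cast; rfl
  rw [this, Complex.re_ofReal_mul, Complex.add_re, Complex.re_ofReal_mul, Complex.one_re]
  ring

theorem abs_trace_mul_op_le_one {n : ℕ} (O : PauliString n) {σ : Op n} (hσ : IsState σ) :
    |(σ * O.op).trace.re| ≤ 1 := by
  have h := sq_trace_re_le hσ O.conjTranspose_op
  rw [O.op_mul_self, Matrix.mul_one, hσ.2, Complex.one_re] at h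
  exact (sq_le_one_iff_abs_le_one _).1 h

theorem bornProb_nonneg {n : ℕ} (O : PauliString n) {σ : Op n} (hσ : IsState σ) (b : Bool) :
    0 ≤ bornProb O σ b := by
  rw [bornProb_eq O hσ.2]
  have := abs_le.1 (abs_trace_mul_op_le_one O hσ)
  cases b <;> simp only [sign] <;> norm_num <;> linarith

theorem bornProb_add {n : ℕ} (O : PauliString n) {σ : Op n} (hσ : σ.trace = 1) :
    bornProb O σ true + bornProb O σ false = 1 := by
  rw [bornProb_eq O hσ, bornProb_eq O hσ]
  simp only [sign]
  norm_num
  ring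

/-- Second moments of a low-average ensemble. -/
theorem Ensemble.IsLowAverage.mean_sq_le {n : ℕ} {E : Ensemble n} {c : ℝ} (hE : E.IsLowAverage c)
    {A : Op n} (hA : Aᴴ = A) :
    E.mean (fun ω => (E.state ω * A).trace.re ^ 2) ≤ c / 2 ^ n * (A * A).trace.re := by
  -- The second moment is not linear in the state, but it is dominated by the expectation of `A *
  -- A`, which is; so only the mixture matters.
  have h1 : E.mean (fun ω => (E.state ω * A).trace.re ^ 2) ≤ (E.mixture * (A * A)).trace.re := by
    have : (E.mixture * (A * A)).trace.re = E.mean fun ω => (E.state ω * (A * A)).trace.re := by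
      rw [Ensemble.mixture, Ensemble.mean, smul_mul_assoc, Matrix.trace_smul, Finset.sum_mul,
        Matrix.trace_sum, smul_eq_mul]
      have : ((E.size : ℂ))⁻¹ = (((E.size : ℝ)⁻¹ : ℝ) : ℂ) := by push_cast; rfl
      rw [this, Complex.re_ofReal_mul, Complex.re_sum]
    rw [this]
    exact mul_le_mul_of_nonneg_left (Finset.sum_le_sum fun ω _ => sq_trace_re_le (E.isState ω) hA)
      (by positivity)
  refine h1.trans ?_
  set T := Matrix.toEuclideanCLM (n := Bits n) (𝕜 := ℂ) E.mixture with hT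
  -- With the columns of `A` as vectors, the trace of the mixture times `A * A` is a sum of
  -- quadratic forms, each controlled by the operator norm, and the squared norms add up to the
  -- trace of `A * A`.
  let v : Bits n → EuclideanSpace ℂ (Bits n) := fun x => WithLp.toLp 2 fun y => A y x
  have h2 : (E.mixture * (A * A)).trace = ∑ x, inner ℂ (v x) (T (v x)) := by
    rw [← Matrix.mul_assoc, Matrix.trace_mul_comm]
    refine Finset.sum_congr rfl fun x _ => ?_
    rw [Matrix.diag_apply, Matrix.mul_apply]
    simp only [v, hT, PiLp.inner_apply, RCLike.inner_apply]
    refine Finset.sum_congr rfl fun y _ => ?_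
    rw [Matrix.toEuclideanCLM_toLp]
    have : A x y = star (A y x) := by
      conv_lhs => rw [← hA]
      rfl
    rw [this, mul_comm]
    rfl
  have h3 : (A * A).trace = ((∑ x, ‖v x‖ ^ 2 : ℝ) : ℂ) := by
    rw [Complex.ofReal_sum]
    refine Finset.sum_congr rfl fun x _ => ?_
    rw [Matrix.diag_apply, Matrix.mul_apply, EuclideanSpace.norm_sq_eq, Complex.ofReal_sum]
    refine Finset.sum_congr rfl fun y _ => ?_
    have : A x y = star (A y x) := by
      conv_lhs => rw [← hA]
      rfl
    rw [this]
    simp only [v, Complex.star_def, Complex.conj_mul', Complex.ofReal_pow]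
  rw [h2, h3, Complex.re_sum, Complex.ofReal_re, Finset.mul_sum]
  refine Finset.sum_le_sum fun x _ => ?_
  calc (inner ℂ (v x) (T (v x))).re ≤ ‖inner ℂ (v x) (T (v x))‖ := Complex.re_le_norm _
    _ ≤ ‖v x‖ * ‖T (v x)‖ := norm_inner_le_norm _ _
    _ ≤ ‖v x‖ * (c / 2 ^ n * ‖v x‖) := by
      gcongr
      exact (T.le_opNorm _).trans (by gcongr; exact hE)
    _ = _ := by ring

/-! ### Two-qubit operators -/

/-- An operator on the ordered pair of qubits `i, j`, the identity on the other qubits. -/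
def pairOp {n : ℕ} (i j : Fin n) (M : Matrix (Fin 2 × Fin 2) (Fin 2 × Fin 2) ℂ) : Op n := fun x y =>
  if ∀ k, k ≠ i → k ≠ j → x k = y k then M (x i, x j) (y i, y j) else 0

theorem Gate.op_eq_pairOp {n : ℕ} (g : Gate n) : g.op = pairOp g.i g.j g.u := rfl

/-- Replace the values at two places. -/
def update₂ {n : ℕ} {α : Type*} (x : Fin n → α) (i j : Fin n) (s : α × α) : Fin n → α :=
  Function.update (Function.update x i s.1) j s.2

section update₂
variable {n : ℕ} {α : Type*} (x : Fin n → α) {i j : Fin n} (s : α × α)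

theorem update₂_left (h : i ≠ j) : update₂ x i j s i = s.1 := by simp [update₂, h]

theorem update₂_right : update₂ x i j s j = s.2 := by simp [update₂]

theorem update₂_of_ne {k : Fin n} (hi : k ≠ i) (hj : k ≠ j) : update₂ x i j s k = x k := by
  simp [update₂, hi, hj]

theorem update₂_injective (h : i ≠ j) : Function.Injective (update₂ x i j) := fun s t hst =>
  Prod.ext (by rw [← update₂_left x s h, hst, update₂_left x t h])
    (by rw [← update₂_right x (i := i) s, hst, update₂_right x t])

theorem eq_update₂ {y : Fin n → α} (h : ∀ k, k ≠ i → k ≠ j → x k = y k) (hij : i ≠ j) :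
    update₂ x i j (y i, y j) = y := by
  ext k
  by_cases hj : k = j
  · subst hj; rw [update₂_right]
  · by_cases hi : k = i
    · subst hi; rw [update₂_left _ _ hij]
    · rw [update₂_of_ne _ _ hi hj, h k hi hj]

end update₂

theorem pairOp_mul_apply {n : ℕ} {i j : Fin n} (h : i ≠ j)
    (M : Matrix (Fin 2 × Fin 2) (Fin 2 × Fin 2) ℂ) (σ : Op n) (x y : Bits n) :
    (pairOp i j M * σ) x y = ∑ s, M (x i, x j) s * σ (update₂ x i j s) y := by
  rw [Matrix.mul_apply]
  refine (Fintype.sum_of_injective (update₂ x i j) (update₂_injective x h) _ _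
    (fun z hz => ?_) fun s => ?_).symm
  · rw [pairOp, if_neg, zero_mul]
    exact fun hk => hz ⟨_, eq_update₂ x hk h⟩
  · rw [pairOp, if_pos fun k hi hj => (update₂_of_ne x s hi hj).symm, update₂_left x s h,
      update₂_right]

theorem mul_pairOp_apply {n : ℕ} {i j : Fin n} (h : i ≠ j)
    (M : Matrix (Fin 2 × Fin 2) (Fin 2 × Fin 2) ℂ) (σ : Op n) (x y : Bits n) :
    (σ * pairOp i j M) x y = ∑ s, σ x (update₂ y i j s) * M s (y i, y j) := by
  rw [Matrix.mul_apply]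
  refine (Fintype.sum_of_injective (update₂ y i j) (update₂_injective y h) _ _
    (fun z hz => ?_) fun s => ?_).symm
  · rw [pairOp, if_neg, mul_zero]
    exact fun hk => hz ⟨_, eq_update₂ y (fun k hi hj => (hk k hi hj).symm) h⟩
  · rw [pairOp, if_pos fun k hi hj => update₂_of_ne y s hi hj, update₂_left y s h, update₂_right]

theorem conjTranspose_pairOp {n : ℕ} (i j : Fin n)
    (M : Matrix (Fin 2 × Fin 2) (Fin 2 × Fin 2) ℂ) : (pairOp i j M)ᴴ = pairOp i j Mᴴ := by
  ext x y
  simp only [Matrix.conjTranspose_apply, pairOp, eq_comm (a := y _)]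
  split_ifs <;> simp

theorem pairOp_mul_pairOp {n : ℕ} {i j : Fin n} (h : i ≠ j)
    (M N : Matrix (Fin 2 × Fin 2) (Fin 2 × Fin 2) ℂ) :
    pairOp i j M * pairOp i j N = pairOp i j (M * N) := by
  ext x y
  rw [pairOp_mul_apply h]
  simp only [pairOp, update₂_left _ _ h, update₂_right, Matrix.mul_apply]
  have : ∀ s, (∀ k, k ≠ i → k ≠ j → update₂ x i j s k = y k) ↔ ∀ k, k ≠ i → k ≠ j → x k = y k :=
    fun s => forall_congr' fun k => forall_congr' fun hi => forall_congr' fun hj => by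
      rw [update₂_of_ne _ _ hi hj]
  simp only [this]
  split_ifs <;> simp

theorem pairOp_one {n : ℕ} {i j : Fin n} (h : i ≠ j) : pairOp i j 1 = 1 := by
  ext x y
  simp only [pairOp, Matrix.one_apply, ← ite_and]
  congr 1
  refine propext ⟨fun ⟨h1, h2⟩ => ?_, fun h => ⟨fun _ _ _ => by rw [h], by rw [h]⟩⟩
  rw [← eq_update₂ x h1 h, ← h2, eq_update₂ x (fun _ _ _ => rfl) h]

theorem Gate.conjTranspose_op_mul_op {n : ℕ} (g : Gate n) : g.opᴴ * g.op = 1 := by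
  rw [Gate.op_eq_pairOp, conjTranspose_pairOp, pairOp_mul_pairOp g.ne]
  rw [← Matrix.star_eq_conjTranspose, Unitary.star_mul_self_of_mem g.unitary, pairOp_one g.ne]

theorem Gate.op_mul_conjTranspose_op {n : ℕ} (g : Gate n) : g.op * g.opᴴ = 1 :=
  mul_eq_one_comm.1 g.conjTranspose_op_mul_op

theorem Layer.conjTranspose_op_mul_op {n : ℕ} (L : Layer n) : L.opᴴ * L.op = 1 := by
  unfold Layer.op
  induction L.gates with
  | nil => simp
  | cons g l ih =>
    rw [List.map_cons, List.prod_cons, Matrix.conjTranspose_mul, Matrix.mul_assoc,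
      ← Matrix.mul_assoc _ g.op, g.conjTranspose_op_mul_op, Matrix.one_mul, ih]

theorem IsState.ideal {n : ℕ} {ρ : Op n} (hρ : IsState ρ) (C : Circuit n) :
    IsState (Circuit.ideal C ρ) := by
  unfold Circuit.ideal
  induction C generalizing ρ with
  | nil => exact hρ
  | cons L C ih => exact ih (hρ.conj L.conjTranspose_op_mul_op)

theorem IsState.run {n : ℕ} {γ : ℝ} {ρ : Op n} (hρ : IsState ρ) (hγ : 0 ≤ γ)
    (C : NoisyCircuit n γ) : IsState (C.run ρ) := by
  have h0 := (Real.exp_pos (-C.rate)).le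
  have h1 : Real.exp (-C.rate) ≤ 1 := Real.exp_le_one_iff.2 (by linarith [C.le_rate])
  unfold NoisyCircuit.run
  have := hρ.depolarizeAll h0 h1
  generalize QEM.depolarizeAll (Real.exp (-C.rate)) ρ = σ at this
  induction C.layers generalizing σ with
  | nil => exact this
  | cons L l ih => exact ih _ ((this.conj L.conjTranspose_op_mul_op).depolarizeAll h0 h1)

/-- The two-qubit Pauli operators. -/
def pauli₂ (a : Fin 4 × Fin 4) : Matrix (Fin 2 × Fin 2) (Fin 2 × Fin 2) ℂ :=
  fun s t => pauli a.1 s.1 t.1 * pauli a.2 s.2 t.2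

theorem conjTranspose_pauli₂ (a : Fin 4 × Fin 4) : (pauli₂ a)ᴴ = pauli₂ a := by
  ext s t
  have h : ∀ b x y, star (pauli b y x) = pauli b x y := fun b x y => by
    conv_rhs => rw [← conjTranspose_pauli b]
    rfl
  simp only [Matrix.conjTranspose_apply, pauli₂, star_mul', h]

/-- The two-qubit Pauli operators are an orthogonal basis whose elements have squared
Hilbert–Schmidt norm 4, which explains the denominator. -/
theorem eq_sum_pauli₂ (M : Matrix (Fin 2 × Fin 2) (Fin 2 × Fin 2) ℂ) :
    M = ∑ q, ((M * pauli₂ q).trace / 4) • pauli₂ q := by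
  ext s t
  have h : ∀ w x : Fin 2 × Fin 2, ∑ q : Fin 4 × Fin 4, pauli₂ q x w * pauli₂ q s t =
      if x = t ∧ w = s then 4 else 0 := fun w x => by
    simp only [pauli₂, Fintype.sum_prod_type, Prod.ext_iff]
    calc _ = (∑ a, pauli a x.1 w.1 * pauli a s.1 t.1) * (∑ b, pauli b x.2 w.2 * pauli b s.2 t.2) := by
          rw [Finset.sum_mul_sum]
          exact Finset.sum_congr rfl fun a _ => Finset.sum_congr rfl fun b _ => by ring
      _ = _ := by
          rw [sum_pauli_mul_pauli, sum_pauli_mul_pauli]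
          by_cases h1 : x.1 = t.1 <;> by_cases h2 : w.1 = s.1 <;> by_cases h3 : x.2 = t.2 <;>
            by_cases h4 : w.2 = s.2 <;> simp [h1, h2, h3, h4]; norm_num
  symm
  calc (∑ q, ((M * pauli₂ q).trace / 4) • pauli₂ q) s t
      = ∑ q, ∑ w, ∑ x, M w x * (pauli₂ q x w * pauli₂ q s t) / 4 := by
        simp only [Matrix.sum_apply, Matrix.smul_apply, smul_eq_mul, Matrix.trace, Matrix.diag,
          Matrix.mul_apply, Finset.sum_div, Finset.sum_mul]
        exact Finset.sum_congr rfl fun q _ => Finset.sum_congr rfl fun w _ =>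
          Finset.sum_congr rfl fun x _ => by ring
    _ = ∑ w, ∑ x, M w x * (∑ q, pauli₂ q x w * pauli₂ q s t) / 4 := by
        rw [Finset.sum_comm]
        refine Finset.sum_congr rfl fun w _ => ?_
        rw [Finset.sum_comm]
        refine Finset.sum_congr rfl fun x _ => ?_
        rw [Finset.mul_sum, Finset.sum_div]
    _ = M s t := by
        simp only [h]
        rw [Finset.sum_eq_single s, Finset.sum_eq_single t]
        · simp
        · intro x _ hx; simp [hx]
        · simp
        · intro w _ hw; simp [hw]
        · simp

/-- The Pauli transfer matrix of a two-qubit gate (in the Heisenberg picture). -/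
noncomputable def transfer (u : Matrix (Fin 2 × Fin 2) (Fin 2 × Fin 2) ℂ) (p q : Fin 4 × Fin 4) : ℝ :=
  (uᴴ * pauli₂ p * u * pauli₂ q).trace.re / 4

/-- The coefficients are real because both factors inside the trace are Hermitian, so taking the
real part in `transfer` loses nothing. -/
theorem sum_transfer (u : Matrix (Fin 2 × Fin 2) (Fin 2 × Fin 2) ℂ) (p : Fin 4 × Fin 4) :
    uᴴ * pauli₂ p * u = ∑ q, (transfer u p q : ℂ) • pauli₂ q := by
  conv_lhs => rw [eq_sum_pauli₂ (uᴴ * pauli₂ p * u)]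
  refine Finset.sum_congr rfl fun q _ => ?_
  congr 1
  have h : star (uᴴ * pauli₂ p * u * pauli₂ q).trace = (uᴴ * pauli₂ p * u * pauli₂ q).trace := by
    rw [← Matrix.trace_conjTranspose]
    simp only [Matrix.conjTranspose_mul, conjTranspose_pauli₂, Matrix.conjTranspose_conjTranspose]
    rw [Matrix.trace_mul_comm]
    simp only [Matrix.mul_assoc]
  rw [transfer]
  push_cast
  rw [Complex.conj_eq_iff_re.1 h]

theorem PauliString.op_update₂ {n : ℕ} (P : PauliString n) {i j : Fin n} (h : i ≠ j)
    (q : Fin 4 × Fin 4) (x y : Bits n) : (PauliString.op (update₂ P i j q)) x y =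
      pauli₂ q (x i, x j) (y i, y j) *
        ∏ k ∈ (Finset.univ.erase i).erase j, pauli (P k) (x k) (y k) := by
  rw [PauliString.op, ← Finset.mul_prod_erase _ _ (Finset.mem_univ i),
    ← Finset.mul_prod_erase _ _ (Finset.mem_erase.2 ⟨h.symm, Finset.mem_univ j⟩),
    update₂_left _ _ h, update₂_right, pauli₂, ← mul_assoc]
  congr 1
  refine Finset.prod_congr rfl fun k hk => ?_
  have hk' := Finset.mem_erase.1 hk
  rw [update₂_of_ne _ _ (Finset.mem_erase.1 hk'.2).1 hk'.1]

/-- A gate acting on a Pauli operator in the Heisenberg picture. -/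
theorem Gate.conj_op {n : ℕ} (g : Gate n) (P : PauliString n) :
    g.opᴴ * P.op * g.op = ∑ q, (transfer g.u (P g.i, P g.j) q : ℂ) •
      PauliString.op (update₂ P g.i g.j q) := by
  ext x y
  have hP : ∀ s t, P.op (update₂ x g.i g.j s) (update₂ y g.i g.j t) =
      pauli₂ (P g.i, P g.j) s t *
        ∏ k ∈ (Finset.univ.erase g.i).erase g.j, pauli (P k) (x k) (y k) := fun s t => by
    have := PauliString.op_update₂ P g.ne (P g.i, P g.j) (update₂ x g.i g.j s) (update₂ y g.i g.j t)
    rw [eq_update₂ P (fun _ _ _ => rfl) g.ne] at this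
    rw [this, update₂_left _ _ g.ne, update₂_left _ _ g.ne, update₂_right, update₂_right]
    congr 1
    refine Finset.prod_congr rfl fun k hk => ?_
    have hk' := Finset.mem_erase.1 hk
    rw [update₂_of_ne _ _ (Finset.mem_erase.1 hk'.2).1 hk'.1,
      update₂_of_ne _ _ (Finset.mem_erase.1 hk'.2).1 hk'.1]
  have hl : (g.opᴴ * P.op * g.op) x y =
      (g.uᴴ * pauli₂ (P g.i, P g.j) * g.u) (x g.i, x g.j) (y g.i, y g.j) *
        ∏ k ∈ (Finset.univ.erase g.i).erase g.j, pauli (P k) (x k) (y k) := by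
    rw [Gate.op_eq_pairOp, conjTranspose_pairOp, mul_pairOp_apply g.ne]
    simp only [pairOp_mul_apply g.ne, hP, Matrix.mul_apply, Finset.sum_mul]
    exact Finset.sum_congr rfl fun s _ => Finset.sum_congr rfl fun t _ => by ring
  rw [hl, sum_transfer]
  simp only [Matrix.sum_apply, Matrix.smul_apply, Finset.sum_mul, PauliString.op_update₂ P g.ne,
    smul_eq_mul, mul_assoc]

/-! ### Pauli paths -/

/-- A Pauli path in the Heisenberg picture: its current Pauli operator, the total weight so far, and
its coefficient in the absence of noise. -/
structure Path (n : ℕ) where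
  P : PauliString n
  k : ℕ
  y : ℝ

/-- The names of the two-qubit Pauli operators. -/
def pauliPairs : List (Fin 4 × Fin 4) :=
  (List.finRange 4).flatMap fun a => (List.finRange 4).map fun b => (a, b)

theorem sum_map_pauliPairs {M : Type*} [AddCommMonoid M] (f : Fin 4 × Fin 4 → M) :
    (pauliPairs.map f).sum = ∑ q, f q := by
  simp [pauliPairs, Fintype.sum_prod_type, Fin.sum_univ_four, List.finRange_succ, add_assoc]

/-- The paths that continue a given path through a gate. -/
noncomputable def Gate.children {n : ℕ} (g : Gate n) (p : Path n) : List (Path n) :=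
  -- A gate fixes a Pauli operator that is trivial on its qubits. Not branching here lets the number
  -- of paths be controlled by weight instead of by the number of gates.
  if p.P g.i = 0 ∧ p.P g.j = 0 then [p]
  else pauliPairs.map fun q =>
    ⟨update₂ p.P g.i g.j q, p.k, p.y * transfer g.u (p.P g.i, p.P g.j) q⟩

/-- All paths are continued through a gate. -/
noncomputable def gateStep {n : ℕ} (L : List (Path n)) (g : Gate n) : List (Path n) :=
  L.foldl (fun acc p => g.children p ++ acc) []

/-- The path after a layer of noise. -/
def Path.bump {n : ℕ} (p : Path n) : Path n := ⟨p.P, p.k + p.P.weight, p.y⟩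

/-- All paths pass a layer of noise, and are discarded unless `keep` holds of their total weights. -/
def noiseStep {n : ℕ} (keep : ℕ → Bool) (L : List (Path n)) : List (Path n) :=
  L.foldl (fun acc p => if keep p.bump.k then p.bump :: acc else acc) []

/-- All paths pass a layer of noise and then a circuit layer. -/
noncomputable def layerStep {n : ℕ} (keep : ℕ → Bool) (L : List (Path n)) (l : Layer n) :
    List (Path n) :=
  l.gates.foldl gateStep (noiseStep keep L)

/-- The paths of an observable through the noisy circuit. -/
noncomputable def paths {n : ℕ} (keep : ℕ → Bool) (C : Circuit n) (O : PauliString n) :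
    List (Path n) :=
  noiseStep keep (C.reverse.foldl (layerStep keep) [⟨O, 0, 1⟩])

/-- The total contribution of a list of paths to the expectation value, if the noise damps each
nontrivial Pauli operator by `a`. -/
noncomputable def pathSum {n : ℕ} (a : ℝ) (σ : Op n) (L : List (Path n)) : ℝ :=
  (L.map fun p => p.y * a ^ p.k * (σ * p.P.op).trace.re).sum

theorem foldl_append_eq {α β : Type*} (f : α → List β) (l : List α) (acc : List β) :
    l.foldl (fun acc x => f x ++ acc) acc = l.reverse.flatMap f ++ acc := by
  induction l generalizing acc with
  | nil => rfl
  | cons a l ih => simp [ih]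

/-- The reversal comes from prepending children, as the program does. The order of paths never
matters, only sums over them and their number. -/
theorem gateStep_eq {n : ℕ} (L : List (Path n)) (g : Gate n) :
    gateStep L g = L.reverse.flatMap g.children := by
  rw [gateStep, foldl_append_eq, List.append_nil]

theorem noiseStep_eq {n : ℕ} (keep : ℕ → Bool) (L : List (Path n)) :
    noiseStep keep L = ((L.map Path.bump).filter fun p => keep p.k).reverse := by
  have : ∀ acc : List (Path n), L.foldl (fun acc p => if keep p.bump.k then p.bump :: acc else acc)
      acc = ((L.map Path.bump).filter fun p => keep p.k).reverse ++ acc := by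
    induction L with
    | nil => simp
    | cons p L ih =>
      intro acc
      rw [List.foldl_cons, ih, List.map_cons, List.filter_cons]
      split_ifs <;> simp
  rw [noiseStep, this, List.append_nil]

theorem sum_map_gateStep {n : ℕ} {M : Type*} [AddCommMonoid M] (L : List (Path n)) (g : Gate n)
    (f : Path n → M) :
    ((gateStep L g).map f).sum = (L.map fun p => ((g.children p).map f).sum).sum := by
  rw [gateStep_eq, ← List.sum_reverse (L.map _), ← List.map_reverse, List.map_flatMap,
    List.flatMap_def, List.sum_flatten, List.map_map]
  rfl

theorem sum_map_noiseStep {n : ℕ} {M : Type*} [AddCommMonoid M] (L : List (Path n))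
    (f : Path n → M) :
    ((noiseStep (fun _ => true) L).map f).sum = (L.map fun p => f p.bump).sum := by
  rw [noiseStep_eq, List.map_reverse, List.sum_reverse]
  simp [Function.comp_def]

theorem Gate.k_of_mem_children {n : ℕ} {g : Gate n} {p q : Path n} (h : q ∈ g.children p) :
    q.k = p.k := by
  unfold Gate.children at h
  split_ifs at h
  · rw [List.mem_singleton.1 h]
  · obtain ⟨_, _, rfl⟩ := List.mem_map.1 h
    rfl

/-- The operator of the continued paths. -/
theorem Gate.sum_children {n : ℕ} (g : Gate n) (p : Path n) :
    ((g.children p).map fun q => (q.y : ℂ) • q.P.op).sum =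
      g.opᴴ * ((p.y : ℂ) • p.P.op) * g.op := by
  rw [mul_smul_comm, smul_mul_assoc]
  unfold Gate.children
  split_ifs with h
  -- In the untouched case, the 16-term expansion is resummed to conjugation of the two-qubit
  -- identity, which unitarity leaves unchanged.
  · have h1 : g.opᴴ * p.P.op * g.op = p.P.op := by
      have hz : p.P.op = PauliString.op (update₂ p.P g.i g.j (0, 0)) := by
        conv_lhs => rw [← eq_update₂ p.P (fun _ _ _ => rfl) g.ne, h.1, h.2]
      have hp : pauli₂ (0, 0) = 1 := by
        ext s t
        simp only [pauli₂, pauli_zero, Matrix.one_apply, Prod.ext_iff]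
        split_ifs <;> simp_all
      have hu : g.uᴴ * pauli₂ (0, 0) * g.u = pauli₂ (0, 0) := by
        rw [hp, Matrix.mul_one, ← Matrix.star_eq_conjTranspose,
          Unitary.star_mul_self_of_mem g.unitary]
      ext x y
      rw [g.conj_op, h.1, h.2]
      simp only [Matrix.sum_apply, Matrix.smul_apply, PauliString.op_update₂ p.P g.ne]
      rw [hz, PauliString.op_update₂ p.P g.ne]
      conv_rhs => rw [← hu, sum_transfer]
      simp only [Matrix.sum_apply, Matrix.smul_apply, Finset.sum_mul, smul_eq_mul, mul_assoc]
    simp [h1]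
  · rw [List.map_map, g.conj_op, Finset.smul_sum, ← sum_map_pauliPairs]
    congr 2
    ext q : 1
    simp [smul_smul]

theorem re_trace_mul_list_sum {n : ℕ} (σ : Op n) (L : List (Path n)) :
    (L.map fun p => p.y * (σ * p.P.op).trace.re).sum =
      (σ * (L.map fun p => (p.y : ℂ) • p.P.op).sum).trace.re := by
  induction L with
  | nil => simp
  | cons p L ih =>
    simp only [List.map_cons, List.sum_cons, ih, Matrix.mul_add, Matrix.trace_add, Complex.add_re,
      mul_smul_comm, Matrix.trace_smul, smul_eq_mul, Complex.re_ofReal_mul]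

/-- By cyclicity of the trace, a gate moves from the observable to the state. Gates do not change
the total weight, so the common factor `a ^ p.k` can be pulled out of the sum over children. -/
theorem pathSum_gateStep {n : ℕ} (a : ℝ) (σ : Op n) (L : List (Path n)) (g : Gate n) :
    pathSum a σ (gateStep L g) = pathSum a (g.op * σ * g.opᴴ) L := by
  rw [pathSum, sum_map_gateStep, pathSum]
  congr 2
  ext p
  have h1 : (g.children p).map (fun q => q.y * a ^ q.k * (σ * q.P.op).trace.re) =
      (g.children p).map fun q => a ^ p.k * (q.y * (σ * q.P.op).trace.re) :=
    List.map_congr_left fun q hq => by rw [Gate.k_of_mem_children hq]; ring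
  rw [h1, List.sum_map_mul_left, re_trace_mul_list_sum, g.sum_children]
  have h2 : (σ * (g.opᴴ * ((p.y : ℂ) • p.P.op) * g.op)).trace =
      (p.y : ℂ) * (g.op * σ * g.opᴴ * p.P.op).trace := by
    rw [mul_smul_comm, smul_mul_assoc, mul_smul_comm, Matrix.trace_smul, smul_eq_mul,
      ← Matrix.mul_assoc, Matrix.trace_mul_comm]
    simp only [Matrix.mul_assoc]
  rw [h2, Complex.re_ofReal_mul]
  ring

theorem pathSum_noiseStep {n : ℕ} (a : ℝ) (σ : Op n) (L : List (Path n)) :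
    pathSum a σ (noiseStep (fun _ => true) L) = pathSum a (depolarizeAll a σ) L := by
  rw [pathSum, sum_map_noiseStep, pathSum]
  congr 2
  ext p
  rw [trace_depolarizeAll_mul, ← Complex.ofReal_pow, Complex.re_ofReal_mul]
  simp only [Path.bump, pow_add]
  ring

theorem pathSum_layerStep {n : ℕ} (a : ℝ) (σ : Op n) (L : List (Path n)) (l : Layer n) :
    pathSum a σ (layerStep (fun _ => true) L l) = pathSum a (depolarizeAll a (l.apply σ)) L := by
  rw [← pathSum_noiseStep, layerStep, Layer.apply, Layer.op]
  generalize noiseStep (fun _ => true) L = L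
  -- The unitary of the layer is the product of its gates in list order, so the first gate of the
  -- list is the first to conjugate the observable.
  induction l.gates generalizing L with
  | nil => simp
  | cons g gs ih =>
    rw [List.foldl_cons, ih, pathSum_gateStep, List.map_cons, List.prod_cons,
      Matrix.conjTranspose_mul]
    simp only [Matrix.mul_assoc]

/-- The sum over all Pauli paths is the noisy expectation value. -/
theorem pathSum_paths {n : ℕ} {γ : ℝ} (C : NoisyCircuit n γ) (ρ : Op n) (O : PauliString n) :
    pathSum (Real.exp (-C.rate)) ρ (paths (fun _ => true) C.layers O) =
      (C.run ρ * O.op).trace.re := by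
  -- The observable meets the last layer first. The induction therefore removes layers from the end,
  -- with an arbitrary list of paths.
  have h : ∀ (l : Circuit n) (L : List (Path n)), pathSum (Real.exp (-C.rate)) ρ
      (noiseStep (fun _ => true) (l.reverse.foldl (layerStep fun _ => true) L)) =
      pathSum (Real.exp (-C.rate)) (l.foldl (fun σ L => depolarizeAll (Real.exp (-C.rate)) (L.apply σ))
        (depolarizeAll (Real.exp (-C.rate)) ρ)) L := by
    intro l
    induction l using List.reverseRecOn with
    | nil => intro L; exact pathSum_noiseStep _ _ _
    | append_singleton l a ih =>
      intro L
      rw [List.reverse_append, List.foldl_append, List.foldl_append]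
      simp only [List.reverse_singleton, List.foldl_cons, List.foldl_nil]
      rw [ih, pathSum_layerStep]
  rw [paths, h]
  simp [pathSum, NoisyCircuit.run]

/-! ### Truncation -/

section truncation
variable {n : ℕ} {keep : ℕ → Bool}

theorem gateStep_filter (L : List (Path n)) (g : Gate n) :
    gateStep (L.filter fun p => keep p.k) g = (gateStep L g).filter fun p => keep p.k := by
  rw [gateStep_eq, gateStep_eq, List.filter_flatMap, ← List.filter_reverse]
  induction L.reverse with
  | nil => rfl
  | cons p L ih =>
    rw [List.filter_cons, List.flatMap_cons]
    by_cases hp : keep p.k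
    · rw [if_pos hp, List.flatMap_cons, ih, List.filter_eq_self.2]
      exact fun q hq => by rwa [Gate.k_of_mem_children hq]
    · rw [if_neg hp, ih, List.filter_eq_nil_iff.2, List.nil_append]
      exact fun q hq => by rwa [Gate.k_of_mem_children hq]

/-- Total weights never decrease and `keep` is closed downwards, so a path dropped before this layer
would also be dropped after it. -/
theorem noiseStep_filter (hk : ∀ j k, j ≤ k → keep k → keep j) (L : List (Path n)) :
    noiseStep keep (L.filter fun p => keep p.k) =
      (noiseStep (fun _ => true) L).filter fun p => keep p.k := by
  rw [noiseStep_eq, noiseStep_eq, List.filter_reverse, List.filter_map, List.filter_filter,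
    List.filter_filter, List.filter_map]
  congr 2
  refine List.filter_congr fun p _ => ?_
  have := hk p.k p.bump.k (Nat.le_add_right _ _)
  simp only [Function.comp_apply, Bool.and_true]
  cases h1 : keep p.bump.k <;> simp_all

theorem layerStep_filter (hk : ∀ j k, j ≤ k → keep k → keep j) (L : List (Path n)) (l : Layer n) :
    layerStep keep (L.filter fun p => keep p.k) l =
      (layerStep (fun _ => true) L l).filter fun p => keep p.k := by
  rw [layerStep, layerStep, noiseStep_filter hk]
  generalize noiseStep (fun _ => true) L = L
  induction l.gates generalizing L with
  | nil => rfl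
  | cons g gs ih => rw [List.foldl_cons, List.foldl_cons, gateStep_filter, ih]

/-- The program discards paths early to stay fast, whereas the error analysis needs a cutoff on
complete paths. Monotonicity of the weight makes the two agree. -/
theorem paths_filter (hk : ∀ j k, j ≤ k → keep k → keep j) (h0 : keep 0) (C : Circuit n)
    (O : PauliString n) :
    paths keep C O = (paths (fun _ => true) C O).filter fun p => keep p.k := by
  rw [paths, paths, ← noiseStep_filter hk]
  congr 1
  have : ([⟨O, 0, 1⟩] : List (Path n)) = [⟨O, 0, 1⟩].filter fun p => keep p.k := by simp [h0]
  conv_lhs => rw [this]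
  generalize ([⟨O, 0, 1⟩] : List (Path n)) = L
  induction C.reverse generalizing L with
  | nil => rfl
  | cons l C ih => rw [List.foldl_cons, List.foldl_cons, layerStep_filter hk, ih]

end truncation

/-! ### Conservation of the norm -/

/-- The operator of the paths of total weight `k`. -/
noncomputable def weightPart {n : ℕ} (L : List (Path n)) (k : ℕ) : Op n :=
  (L.map fun p => if p.k = k then (p.y : ℂ) • p.P.op else 0).sum

/-- The coefficient of a Pauli operator in the operator of the paths of total weight `k`. -/
noncomputable def weightCoeff {n : ℕ} (L : List (Path n)) (k : ℕ) (P : PauliString n) : ℝ :=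
  (L.map fun p => if p.k = k ∧ p.P = P then p.y else 0).sum

theorem weightPart_eq {n : ℕ} (L : List (Path n)) (k : ℕ) :
    weightPart L k = ∑ P, (weightCoeff L k P : ℂ) • P.op := by
  unfold weightPart weightCoeff
  induction L with
  | nil => simp
  | cons p L ih =>
    simp only [List.map_cons, List.sum_cons, ih, Complex.ofReal_add, add_smul,
      Finset.sum_add_distrib]
    congr 1
    by_cases h : p.k = k
    · simp only [h, if_true, true_and]
      rw [Finset.sum_eq_single p.P]
      · simp
      · intro P _ hP
        simp [Ne.symm hP]
      · simp
    · simp [h]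

theorem weightPart_gateStep {n : ℕ} (L : List (Path n)) (g : Gate n) (k : ℕ) :
    weightPart (gateStep L g) k = g.opᴴ * weightPart L k * g.op := by
  rw [weightPart, sum_map_gateStep, weightPart]
  have : ∀ p, ((g.children p).map fun q => if q.k = k then (q.y : ℂ) • q.P.op else 0).sum =
      g.opᴴ * (if p.k = k then (p.y : ℂ) • p.P.op else 0) * g.op := by
    intro p
    rw [List.map_congr_left (g := fun q => if p.k = k then (q.y : ℂ) • q.P.op else 0) fun q hq => by
      rw [Gate.k_of_mem_children hq]]
    split_ifs
    · rw [g.sum_children]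
    · simp
  simp only [this]
  induction L with
  | nil => simp
  | cons p L ih => simp only [List.map_cons, List.sum_cons, ih, Matrix.mul_add, Matrix.add_mul]

/-- A gate preserves the total weight of each path, so it acts on the operator of each weight
separately; there it is a unitary conjugation, which preserves the Hilbert–Schmidt norm. -/
theorem sum_sq_weightCoeff_gateStep {n : ℕ} (L : List (Path n)) (g : Gate n) (k : ℕ) :
    ∑ P, weightCoeff (gateStep L g) k P ^ 2 = ∑ P, weightCoeff L k P ^ 2 := by
  have h : (weightPart (gateStep L g) k * weightPart (gateStep L g) k).trace =
      (weightPart L k * weightPart L k).trace := by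
    rw [weightPart_gateStep]
    set A := weightPart L k
    calc (g.opᴴ * A * g.op * (g.opᴴ * A * g.op)).trace
        = (g.opᴴ * (A * (g.op * g.opᴴ) * A * g.op)).trace := by simp only [Matrix.mul_assoc]
      _ = (A * A * (g.op * g.opᴴ)).trace := by
          rw [g.op_mul_conjTranspose_op, Matrix.trace_mul_comm, Matrix.mul_one, Matrix.mul_assoc,
            g.op_mul_conjTranspose_op]
      _ = _ := by rw [g.op_mul_conjTranspose_op, Matrix.mul_one]
  rw [weightPart_eq, weightPart_eq, trace_sq_sum_pauli, trace_sq_sum_pauli, Complex.ofReal_inj] at h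
  exact mul_left_cancel₀ (by positivity) h

theorem weightCoeff_noiseStep {n : ℕ} (L : List (Path n)) (k : ℕ) (P : PauliString n) :
    weightCoeff (noiseStep (fun _ => true) L) k P =
      if P.weight ≤ k then weightCoeff L (k - P.weight) P else 0 := by
  rw [weightCoeff, sum_map_noiseStep, weightCoeff]
  have : ∀ p : Path n, (if p.bump.k = k ∧ p.bump.P = P then p.bump.y else 0) =
      if P.weight ≤ k then (if p.k = k - P.weight ∧ p.P = P then p.y else 0) else 0 := by
    intro p
    simp only [Path.bump, ← ite_and]
    congr 1
    refine propext ⟨?_, ?_⟩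
    · rintro ⟨h, rfl⟩
      exact ⟨by omega, by omega, rfl⟩
    · rintro ⟨h, h2, rfl⟩
      exact ⟨by omega, rfl⟩
  simp only [this]
  split_ifs <;> simp

/-- The total norm of the paths of total weight less than `N`. -/
noncomputable def pathNorm {n : ℕ} (N : ℕ) (L : List (Path n)) : ℝ :=
  ∑ P, ∑ k ∈ Finset.range N, weightCoeff L k P ^ 2

theorem pathNorm_gateStep {n : ℕ} (N : ℕ) (L : List (Path n)) (g : Gate n) :
    pathNorm N (gateStep L g) = pathNorm N L := by
  rw [pathNorm, pathNorm, Finset.sum_comm, Finset.sum_comm (s := Finset.univ)]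
  exact Finset.sum_congr rfl fun k _ => sum_sq_weightCoeff_gateStep L g k

/-- For a fixed Pauli operator, noise shifts the weight by a constant. The shift is injective, so no
two coefficients merge; those pushed to `N` or beyond are lost, whence an inequality. -/
theorem pathNorm_noiseStep_le {n : ℕ} (N : ℕ) (L : List (Path n)) :
    pathNorm N (noiseStep (fun _ => true) L) ≤ pathNorm N L := by
  refine Finset.sum_le_sum fun P _ => ?_
  simp only [weightCoeff_noiseStep]
  rw [← Finset.sum_filter_add_sum_filter_not _ (fun k => P.weight ≤ k)]
  have h0 : ∑ k ∈ (Finset.range N).filter (fun k => ¬ P.weight ≤ k),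
      (if P.weight ≤ k then weightCoeff L (k - P.weight) P else 0) ^ 2 = 0 :=
    Finset.sum_eq_zero fun k hk => by rw [if_neg (Finset.mem_filter.1 hk).2]; simp
  rw [h0, add_zero]
  have h1 : ∑ k ∈ (Finset.range N).filter (fun k => P.weight ≤ k),
      (if P.weight ≤ k then weightCoeff L (k - P.weight) P else 0) ^ 2 =
      ∑ k ∈ ((Finset.range N).filter (fun k => P.weight ≤ k)).image (fun k => k - P.weight),
        weightCoeff L k P ^ 2 := by
    rw [Finset.sum_image]
    · exact Finset.sum_congr rfl fun k hk => by rw [if_pos (Finset.mem_filter.1 hk).2]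
    · intro j hj k hk hjk
      have hj' := (Finset.mem_filter.1 hj).2
      have hk' := (Finset.mem_filter.1 hk).2
      simp only at hjk
      omega
  rw [h1]
  refine Finset.sum_le_sum_of_subset_of_nonneg ?_ fun _ _ _ => sq_nonneg _
  intro k hk
  obtain ⟨j, hj, rfl⟩ := Finset.mem_image.1 hk
  have := Finset.mem_range.1 (Finset.mem_filter.1 hj).1
  exact Finset.mem_range.2 (by omega)

/-- The initial list has a single coefficient 1, at weight 0. Paths with equal weight and equal
final operator may interfere, but they are summed before squaring, so orthogonality of whole paths
is not needed. -/
theorem pathNorm_paths_le {n : ℕ} (N : ℕ) (C : Circuit n) (O : PauliString n) :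
    pathNorm N (paths (fun _ => true) C O) ≤ 1 := by
  have h1 : ∀ (l : Layer n) (L : List (Path n)),
      pathNorm N (layerStep (fun _ => true) L l) ≤ pathNorm N L := by
    intro l L
    refine le_trans (le_of_eq ?_) (pathNorm_noiseStep_le N L)
    rw [layerStep]
    generalize noiseStep (fun _ => true) L = L
    induction l.gates generalizing L with
    | nil => rfl
    | cons g gs ih => rw [List.foldl_cons, ih, pathNorm_gateStep]
  have h2 : ∀ (l : Circuit n) (L : List (Path n)),
      pathNorm N (l.foldl (layerStep fun _ => true) L) ≤ pathNorm N L := by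
    intro l
    induction l with
    | nil => exact fun L => le_rfl
    | cons a l ih => exact fun L => (ih _).trans (h1 a L)
  refine (pathNorm_noiseStep_le N _).trans ((h2 _ _).trans ?_)
  simp only [pathNorm, weightCoeff, List.map_cons, List.map_nil, List.sum_cons, List.sum_nil,
    add_zero]
  rw [Finset.sum_eq_single O (fun P _ hP => by simp [Ne.symm hP]) (by simp)]
  calc _ ≤ ∑ k ∈ Finset.range N, if 0 = k then (1 : ℝ) else 0 :=
        Finset.sum_le_sum fun k _ => by split_ifs <;> simp_all
    _ ≤ 1 := by rw [Finset.sum_ite_eq]; split_ifs <;> norm_num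

/-! ### The truncation error -/

/-- Regrouping the dropped paths by final operator and total weight exhibits the error as the
expectation of one Hermitian operator, to which the second-moment bound applies. -/
theorem pathSum_sub_pathSum_filter {n : ℕ} (a : ℝ) (σ : Op n) (keep : ℕ → Bool) {N : ℕ}
    {L : List (Path n)} (hN : ∀ p ∈ L, p.k < N) :
    pathSum a σ L - pathSum a σ (L.filter fun p => keep p.k) =
      (σ * ∑ P, ((∑ k ∈ Finset.range N, if keep k then 0 else a ^ k * weightCoeff L k P : ℝ) : ℂ) •
        P.op).trace.re := by
  have h : ∀ F : PauliString n → ℝ, (σ * ∑ P, (F P : ℂ) • P.op).trace.re =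
      ∑ P, F P * (σ * P.op).trace.re := fun F => by
    simp only [Finset.mul_sum, Matrix.trace_sum, Complex.re_sum, mul_smul_comm, Matrix.trace_smul,
      smul_eq_mul, Complex.re_ofReal_mul]
  rw [h]
  clear h
  unfold pathSum weightCoeff
  induction L with
  | nil => simp
  | cons p L ih =>
    have ih := ih fun q hq => hN q (List.mem_cons_of_mem _ hq)
    have hp := hN p (by simp)
    have h1 : ∀ P, (∑ k ∈ Finset.range N, if keep k then 0 else a ^ k *
        ((p :: L).map fun p => if p.k = k ∧ p.P = P then p.y else 0).sum) =
        (if p.P = P then (if keep p.k then 0 else a ^ p.k * p.y) else 0) +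
        ∑ k ∈ Finset.range N, if keep k then 0 else a ^ k *
          (L.map fun p => if p.k = k ∧ p.P = P then p.y else 0).sum := by
      intro P
      have h2 : ∀ k, (if keep k then 0 else a ^ k *
          ((p :: L).map fun p => if p.k = k ∧ p.P = P then p.y else 0).sum) =
          (if p.k = k then (if p.P = P then (if keep p.k then 0 else a ^ p.k * p.y) else 0) else 0) +
          (if keep k then 0 else a ^ k *
            (L.map fun p => if p.k = k ∧ p.P = P then p.y else 0).sum) := by
        intro k
        rw [List.map_cons, List.sum_cons]
        by_cases h3 : p.k = k
        · subst h3
          by_cases h4 : p.P = P <;> by_cases h5 : keep p.k <;> simp [h4, h5, mul_add]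
        · simp [h3]
      rw [Finset.sum_congr rfl fun k _ => h2 k, Finset.sum_add_distrib, Finset.sum_ite_eq,
        if_pos (Finset.mem_range.2 hp)]
    simp only [h1, add_mul, Finset.sum_add_distrib]
    rw [← ih]
    simp only [ite_mul, zero_mul, Finset.sum_ite_eq, Finset.mem_univ, if_true, List.map_cons,
      List.sum_cons, List.filter_cons]
    by_cases h5 : keep p.k
    · simp [h5]
    · simp only [h5, Bool.false_eq_true, if_false]
      ring

/-- The mean square truncation error over a low-average ensemble. -/
theorem mean_sq_truncation_le {n : ℕ} {γ : ℝ} (C : NoisyCircuit n γ) (hγ : 0 < γ)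
    (O : PauliString n) {E : Ensemble n} {c : ℝ} (hE : E.IsLowAverage c) {keep : ℕ → Bool}
    (hk : ∀ j k, j ≤ k → keep k → keep j) (h0 : keep 0) {θ : ℝ} (hθ0 : 0 ≤ θ)
    (hθ : ∀ k, ¬ keep k → Real.exp (-C.rate) ^ k ≤ θ) :
    E.mean (fun ω => ((C.run (E.state ω) * O.op).trace.re -
      pathSum (Real.exp (-C.rate)) (E.state ω) (paths keep C.layers O)) ^ 2) ≤
      c * (θ / (1 - Real.exp (-γ))) := by
  set a := Real.exp (-C.rate) with ha
  have ha0 : 0 ≤ a := (Real.exp_pos _).le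
  have haγ : a ≤ Real.exp (-γ) := Real.exp_le_exp.2 (by linarith [C.le_rate])
  have hγ1 : Real.exp (-γ) < 1 := by simpa using hγ
  have ha1 : a < 1 := haγ.trans_lt hγ1
  set L := paths (fun _ => true) C.layers O with hL
  -- Any bound on the finitely many weights will do, since the final estimate is uniform in `N`.
  obtain ⟨N, hN⟩ : ∃ N, ∀ p ∈ L, p.k < N :=
    ⟨(L.map Path.k).sum + 1, fun p hp =>
      Nat.lt_succ_of_le (List.le_sum_of_mem (List.mem_map_of_mem hp))⟩
  set F : PauliString n → ℝ := fun P =>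
    ∑ k ∈ Finset.range N, if keep k then 0 else a ^ k * weightCoeff L k P with hF
  have hA : (∑ P, (F P : ℂ) • P.op)ᴴ = ∑ P, (F P : ℂ) • P.op := by
    simp only [Matrix.conjTranspose_sum, Matrix.conjTranspose_smul, PauliString.conjTranspose_op,
      Complex.star_def, Complex.conj_ofReal]
  have h1 := hE.mean_sq_le hA
  have h2 : ∀ ω, (C.run (E.state ω) * O.op).trace.re - pathSum a (E.state ω) (paths keep C.layers O) =
      (E.state ω * ∑ P, (F P : ℂ) • P.op).trace.re := fun ω => by
    rw [paths_filter hk h0, ← pathSum_paths, pathSum_sub_pathSum_filter _ _ _ hN]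
  simp only [h2]
  refine h1.trans ?_
  have hc : 0 ≤ c := by
    have := (norm_nonneg _).trans hE
    rwa [le_div_iff₀ (by positivity), zero_mul] at this
  -- The factor 2^n from the norm of the Pauli operators cancels the 2^n of the low-average
  -- condition.
  rw [trace_sq_sum_pauli, Complex.ofReal_re, ← mul_assoc, div_mul_cancel₀ _ (by positivity)]
  refine mul_le_mul_of_nonneg_left ?_ hc
  -- One of the two factors `a ^ k` is at most `θ` for dropped weights; the other gives a geometric
  -- series, bounded uniformly in the rate.
  have hgeom : ∑ k ∈ Finset.range N, (if keep k then 0 else a ^ k) ^ 2 ≤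
      θ / (1 - Real.exp (-γ)) := by
    calc _ ≤ ∑ k ∈ Finset.range N, θ * a ^ k := by
          refine Finset.sum_le_sum fun k _ => ?_
          split_ifs with h
          · simpa using mul_nonneg (hθ0) (pow_nonneg ha0 k)
          · rw [sq]
            exact mul_le_mul_of_nonneg_right (hθ k h) (pow_nonneg ha0 k)
      _ = θ * ∑ k ∈ Finset.range N, a ^ k := (Finset.mul_sum _ _ _).symm
      _ ≤ θ * (1 - a)⁻¹ := by
          refine mul_le_mul_of_nonneg_left ?_ (hθ0)
          rw [← tsum_geometric_of_lt_one ha0 ha1]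
          exact (summable_geometric_of_lt_one ha0 ha1).sum_le_tsum _ fun k _ => pow_nonneg ha0 k
      _ ≤ θ * (1 - Real.exp (-γ))⁻¹ := by
          refine mul_le_mul_of_nonneg_left ?_ (hθ0)
          exact inv_anti₀ (by linarith) (by linarith)
      _ = _ := (div_eq_mul_inv _ _).symm
  -- Cauchy–Schwarz over the weights, for each final Pauli operator separately.
  have hcs : ∀ P, F P ^ 2 ≤ (θ / (1 - Real.exp (-γ))) *
      ∑ k ∈ Finset.range N, weightCoeff L k P ^ 2 := fun P => by
    have : F P = ∑ k ∈ Finset.range N, (if keep k then 0 else a ^ k) * weightCoeff L k P :=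
      Finset.sum_congr rfl fun k _ => by split_ifs <;> simp
    rw [this]
    exact (Finset.sum_mul_sq_le_sq_mul_sq _ _ _).trans
      (mul_le_mul_of_nonneg_right hgeom (Finset.sum_nonneg fun _ _ => sq_nonneg _))
  calc ∑ P, F P ^ 2 ≤ ∑ P, (θ / (1 - Real.exp (-γ))) *
        ∑ k ∈ Finset.range N, weightCoeff L k P ^ 2 := Finset.sum_le_sum fun P _ => hcs P
    _ = (θ / (1 - Real.exp (-γ))) * pathNorm N L := by rw [pathNorm, Finset.mul_sum]
    _ ≤ _ := mul_le_of_le_one_right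
        ((Finset.sum_nonneg fun _ _ => sq_nonneg _).trans hgeom) (pathNorm_paths_le N _ _)

/-! ### The number of paths -/

/-- The number of gates that touch a Pauli operator. -/
def touching {n : ℕ} (gs : List (Gate n)) (P : PauliString n) : ℕ :=
  (gs.map fun g => if P g.i = 0 ∧ P g.j = 0 then 0 else 1).sum

/-- A potential that bounds the number of paths, where the gates `gs` remain in the layer. -/
noncomputable def potential {n : ℕ} (gs : List (Gate n)) (L : List (Path n)) : ℝ :=
  (L.map fun p => 16 ^ touching gs p.P * (1 / 16 : ℝ) ^ p.k).sum

/-- The two gates act on disjoint pairs of qubits. -/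
def Gate.Disjoint {n : ℕ} (g h : Gate n) : Prop :=
  g.i ≠ h.i ∧ g.i ≠ h.j ∧ g.j ≠ h.i ∧ g.j ≠ h.j

theorem touching_update₂ {n : ℕ} {g : Gate n} {gs : List (Gate n)} (hg : ∀ h ∈ gs, g.Disjoint h)
    (P : PauliString n) (q : Fin 4 × Fin 4) :
    touching gs (update₂ P g.i g.j q) = touching gs P := by
  unfold touching
  congr 1
  refine List.map_congr_left fun h hh => ?_
  obtain ⟨h1, h2, h3, h4⟩ := hg h hh
  rw [update₂_of_ne _ _ h1.symm h3.symm, update₂_of_ne _ _ h2.symm h4.symm]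

theorem length_pauliPairs : pauliPairs.length = 16 := by decide

/-- A touched path has 16 children, each with one gate fewer left to be touched; the factor 16 is
exactly compensated. Disjointness ensures that the gate does not alter which later gates are
touched. -/
theorem potential_gateStep {n : ℕ} {g : Gate n} {gs : List (Gate n)} (hg : ∀ h ∈ gs, g.Disjoint h)
    (L : List (Path n)) : potential gs (gateStep L g) = potential (g :: gs) L := by
  rw [potential, sum_map_gateStep, potential]
  congr 2
  ext p
  unfold Gate.children
  split_ifs with h
  · simp [touching, h]
  · simp only [List.map_map, Function.comp_def, touching_update₂ hg, List.map_const',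
      List.sum_replicate, length_pauliPairs]
    have : touching (g :: gs) p.P = touching gs p.P + 1 := by
      simp [touching, h, add_comm]
    rw [this, pow_succ]
    ring

/-- Each touching gate has a qubit in the support of `P`, and the qubits of different gates are
distinct. -/
theorem touching_le_weight {n : ℕ} {gs : List (Gate n)} (hgs : gs.Pairwise Gate.Disjoint)
    (P : PauliString n) : touching gs P ≤ P.weight := by
  have h : touching gs P ≤
      ((Finset.univ.filter fun k => P k ≠ 0) ∩
        (gs.flatMap fun g => [g.i, g.j]).toFinset).card := by
    induction gs with
    | nil => simp [touching]
    | cons g gs ih =>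
      obtain ⟨hg, hgs⟩ := List.pairwise_cons.1 hgs
      rw [List.flatMap_cons, List.toFinset_append, Finset.inter_union_distrib_left,
        Finset.card_union_of_disjoint]
      · have h1 : touching (g :: gs) P = (if P g.i = 0 ∧ P g.j = 0 then 0 else 1) + touching gs P := by
          simp [touching]
        rw [h1]
        refine add_le_add ?_ (ih hgs)
        split_ifs with h0
        · exact Nat.zero_le _
        · refine Finset.card_pos.2 ?_
          by_cases hi : P g.i = 0
          · exact ⟨g.j, by simp; tauto⟩
          · exact ⟨g.i, by simp; tauto⟩
      · refine Finset.disjoint_left.2 fun k hk hk' => ?_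
        simp only [Finset.mem_inter, List.mem_toFinset, List.mem_flatMap, List.mem_cons,
          List.not_mem_nil, or_false] at hk hk'
        obtain ⟨_, h, hh, hk'⟩ := hk'
        obtain ⟨h1, h2, h3, h4⟩ := hg h hh
        rcases hk.2 with rfl | rfl <;> rcases hk' with hk' | hk' <;> tauto
  exact h.trans (Finset.card_le_card Finset.inter_subset_left)

/-- Passing noise with an operator of weight w earns a factor 16^(-w), which pays in advance for the
at most w branchings in the layer that follows. -/
theorem potential_noiseStep_le {n : ℕ} {gs : List (Gate n)} (hgs : gs.Pairwise Gate.Disjoint)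
    (keep : ℕ → Bool) (L : List (Path n)) :
    potential gs (noiseStep keep L) ≤ potential [] L := by
  rw [potential, noiseStep_eq, List.map_reverse, List.sum_reverse, potential]
  induction L with
  | nil => simp
  | cons p L ih =>
    rw [List.map_cons, List.filter_cons, List.map_cons, List.sum_cons]
    have h0 : (0 : ℝ) ≤ 16 ^ touching ([] : List (Gate n)) p.P * (1 / 16) ^ p.k := by positivity
    split_ifs
    · rw [List.map_cons, List.sum_cons]
      refine add_le_add ?_ ih
      have h1 : (16 : ℝ) ^ touching gs p.P ≤ 16 ^ p.P.weight :=
        pow_le_pow_right₀ (by norm_num) (touching_le_weight hgs _)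
      calc (16 : ℝ) ^ touching gs p.P * (1 / 16) ^ (p.k + p.P.weight)
          ≤ 16 ^ p.P.weight * (1 / 16) ^ (p.k + p.P.weight) := by gcongr
        _ = _ := by
          rw [pow_add, mul_comm ((1 / 16 : ℝ) ^ p.k), ← mul_assoc, ← mul_pow]
          simp [touching]
    · linarith

theorem potential_nil_le {n : ℕ} (gs : List (Gate n)) (L : List (Path n)) :
    potential [] L ≤ potential gs L := by
  refine List.sum_le_sum fun p _ => ?_
  simp only [touching, List.map_nil, List.sum_nil, pow_zero]
  refine mul_le_mul_of_nonneg_right (one_le_pow₀ (by norm_num)) (by positivity)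

/-- A list of paths that are kept and of which there are not too many. -/
def Bounded {n : ℕ} (keep : ℕ → Bool) (L : List (Path n)) : Prop :=
  (∀ p ∈ L, keep p.k) ∧ potential [] L ≤ 1

theorem bounded_singleton {n : ℕ} {keep : ℕ → Bool} (h0 : keep 0) (O : PauliString n) :
    Bounded keep [⟨O, 0, 1⟩] :=
  ⟨by simpa using h0, by simp [potential, touching]⟩

/-- A kept path contributes at least `1 / B` to a sum that is at most 1. -/
theorem Bounded.length_le {n : ℕ} {keep : ℕ → Bool} {L : List (Path n)} (hL : Bounded keep L)
    {B : ℕ} (hB : ∀ k, keep k → 16 ^ k ≤ B) : L.length ≤ B := by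
  by_contra! h
  have hB0 : (0 : ℝ) < B := by
    obtain ⟨p, hp⟩ := List.exists_mem_of_length_pos (Nat.zero_lt_of_lt h)
    exact_mod_cast (pow_pos (by norm_num : 0 < 16) p.k).trans_le (hB _ (hL.1 p hp))
  have h1 : (L.length : ℝ) * (1 / B) ≤ potential [] L := by
    rw [potential, ← nsmul_eq_mul, ← List.sum_replicate, ← List.map_const']
    refine List.sum_le_sum fun p hp => ?_
    have : (16 : ℝ) ^ p.k ≤ B := by exact_mod_cast hB _ (hL.1 p hp)
    simp only [touching, List.map_nil, List.sum_nil, pow_zero, one_mul, one_div, inv_pow]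
    exact inv_anti₀ (by positivity) this
  have h2 := h1.trans hL.2
  rw [mul_one_div, div_le_one hB0] at h2
  exact absurd (by exact_mod_cast h2) (not_le.2 h)

theorem Bounded.of_noiseStep {n : ℕ} {keep : ℕ → Bool} {L : List (Path n)} (hL : Bounded keep L) :
    Bounded keep (noiseStep keep L) :=
  ⟨fun p hp => by
    rw [noiseStep_eq, List.mem_reverse, List.mem_filter] at hp
    exact hp.2, (potential_noiseStep_le List.Pairwise.nil keep L).trans hL.2⟩

/-- The bound is needed after every initial segment `pre` of the gates, because the running time
depends on the intermediate lists. The credit still reserved for `post` is discarded at the end. -/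
theorem Bounded.of_layerStep {n : ℕ} {keep : ℕ → Bool} {L : List (Path n)} (hL : Bounded keep L)
    (l : Layer n) {pre post : List (Gate n)} (h : l.gates = pre ++ post) :
    Bounded keep (pre.foldl gateStep (noiseStep keep L)) := by
  have hd : (pre ++ post).Pairwise Gate.Disjoint := h ▸ l.disjoint
  have h1 : ∀ L : List (Path n), (∀ p ∈ L, keep p.k) → ∀ p ∈ pre.foldl gateStep L, keep p.k := by
    clear h hd
    induction pre with
    | nil => exact fun L h => h
    | cons g gs ih =>
      refine fun L h => ih _ fun p hp => ?_
      rw [gateStep_eq, List.mem_flatMap] at hp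
      obtain ⟨q, hq, hp⟩ := hp
      rw [Gate.k_of_mem_children hp]
      exact h q (List.mem_reverse.1 hq)
  refine ⟨h1 _ hL.of_noiseStep.1, ?_⟩
  have h2 := (potential_noiseStep_le hd keep L).trans hL.2
  generalize noiseStep keep L = L' at h2
  clear h h1
  induction pre generalizing L' with
  | nil => exact (potential_nil_le _ _).trans h2
  | cons g gs ih =>
    rw [List.cons_append, List.pairwise_cons] at hd
    exact ih hd.2 _ (by rwa [potential_gateStep hd.1])

namespace FProg

/-! ### Basic procedures

Procedures get their arguments as a list. -/

/-- The entry number `k` of the environment. -/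
def var : ℕ → FProg
  | 0 => fst
  | k + 1 => comp (var k) snd

/-- Put the values of some programs in front of a list. -/
def push (es : List FProg) (e : FProg) : FProg := es.foldr pair e

/-- Call a procedure. -/
def call (p : FProg) (es : List FProg) : FProg := comp p (push es nil)

/-- The sum of two expressions. -/
def plus (f g : FProg) : FProg := comp add (pair f g)

/-- The difference of two expressions. -/
def minus (f g : FProg) : FProg := comp sub (pair f g)

/-- The product of two expressions. -/
def times (f g : FProg) : FProg := comp mul (pair f g)

/-- Test for equality of two numbers. -/
def ifEq (a b f g : FProg) : FProg := cond (minus a b) g (cond (minus b a) g f)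

section eval
variable {ask : Data → Data} {d e : Data} {f g : FProg} {x y : ℝ}

@[simp] theorem eval_var_zero : (var 0).eval ask d = d.fst := rfl

@[simp] theorem eval_var_succ (k : ℕ) : (var (k + 1)).eval ask d = (var k).eval ask d.snd := rfl

theorem eval_comp (g f : FProg) : (comp g f).eval ask d = g.eval ask (f.eval ask d) := rfl

theorem eval_pair (f g : FProg) :
    (pair f g).eval ask d = .node (f.eval ask d) (g.eval ask d) := rfl

theorem cost_comp (g f : FProg) :
    (comp g f).cost ask d = f.cost ask d + g.cost ask (f.eval ask d) + 1 := rfl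

theorem cost_pair (f g : FProg) :
    (pair f g).cost ask d = f.cost ask d + g.cost ask d + 1 := rfl

theorem cost_cond (c f g : FProg) :
    (cond c f g).cost ask d = c.cost ask d + f.cost ask d + g.cost ask d + 1 := rfl

theorem eval_push (es : List FProg) (f : FProg) {xs : List Data} (h : f.eval ask d = .ofList xs) :
    (push es f).eval ask d = .ofList (es.map (fun e => e.eval ask d) ++ xs) := by
  induction es with
  | nil => simpa [push] using h
  | cons e es ih => rw [push, List.foldr_cons, eval, ← push, ih]; rfl

@[simp] theorem eval_call (p : FProg) (es : List FProg) :
    (call p es).eval ask d = p.eval ask (.ofList (es.map fun e => e.eval ask d)) := by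
  rw [call, eval, eval_push es nil (xs := []) rfl, List.append_nil]

theorem eval_plus (hf : f.eval ask d = .num x) (hg : g.eval ask d = .num y) :
    (plus f g).eval ask d = .num (x + y) := by
  simp [plus, eval, hf, hg, Data.arith]

theorem eval_minus (hf : f.eval ask d = .num x) (hg : g.eval ask d = .num y) :
    (minus f g).eval ask d = .num (x - y) := by
  simp [minus, eval, hf, hg, Data.arith]

theorem eval_times (hf : f.eval ask d = .num x) (hg : g.eval ask d = .num y) :
    (times f g).eval ask d = .num (x * y) := by
  simp [times, eval, hf, hg, Data.arith]

open Classical in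
theorem eval_ifEq {a b : FProg} (ha : a.eval ask d = .num x) (hb : b.eval ask d = .num y) :
    (ifEq a b f g).eval ask d = if x = y then f.eval ask d else g.eval ask d := by
  rw [ifEq, eval, eval, eval_minus ha hb, eval_minus hb ha]
  simp only [Data.Holds, sub_pos]
  rcases lt_trichotomy x y with h | h | h
  · rw [if_neg h.not_gt, if_pos h, if_neg h.ne]
  · simp [h]
  · rw [if_pos h, if_neg h.ne']

open Classical in
theorem eval_cond_num {c : FProg} (hc : c.eval ask d = .num x) :
    (cond c f g).eval ask d = if 0 < x then f.eval ask d else g.eval ask d := by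
  rw [eval, hc]
  rfl

end eval

section flat

@[simp] theorem flat_var (k : ℕ) : (var k).Flat := by
  induction k with
  | zero => trivial
  | succ k ih => exact ⟨trivial, ih⟩

theorem Flat.push {es : List FProg} (hes : ∀ e ∈ es, e.Flat) {f : FProg} (hf : f.Flat) :
    (push es f).Flat := by
  induction es with
  | nil => exact hf
  | cons e es ih =>
    exact ⟨hes e (by simp), ih fun e he => hes e (by simp [he])⟩

@[simp] theorem flat_plus {f g : FProg} : (plus f g).Flat ↔ f.Flat ∧ g.Flat := by
  simp [plus, Flat]

@[simp] theorem flat_minus {f g : FProg} : (minus f g).Flat ↔ f.Flat ∧ g.Flat := by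
  simp [minus, Flat]

@[simp] theorem flat_times {f g : FProg} : (times f g).Flat ↔ f.Flat ∧ g.Flat := by
  simp [times, Flat]

@[simp] theorem flat_ifEq {a b f g : FProg} :
    (ifEq a b f g).Flat ↔ (a.Flat ∧ b.Flat) ∧ f.Flat ∧ g.Flat := by
  simp [ifEq, Flat]
  tauto

end flat

theorem cost_fold_of_flat {l z b : FProg} (hb : b.Flat) (ask : Data → Data) (d : Data) :
    (fold l z b).cost ask d = l.cost ask d + z.cost ask d + 12 +
      (l.eval ask d).toList.length * (b.size + 18) := by
  simp only [cost, hb.cost_eq]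
  congr 1
  generalize z.eval ask d = acc
  induction (l.eval ask d).toList generalizing acc with
  | nil => simp [iterCost]
  | cons a l ih => rw [iterCost, ih, List.length_cons]; ring

/-- A procedure that takes linear time in the length of its argument number `k`. -/
def LinearCost (p : FProg) (k : ℕ) : Prop :=
  ∃ C, ∀ ask d, p.cost ask d ≤ C * (((var k).eval ask d).toList.length + 1)

theorem linearCost_fold {z b : FProg} (hz : z.Flat) (hb : b.Flat) (k : ℕ) :
    (fold (var k) z b).LinearCost k := by
  refine ⟨(var k).size + z.size + 12 + (b.size + 18), fun ask d => ?_⟩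
  rw [cost_fold_of_flat hb, (flat_var k).cost_eq, hz.cost_eq]
  nlinarith [Nat.zero_le ((var k).size + z.size + 12)]

theorem LinearCost.comp {p g : FProg} {k : ℕ} (hp : p.LinearCost k) (hg : g.Flat) :
    (FProg.comp g p).LinearCost k := by
  obtain ⟨C, hC⟩ := hp
  refine ⟨C + g.size + 1, fun ask d => ?_⟩
  have := hC ask d
  rw [cost, hg.cost_eq]
  nlinarith [Nat.zero_le (g.size + 1)]

theorem cost_push (es : List FProg) (f : FProg) (ask : Data → Data) (d : Data) :
    (push es f).cost ask d = (es.map fun e => e.cost ask d + 1).sum + f.cost ask d := by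
  induction es with
  | nil => simp [push]
  | cons e es ih =>
    rw [push, List.foldr_cons, cost, ← push, ih, List.map_cons, List.sum_cons]
    ring

theorem cost_call (p : FProg) (es : List FProg) (ask : Data → Data) (d : Data) :
    (call p es).cost ask d = (es.map fun e => e.cost ask d + 1).sum + 2 +
      p.cost ask (.ofList (es.map fun e => e.eval ask d)) := by
  rw [call, cost, cost_push, eval_push es nil (xs := []) rfl, List.append_nil]
  simp only [cost]
  ring

/-! ### Lists -/

/-- Reverse the list `[l]`. -/
def reverse : FProg := fold (var 0) nil (pair (var 0) (var 1))

theorem eval_reverse (ask : Data → Data) (xs : List Data) :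
    reverse.eval ask (.ofList [.ofList xs]) = .ofList xs.reverse := by
  rw [reverse, eval_fold_eq (σ := List Data) (α := Data) Data.ofList (fun a => a) (fun s a => a :: s)
    (xs := xs) (s₀ := []) (by simp [Data.ofList, Data.fst]) rfl
    (fun s a _ => by simp [eval, Data.ofList, Data.fst, Data.snd])]
  simp

theorem linearCost_reverse : reverse.LinearCost 0 := linearCost_fold (by simp [Flat]) (by simp [Flat]) 0

/-- `[i, l]`: the entry number `i` of `l`. -/
def get : FProg :=
  -- The accumulator pairs a counter with the value found so far. In the body of an iteration, `var
  -- 0` is the entry, `var 1` the accumulator, and the arguments of the procedure start at `var 2`.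
  comp snd (fold (var 1) (pair (const 0) nil)
    (pair (plus (comp fst (var 1)) (const 1))
      (ifEq (comp fst (var 1)) (var 2) (var 0) (comp snd (var 1)))))

theorem foldl_get {α : Type*} (j : ℕ) (xs : List α) (m : ℕ) (b : α) :
    (xs.foldl (fun (s : ℕ × α) x => (s.1 + 1, if s.1 = j then x else s.2)) (m, b)).2 =
      if m ≤ j then (xs[j - m]?).getD b else b := by
  induction xs generalizing m b with
  | nil => simp
  | cons x xs ih =>
    rw [List.foldl_cons, ih]
    rcases lt_trichotomy m j with h | h | h
    · rw [if_pos (by omega), if_pos h.le, if_neg h.ne,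
        show j - m = (j - (m + 1)) + 1 by omega, List.getElem?_cons_succ]
    · subst h; simp
    · rw [if_neg (by omega), if_neg (by omega), if_neg (by omega)]

theorem eval_get (ask : Data → Data) {n : ℕ} (f : Fin n → Data) (j : Fin n) :
    get.eval ask (.ofList [.num ((j : ℕ) : ℝ), .ofList (List.ofFn f)]) = f j := by
  rw [get, eval, eval_fold_eq (σ := ℕ × Data) (α := Data) (fun s => .node (.num s.1) s.2) (fun a => a)
    (fun s a => (s.1 + 1, if s.1 = (j : ℕ) then a else s.2))
    (xs := List.ofFn f) (s₀ := (0, .nil)) (by simp [Data.ofList, Data.fst, Data.snd]; rfl)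
    (by simp [eval])]
  · simp only [eval, Data.snd, foldl_get]
    simp
  · intro s a _
    rw [eval, eval_plus (x := s.1) (y := 1) (by simp [eval, Data.fst, Data.snd]) (by simp [eval]),
      eval_ifEq (x := s.1) (y := (j : ℕ)) (by simp [eval, Data.fst, Data.snd])
        (by simp [Data.fst, Data.snd, Data.ofList])]
    simp only [Nat.cast_inj, Nat.cast_add, Nat.cast_one]
    split_ifs <;> simp [eval, Data.fst, Data.snd]

theorem linearCost_get : get.LinearCost 1 :=
  (linearCost_fold (by simp [Flat]) (by simp [Flat]) 1).comp (by simp [Flat])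

/-- `[i, j, a, b, l]`: replace the entries number `i` and `j` of `l` by `a` and `b`, and reverse. -/
def setRev : FProg :=
  comp snd (fold (var 4) (pair (const 0) nil)
    (pair (plus (comp fst (var 1)) (const 1))
      (pair
        -- Place `j` is tested first, since in `update₂` the update at `j` is the outer one.
        (ifEq (comp fst (var 1)) (var 3) (var 5) (ifEq (comp fst (var 1)) (var 2) (var 4) (var 0)))
        (comp snd (var 1)))))

/-- `[i, j, a, b, l]`: replace the entries number `i` and `j` of `l` by `a` and `b`. -/
def set : FProg := call reverse [setRev]

theorem foldl_mapIdx {α β : Type*} (f : ℕ → α → β) (xs : List α) (m : ℕ) (l : List β) :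
    (xs.foldl (fun (s : ℕ × List β) x => (s.1 + 1, f s.1 x :: s.2)) (m, l)).2 =
      (xs.mapIdx fun t x => f (m + t) x).reverse ++ l := by
  induction xs generalizing m l with
  | nil => simp
  | cons x xs ih =>
    rw [List.foldl_cons, ih, List.mapIdx_cons]
    simp [add_assoc, add_comm 1]

theorem eval_setRev (ask : Data → Data) {n : ℕ} (f : Fin n → Data) (i j : Fin n) (a b : Data) :
    setRev.eval ask
      (.ofList [.num ((i : ℕ) : ℝ), .num ((j : ℕ) : ℝ), a, b, .ofList (List.ofFn f)]) =
      .ofList (List.ofFn (update₂ f i j (a, b))).reverse := by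
  rw [setRev, eval, eval_fold_eq (σ := ℕ × List Data) (α := Data)
    (fun s => .node (.num s.1) (.ofList s.2)) (fun a => a)
    (fun s x => (s.1 + 1,
      (fun t x => if t = (j : ℕ) then b else if t = (i : ℕ) then a else x) s.1 x :: s.2))
    (xs := List.ofFn f) (s₀ := (0, [])) (by simp [Data.ofList, Data.fst, Data.snd]; rfl)
    (by simp [eval, Data.ofList])]
  · refine congrArg Data.ofList ((foldl_mapIdx
      (fun t x => if t = (j : ℕ) then b else if t = (i : ℕ) then a else x) _ 0 []).trans ?_)
    rw [List.append_nil]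
    congr 1
    refine List.ext_getElem (by simp) fun k h1 h2 => ?_
    simp only [List.getElem_mapIdx, List.getElem_ofFn, update₂, Function.update_apply, zero_add,
      Fin.ext_iff]
  · intro s x _
    rw [eval, eval, eval_plus (x := s.1) (y := 1) (by simp [eval, Data.fst, Data.snd])
      (by simp [eval]),
      eval_ifEq (x := s.1) (y := (j : ℕ)) (by simp [eval, Data.fst, Data.snd])
        (by simp [Data.fst, Data.snd, Data.ofList]),
      eval_ifEq (x := s.1) (y := (i : ℕ)) (by simp [eval, Data.fst, Data.snd])
        (by simp [Data.fst, Data.snd, Data.ofList])]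
    simp only [Nat.cast_inj, Nat.cast_add, Nat.cast_one]
    split_ifs <;> simp [eval, Data.fst, Data.snd, Data.ofList]

theorem eval_set (ask : Data → Data) {n : ℕ} (f : Fin n → Data) (i j : Fin n) (a b : Data) :
    set.eval ask (.ofList [.num ((i : ℕ) : ℝ), .num ((j : ℕ) : ℝ), a, b, .ofList (List.ofFn f)]) =
      .ofList (List.ofFn (update₂ f i j (a, b))) := by
  rw [set, eval_call, List.map_singleton, eval_setRev, eval_reverse, List.reverse_reverse]

theorem linearCost_setRev : setRev.LinearCost 4 :=
  (linearCost_fold (by simp [Flat]) (by simp [Flat]) 4).comp (by simp [Flat])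

theorem cost_set : ∃ C, ∀ (ask : Data → Data) {n : ℕ} (f : Fin n → Data) (i j : Fin n) (a b : Data),
    set.cost ask (.ofList [.num ((i : ℕ) : ℝ), .num ((j : ℕ) : ℝ), a, b, .ofList (List.ofFn f)]) ≤
      C * (n + 1) := by
  obtain ⟨C₁, h₁⟩ := linearCost_setRev
  obtain ⟨C₂, h₂⟩ := linearCost_reverse
  refine ⟨C₁ + C₂ + 3, fun ask n f i j a b => ?_⟩
  set d := Data.ofList [.num ((i : ℕ) : ℝ), .num ((j : ℕ) : ℝ), a, b, .ofList (List.ofFn f)] with hd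
  have h := h₁ ask d
  have hlen : ((setRev.eval ask d).toList).length = n := by
    rw [hd, eval_setRev, Data.toList_ofList, List.length_reverse, List.length_ofFn]
  have h' := h₂ ask (.ofList [setRev.eval ask d])
  have hv : ((var 4).eval ask d).toList.length = n := by
    simp [hd, Data.ofList, Data.fst, Data.snd]
  have hv' : ((var 0).eval ask (.ofList [setRev.eval ask d])).toList.length = n := by
    simpa [Data.ofList, Data.fst] using hlen
  rw [hv] at h
  rw [hv'] at h'
  rw [set, cost_call]
  simp only [List.map_cons, List.map_nil, List.sum_cons, List.sum_nil]
  nlinarith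

end FProg

namespace FProg

/-! ### Complex arithmetic -/

/-- The sum of two complex expressions. -/
def cadd (f g : FProg) : FProg :=
  pair (plus (comp fst f) (comp fst g)) (plus (comp snd f) (comp snd g))

/-- The product of two complex expressions. -/
def cmul (f g : FProg) : FProg :=
  pair (minus (times (comp fst f) (comp fst g)) (times (comp snd f) (comp snd g)))
    (plus (times (comp fst f) (comp snd g)) (times (comp snd f) (comp fst g)))

/-- The conjugate of a complex expression. -/
def cconj (f : FProg) : FProg := pair (comp fst f) (minus (const 0) (comp snd f))

/-- The sum of a list of complex expressions. -/
def csum (l : List FProg) : FProg := l.foldr cadd (pair (const 0) (const 0))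

section
variable {ask : Data → Data} {d : Data} {f g : FProg} {z w : ℂ}

theorem eval_cadd (hf : f.eval ask d = complexData z) (hg : g.eval ask d = complexData w) :
    (cadd f g).eval ask d = complexData (z + w) := by
  simp [cadd, plus, eval, hf, hg, complexData, Data.fst, Data.snd, Data.arith]

theorem eval_cmul (hf : f.eval ask d = complexData z) (hg : g.eval ask d = complexData w) :
    (cmul f g).eval ask d = complexData (z * w) := by
  simp [cmul, plus, minus, times, eval, hf, hg, complexData, Data.fst, Data.snd, Data.arith]

theorem eval_cconj (hf : f.eval ask d = complexData z) :
    (cconj f).eval ask d = complexData (star z) := by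
  simp [cconj, minus, eval, hf, complexData, Data.fst, Data.snd, Data.arith]

theorem eval_csum {α : Type*} {F : α → FProg} {z : α → ℂ}
    (h : ∀ a, (F a).eval ask d = complexData (z a)) (l : List α) :
    (csum (l.map F)).eval ask d = complexData (l.map z).sum := by
  induction l with
  | nil => simp [csum, eval, complexData]
  | cons a l ih =>
    rw [List.map_cons, csum, List.foldr_cons, ← csum, eval_cadd (h a) ih, List.map_cons,
      List.sum_cons]

end

theorem eval_re {ask : Data → Data} {d : Data} {f : FProg} {z : ℂ}
    (hf : f.eval ask d = complexData z) : (comp fst f).eval ask d = .num z.re := by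
  rw [eval_comp, hf]
  rfl

theorem eval_const_nat {ask : Data → Data} {d : Data} (k : ℕ) :
    (const k).eval ask d = .num k := by
  simp [eval]

@[simp] theorem flat_cadd {f g : FProg} : (cadd f g).Flat ↔ f.Flat ∧ g.Flat := by
  simp [cadd, Flat]

@[simp] theorem flat_cmul {f g : FProg} : (cmul f g).Flat ↔ f.Flat ∧ g.Flat := by
  simp [cmul, Flat]

@[simp] theorem flat_cconj {f : FProg} : (cconj f).Flat ↔ f.Flat := by
  simp [cconj, Flat]

theorem flat_csum {α : Type*} {F : α → FProg} (h : ∀ a, (F a).Flat) (l : List α) :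
    (csum (l.map F)).Flat := by
  induction l with
  | nil => simp [csum, Flat]
  | cons a l ih =>
    rw [List.map_cons, csum, List.foldr_cons, ← csum, flat_cadd]
    exact ⟨h a, ih⟩

/-! ### The Pauli transfer matrix -/

/-- The real parts of the entries of the single-qubit Pauli operators. -/
def pauliRe : Fin 4 → Matrix (Fin 2) (Fin 2) ℚ := 
  ![!![1, 0; 0, 1], !![0, 1; 1, 0], !![0, 0; 0, 0], !![1, 0; 0, -1]]

/-- The imaginary parts of the entries of the single-qubit Pauli operators. -/
def pauliIm : Fin 4 → Matrix (Fin 2) (Fin 2) ℚ := 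
  ![!![0, 0; 0, 0], !![0, 0; 0, 0], !![0, -1; 1, 0], !![0, 0; 0, 0]]

theorem complexData_pauli (a : Fin 4) (s t : Fin 2) :
    complexData (pauli a s t) = .node (.num (pauliRe a s t)) (.num (pauliIm a s t)) := by
  fin_cases a <;> fin_cases s <;> fin_cases t <;> simp [pauli, pauliRe, pauliIm, complexData]

/-- An entry of a Pauli operator whose name is computed by `e`. -/
def pauliEntry (e : FProg) (s t : Fin 2) : FProg :=
  let c := fun a => pair (const (pauliRe a s t)) (const (pauliIm a s t))
  -- Positivity is the only available test, so the names 0, 1, 2, 3 are told apart by half-integer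
  -- thresholds.
  cond (minus e (const (1 / 2)))
    (cond (minus e (const (3 / 2))) (cond (minus e (const (5 / 2))) (c 3) (c 2)) (c 1)) (c 0)

theorem eval_pauliEntry {ask : Data → Data} {d : Data} {e : FProg} {a : Fin 4}
    (he : e.eval ask d = .num ((a : ℕ) : ℝ)) (s t : Fin 2) :
    (pauliEntry e s t).eval ask d = complexData (pauli a s t) := by
  rw [complexData_pauli, pauliEntry, eval_cond_num (eval_minus he rfl),
    eval_cond_num (eval_minus he rfl), eval_cond_num (eval_minus he rfl)]
  match a with
  | 0 => norm_num [eval]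
  | 1 => norm_num [eval]
  | 2 => norm_num [eval]
  | 3 => norm_num [eval]

theorem flat_pauliEntry {e : FProg} (he : e.Flat) (s t : Fin 2) : (pauliEntry e s t).Flat := by
  simp [pauliEntry, Flat, he]

/-- An entry of a two-qubit matrix whose rows are computed by `e`. -/
def matrixEntry (e : FProg) (s t : Fin 2 × Fin 2) : FProg :=
  comp (var (2 * t.1 + t.2)) (comp (var (2 * s.1 + s.2)) e)

theorem eval_matrixEntry {ask : Data → Data} {d : Data} {e : FProg}
    {u : Matrix (Fin 2 × Fin 2) (Fin 2 × Fin 2) ℂ}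
    (he : e.eval ask d =
      .ofList (twoBits.map fun x => .ofList (twoBits.map fun y => complexData (u x y))))
    (s t : Fin 2 × Fin 2) : (matrixEntry e s t).eval ask d = complexData (u s t) := by
  rw [matrixEntry, eval, eval, he]
  obtain ⟨s₁, s₂⟩ := s
  obtain ⟨t₁, t₂⟩ := t
  fin_cases s₁ <;> fin_cases s₂ <;> fin_cases t₁ <;> fin_cases t₂ <;> rfl

theorem flat_matrixEntry {e : FProg} (he : e.Flat) (s t : Fin 2 × Fin 2) :
    (matrixEntry e s t).Flat := by
  simp [matrixEntry, Flat, he]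

theorem sum_map_twoBits {M : Type*} [AddCommMonoid M] (f : Fin 2 × Fin 2 → M) :
    (twoBits.map f).sum = ∑ s, f s := by
  simp [twoBits, Fintype.sum_prod_type, Fin.sum_univ_two, add_assoc]

/-- An entry of the Pauli transfer matrix; `e₁, e₂` compute the Pauli operators and `e` computes the
rows of the gate. -/
def transferEntry (e₁ e₂ e : FProg) (q : Fin 4 × Fin 4) : FProg :=
  times (const (1 / 4)) (comp fst
    (csum (twoBits.map fun x => csum (twoBits.map fun w => csum (twoBits.map fun z =>
      csum (twoBits.map fun y =>
        cmul (cmul (cmul (cconj (matrixEntry e y x))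
          (cmul (pauliEntry e₁ y.1 z.1) (pauliEntry e₂ y.2 z.2))) (matrixEntry e z w))
          (cmul (pauliEntry (const (q.1 : ℕ)) w.1 x.1) (pauliEntry (const (q.2 : ℕ)) w.2 x.2))))))))

theorem eval_transferEntry {ask : Data → Data} {d : Data} {e₁ e₂ e : FProg}
    {u : Matrix (Fin 2 × Fin 2) (Fin 2 × Fin 2) ℂ} {p : Fin 4 × Fin 4}
    (h₁ : e₁.eval ask d = .num ((p.1 : ℕ) : ℝ)) (h₂ : e₂.eval ask d = .num ((p.2 : ℕ) : ℝ))
    (he : e.eval ask d =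
      .ofList (twoBits.map fun x => .ofList (twoBits.map fun y => complexData (u x y))))
    (q : Fin 4 × Fin 4) : (transferEntry e₁ e₂ e q).eval ask d = .num (transfer u p q) := by
  have hterm : ∀ x w z y, (cmul (cmul (cmul (cconj (matrixEntry e y x))
      (cmul (pauliEntry e₁ y.1 z.1) (pauliEntry e₂ y.2 z.2))) (matrixEntry e z w))
      (cmul (pauliEntry (const (q.1 : ℕ)) w.1 x.1)
        (pauliEntry (const (q.2 : ℕ)) w.2 x.2))).eval ask d =
      complexData (star (u y x) * (pauli p.1 y.1 z.1 * pauli p.2 y.2 z.2) * u z w *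
        (pauli q.1 w.1 x.1 * pauli q.2 w.2 x.2)) := fun x w z y =>
    eval_cmul (eval_cmul (eval_cmul (eval_cconj (eval_matrixEntry he y x))
      (eval_cmul (eval_pauliEntry h₁ _ _) (eval_pauliEntry h₂ _ _))) (eval_matrixEntry he z w))
      (eval_cmul (eval_pauliEntry (eval_const_nat _) _ _) (eval_pauliEntry (eval_const_nat _) _ _))
  have h := fun x => eval_csum (fun w => eval_csum (fun z => eval_csum (hterm x w z) twoBits)
    twoBits) twoBits
  replace h := eval_csum h twoBits
  rw [transferEntry, eval_times (x := 1 / 4) (by simp [eval]) (eval_re h), transfer]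
  congr 1
  rw [one_div, mul_comm, ← div_eq_mul_inv]
  congr 2
  simp only [sum_map_twoBits, Matrix.trace, Matrix.diag, Matrix.mul_apply, Finset.sum_mul,
    Matrix.conjTranspose_apply, pauli₂]

/-- The trace of the product of four matrices is unrolled into 256 terms, so that an entry costs a
constant number of steps. -/
theorem flat_transferEntry {e₁ e₂ e : FProg} (h₁ : e₁.Flat) (h₂ : e₂.Flat) (he : e.Flat)
    (q : Fin 4 × Fin 4) : (transferEntry e₁ e₂ e q).Flat := by
  rw [transferEntry, flat_times]
  refine ⟨trivial, flat_csum (fun x => flat_csum (fun w => flat_csum (fun z =>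
    flat_csum (fun y => ?_) _) _) _) _, trivial⟩
  simp only [flat_cmul, flat_cconj]
  exact ⟨⟨⟨flat_matrixEntry he _ _, flat_pauliEntry h₁ _ _, flat_pauliEntry h₂ _ _⟩,
    flat_matrixEntry he _ _⟩, flat_pauliEntry (by simp [Flat]) _ _,
    flat_pauliEntry (by simp [Flat]) _ _⟩

end FProg

/-! ### Gates acting on paths -/

/-- A path as data, with the damping factor in place of the total weight. -/
noncomputable def Path.data {n : ℕ} (a : ℝ) (p : Path n) : Data :=
  .node (.num (a ^ p.k)) (.node (.num p.y) p.P.data)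

/-- A list of paths as data. -/
noncomputable def pathsData {n : ℕ} (a : ℝ) (L : List (Path n)) : Data := .ofList (L.map (Path.data a))

theorem data_update₂ {n : ℕ} (P : PauliString n) (i j : Fin n) (q : Fin 4 × Fin 4) :
    PauliString.data (update₂ P i j q) = .ofList (List.ofFn (update₂
      (fun k => .num ((P k : ℕ) : ℝ)) i j (.num ((q.1 : ℕ) : ℝ), .num ((q.2 : ℕ) : ℝ)))) := by
  rw [PauliString.data]
  congr 2
  ext k : 1
  simp only [update₂, Function.update_apply]
  split_ifs <;> rfl

namespace FProg

/-- `[a, b, p, l, g]`: the child number `q` of the path `p`, if its Pauli operators on the qubits of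
the gate `g` are `a` and `b`. -/
def child (q : Fin 4 × Fin 4) : FProg :=
  pair (comp fst (var 2))
    (pair (times (comp fst (comp snd (var 2)))
        (transferEntry (var 0) (var 1) (comp snd (comp snd (var 4))) q))
      (call set [comp fst (var 4), comp fst (comp snd (var 4)), const (q.1 : ℕ), const (q.2 : ℕ),
        comp snd (comp snd (var 2))]))

/-- `[a, b, p, l, g]`: put the children of the path `p` in front of the list `l`. -/
def branch : FProg :=
  -- The name of a Pauli operator is positive exactly if it is not the identity, so the two tests
  -- decide whether the gate is touched.
  cond (var 0) (push (pauliPairs.map child) (var 3))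
    (cond (var 1) (push (pauliPairs.map child) (var 3)) (pair (var 2) (var 3)))

/-- `[p, l, g]`: put the children of the path `p` in front of the list `l`. -/
def children : FProg :=
  call branch
    [call get [comp fst (var 2), comp snd (comp snd (var 0))],
      call get [comp fst (comp snd (var 2)), comp snd (comp snd (var 0))], var 0, var 1, var 2]

/-- `[g, l]`: continue the paths `l` through the gate `g`. -/
def gate : FProg := fold (var 1) nil (call children [var 0, var 1, var 2])

section
variable (ask : Data → Data) {n : ℕ} (g : Gate n) (a : ℝ) (p : Path n) (L : List (Path n))

/-- The environment of `branch`. -/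
noncomputable def branchEnv : Data :=
  .ofList [.num ((p.P g.i : ℕ) : ℝ), .num ((p.P g.j : ℕ) : ℝ), p.data a, pathsData a L, g.data]

theorem eval_set_branchEnv (q : Fin 4 × Fin 4) :
    set.eval ask (.ofList ([comp fst (var 4), comp fst (comp snd (var 4)), const (q.1 : ℕ),
      const (q.2 : ℕ), comp snd (comp snd (var 2))].map fun e => e.eval ask (branchEnv g a p L))) =
      PauliString.data (update₂ p.P g.i g.j q) := by
  rw [data_update₂, ← eval_set ask]
  simp only [List.map_cons, List.map_nil, eval_const_nat]
  rfl

theorem eval_child (q : Fin 4 × Fin 4) :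
    (child q).eval ask (branchEnv g a p L) = Path.data a
      ⟨update₂ p.P g.i g.j q, p.k, p.y * transfer g.u (p.P g.i, p.P g.j) q⟩ := by
  rw [child, eval_pair, eval_pair, eval_call, eval_set_branchEnv, eval_times (x := p.y)
    (y := transfer g.u (p.P g.i, p.P g.j) q)]
  · rfl
  · rfl
  · exact eval_transferEntry rfl rfl rfl q

theorem eval_branch : branch.eval ask (branchEnv g a p L) = pathsData a (g.children p ++ L) := by
  have h : (push (pauliPairs.map child) (var 3)).eval ask (branchEnv g a p L) = pathsData a
      ((pauliPairs.map fun q =>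
        ⟨update₂ p.P g.i g.j q, p.k, p.y * transfer g.u (p.P g.i, p.P g.j) q⟩) ++ L) := by
    rw [eval_push (xs := L.map (Path.data a)) _ _ rfl, pathsData, List.map_append, List.map_map,
      List.map_map]
    congr 3
    ext q : 1
    exact eval_child ask g a p L q
  have h' : (pair (var 2) (var 3)).eval ask (branchEnv g a p L) = pathsData a ([p] ++ L) := rfl
  rw [branch, eval_cond_num (x := ((p.P g.i : ℕ) : ℝ)) rfl,
    eval_cond_num (x := ((p.P g.j : ℕ) : ℝ)) rfl, h, h', Gate.children]
  have hpos : ∀ x : Fin 4, (0 : ℝ) < ((x : ℕ) : ℝ) ↔ x ≠ 0 := fun x => by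
    rw [Nat.cast_pos, Nat.pos_iff_ne_zero, ne_eq, ne_eq, Fin.ext_iff]
    rfl
  simp only [hpos]
  by_cases h1 : p.P g.i = 0 <;> by_cases h2 : p.P g.j = 0 <;> simp [h1, h2]

theorem eval_children_args :
    ([call get [comp fst (var 2), comp snd (comp snd (var 0))],
      call get [comp fst (comp snd (var 2)), comp snd (comp snd (var 0))], var 0, var 1, var 2].map
        fun e => e.eval ask (.ofList [p.data a, pathsData a L, g.data])) =
      [.num ((p.P g.i : ℕ) : ℝ), .num ((p.P g.j : ℕ) : ℝ), p.data a, pathsData a L, g.data] := by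
  have h1 := eval_get ask (fun k => .num ((p.P k : ℕ) : ℝ)) g.i
  have h2 := eval_get ask (fun k => .num ((p.P k : ℕ) : ℝ)) g.j
  simp only [List.map_cons, List.map_nil, eval_call]
  rw [← h1, ← h2]
  rfl

theorem eval_children :
    children.eval ask (.ofList [p.data a, pathsData a L, g.data]) =
      pathsData a (g.children p ++ L) := by
  rw [children, eval_call, eval_children_args]
  exact eval_branch ask g a p L

theorem eval_gate :
    gate.eval ask (.ofList [g.data, pathsData a L]) = pathsData a (gateStep L g) := by
  rw [gate, eval_fold_eq (pathsData a) (Path.data a) (fun acc p => g.children p ++ acc) (xs := L)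
    (s₀ := []) rfl rfl]
  · rfl
  · intro s p _
    rw [eval_call, ← eval_children]
    rfl

end

/-- There are 16 children. The matrix entry of each takes constant time, and only rewriting the
Pauli string depends on the number of qubits, linearly. -/
theorem cost_branch : ∃ C, ∀ (ask : Data → Data) {n : ℕ} (g : Gate n) (a : ℝ) (p : Path n)
    (L : List (Path n)), branch.cost ask (branchEnv g a p L) ≤ C * (n + 1) := by
  have h : ∀ q : Fin 4 × Fin 4, ∃ C, ∀ (ask : Data → Data) {n : ℕ} (g : Gate n) (a : ℝ) (p : Path n)
      (L : List (Path n)), (child q).cost ask (branchEnv g a p L) + 1 ≤ C * (n + 1) := by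
    intro q
    obtain ⟨C, hC⟩ := cost_set
    have h1 : (times (comp fst (comp snd (var 2)))
        (transferEntry (var 0) (var 1) (comp snd (comp snd (var 4))) q)).Flat := by
      rw [flat_times]
      exact ⟨by simp [Flat], flat_transferEntry (by simp) (by simp) (by simp [Flat]) q⟩
    set e := times (comp fst (comp snd (var 2)))
        (transferEntry (var 0) (var 1) (comp snd (comp snd (var 4))) q) with he
    set es := [comp fst (var 4), comp fst (comp snd (var 4)), const (q.1 : ℕ), const (q.2 : ℕ),
        comp snd (comp snd (var 2))] with hes
    have hes' : ∀ (ask : Data → Data) (d : Data),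
        (es.map fun e => e.cost ask d + 1) = es.map fun e => e.size + 1 := fun ask d =>
      List.map_congr_left fun e he => by
        rw [Flat.cost_eq]
        simp only [hes, List.mem_cons, List.not_mem_nil, or_false] at he
        rcases he with rfl | rfl | rfl | rfl | rfl <;> simp [Flat]
    refine ⟨C + (comp fst (var 2)).size + e.size + (es.map fun e => e.size + 1).sum + 5,
      fun ask n g a p L => ?_⟩
    have h2 := hC ask (fun k => .num ((p.P k : ℕ) : ℝ)) g.i g.j (.num ((q.1 : ℕ) : ℝ))
      (.num ((q.2 : ℕ) : ℝ))
    have h3 : set.cost ask (.ofList (es.map fun e => e.eval ask (branchEnv g a p L))) ≤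
        C * (n + 1) := by
      refine le_of_eq_of_le ?_ h2
      simp only [hes, List.map_cons, List.map_nil, eval_const_nat]
      rfl
    have h4 : (comp fst (var 2)).cost ask (branchEnv g a p L) = (comp fst (var 2)).size :=
      Flat.cost_eq (by simp [Flat]) _ _
    rw [child, cost_pair, ← he, ← hes, cost_pair, cost_call, h1.cost_eq, h4, hes']
    nlinarith [Nat.zero_le ((comp fst (var 2)).size + e.size +
      (es.map fun e => e.size + 1).sum + 5)]
  choose C hC using h
  refine ⟨(var 0).size + (var 1).size + (pair (var 2) (var 3)).size + 2 +
    2 * ((pauliPairs.map C).sum + (var 3).size), fun ask n g a p L => ?_⟩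
  have hp : (push (pauliPairs.map child) (var 3)).cost ask (branchEnv g a p L) ≤
      (pauliPairs.map C).sum * (n + 1) + (var 3).size := by
    rw [cost_push, (flat_var 3).cost_eq, List.map_map, ← List.sum_map_mul_right]
    exact Nat.add_le_add_right (List.sum_le_sum fun q _ => hC q ask g a p L) _
  have hp2 : (pair (var 2) (var 3)).cost ask (branchEnv g a p L) = (pair (var 2) (var 3)).size :=
    Flat.cost_eq (by simp [Flat]) _ _
  rw [branch, cost_cond, cost_cond, (flat_var 0).cost_eq, (flat_var 1).cost_eq, hp2]
  nlinarith [Nat.zero_le ((var 0).size + (var 1).size + (pair (var 2) (var 3)).size + 2 +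
    2 * (var 3).size)]

theorem cost_children : ∃ C, ∀ (ask : Data → Data) {n : ℕ} (g : Gate n) (a : ℝ) (p : Path n)
    (L : List (Path n)),
    children.cost ask (.ofList [p.data a, pathsData a L, g.data]) ≤ C * (n + 1) := by
  obtain ⟨C₁, h₁⟩ := cost_branch
  obtain ⟨C₂, h₂⟩ := linearCost_get
  set e₁ := [comp fst (var 2), comp snd (comp snd (var 0))] with he₁
  set e₂ := [comp fst (comp snd (var 2)), comp snd (comp snd (var 0))] with he₂
  have hsize : ∀ es : List FProg, (∀ e ∈ es, e.Flat) → ∀ (ask : Data → Data) (d : Data),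
      (es.map fun e => e.cost ask d + 1) = es.map fun e => e.size + 1 := fun es h ask d =>
    List.map_congr_left fun e he => by rw [(h e he).cost_eq]
  have hs₁ := hsize e₁ (by simp [he₁, Flat])
  have hs₂ := hsize e₂ (by simp [he₂, Flat])
  refine ⟨C₁ + 2 * C₂ + (e₁.map fun e => e.size + 1).sum + (e₂.map fun e => e.size + 1).sum + 11 +
    (var 0).size + (var 1).size + (var 2).size, fun ask n g a p L => ?_⟩
  set d := Data.ofList [p.data a, pathsData a L, g.data] with hd
  have h3 := h₁ ask g a p L
  have hlen : p.P.data.toList.length = n := by simp [PauliString.data]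
  have h4 : get.cost ask (.ofList (e₁.map fun e => e.eval ask d)) ≤ C₂ * (n + 1) := by
    have := h₂ ask (.ofList (e₁.map fun e => e.eval ask d))
    rwa [show ((var 1).eval ask (.ofList (e₁.map fun e => e.eval ask d))) = p.P.data from rfl,
      hlen] at this
  have h5 : get.cost ask (.ofList (e₂.map fun e => e.eval ask d)) ≤ C₂ * (n + 1) := by
    have := h₂ ask (.ofList (e₂.map fun e => e.eval ask d))
    rwa [show ((var 1).eval ask (.ofList (e₂.map fun e => e.eval ask d))) = p.P.data from rfl,
      hlen] at this
  rw [children, cost_call, eval_children_args]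
  rw [branchEnv] at h3
  rw [← he₁, ← he₂, List.map_cons, List.map_cons, cost_call, cost_call, hs₁, hs₂]
  simp only [List.map_cons, List.map_nil, List.sum_cons, List.sum_nil, (flat_var _).cost_eq]
  nlinarith [Nat.zero_le ((e₁.map fun e => e.size + 1).sum + (e₂.map fun e => e.size + 1).sum +
    11 + (var 0).size + (var 1).size + (var 2).size)]

theorem cost_gate : ∃ C, ∀ (ask : Data → Data) {n : ℕ} (g : Gate n) (a : ℝ) (L : List (Path n)),
    gate.cost ask (.ofList [g.data, pathsData a L]) ≤ C * ((L.length + 1) * (n + 1)) := by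
  obtain ⟨C, hC⟩ := cost_children
  refine ⟨(var 1).size + 13 + (C + (var 0).size + (var 1).size + (var 2).size + 23),
    fun ask n g a L => ?_⟩
  refine (cost_fold_le (pathsData a) (Path.data a) (fun acc p => g.children p ++ acc) (xs := L)
    (s₀ := []) rfl rfl ?_
    (B := C * (n + 1) + ((var 0).size + (var 1).size + (var 2).size + 5)) ?_).trans ?_
  · intro pre p post _
    rw [eval_call, ← eval_children]
    rfl
  · intro pre p post _
    have := hC ask g a p (pre.foldl (fun acc p => g.children p ++ acc) [])
    rw [cost_call]
    simp only [List.map_cons, List.map_nil, List.sum_cons, List.sum_nil, (flat_var _).cost_eq]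
    change _ + _ + children.cost ask (.ofList [p.data a, pathsData a _, g.data]) ≤ _
    omega
  · rw [(flat_var _).cost_eq]
    simp only [cost]
    set S := (var 0).size + (var 1).size + (var 2).size + 23
    have h1 : L.length * (C * (n + 1) + ((var 0).size + (var 1).size + (var 2).size + 5) + 18) ≤
        (C + S) * ((L.length + 1) * (n + 1)) := by
      have : C * (n + 1) + ((var 0).size + (var 1).size + (var 2).size + 5) + 18 ≤
          (C + S) * (n + 1) := by
        have : (var 0).size + (var 1).size + (var 2).size + 5 + 18 = S := rfl
        nlinarith [Nat.zero_le (S * n)]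
      calc _ ≤ (L.length + 1) * ((C + S) * (n + 1)) := Nat.mul_le_mul (Nat.le_succ _) this
        _ = _ := by ring
    have h2 : (var 1).size + 13 ≤ ((var 1).size + 13) * ((L.length + 1) * (n + 1)) :=
      Nat.le_mul_of_pos_right _ (by positivity)
    calc _ ≤ ((var 1).size + 13) + (C + S) * ((L.length + 1) * (n + 1)) := by omega
      _ ≤ ((var 1).size + 13) * ((L.length + 1) * (n + 1)) +
          (C + S) * ((L.length + 1) * (n + 1)) := by omega
      _ = _ := by simp only [S]; ring

end FProg

/-- Paths are kept as long as their damping factors exceed `1 / R ^ 2`. -/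
noncomputable def keepAbove (a : ℝ) (R k : ℕ) : Bool := decide (1 < a ^ k * R * R)

namespace FProg

theorem cost_call_of_flat {es : List FProg} (hes : ∀ e ∈ es, e.Flat) (p : FProg)
    (ask : Data → Data) (d : Data) :
    (call p es).cost ask d = (es.map fun e => e.size + 1).sum + 2 +
      p.cost ask (.ofList (es.map fun e => e.eval ask d)) := by
  rw [cost_call]
  congr 3
  exact List.map_congr_left fun e he => by rw [(hes e he).cost_eq]

theorem add_mul_le_mul (m n C S S' : ℕ) :
    S' + m * (C * n + S) ≤ (C + S + S') * ((m + 1) * (n + 1)) := by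
  nlinarith [Nat.zero_le (m * n), Nat.zero_le (S * m * n), Nat.zero_le (C * m), Nat.zero_le (C * n),
    Nat.zero_le C, Nat.zero_le S, Nat.zero_le (S * n), Nat.zero_le (S' * m * n),
    Nat.zero_le (S' * m), Nat.zero_le (S' * n)]

/-! ### Noise acting on paths -/

/-- `[a, x, P]`: multiply `x` by `a` for each qubit on which `P` is not the identity. -/
def damp : FProg := fold (var 2) (var 1) (cond (var 0) (times (var 1) (var 2)) (var 1))

theorem pauli_pos_iff (x : Fin 4) : (0 : ℝ) < ((x : ℕ) : ℝ) ↔ x ≠ 0 := by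
  rw [Nat.cast_pos, Nat.pos_iff_ne_zero, ne_eq, ne_eq, Fin.ext_iff]
  rfl

/-- The program never computes a weight: the damping factor is updated by repeated multiplication,
which suffices for both the threshold test and the final sum. -/
theorem eval_damp (ask : Data → Data) {n : ℕ} (P : PauliString n) (a x : ℝ) :
    damp.eval ask (.ofList [.num a, .num x, P.data]) = .num (x * a ^ P.weight) := by
  rw [damp, eval_fold_eq (σ := ℝ) (α := Fin n) Data.num (fun k => .num ((P k : ℕ) : ℝ))
    (fun s k => if P k = 0 then s else s * a) (xs := List.finRange n) (s₀ := x)]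
  · congr 1
    have h : ∀ (l : List (Fin n)) (x : ℝ), l.foldl (fun s k => if P k = 0 then s else s * a) x =
        x * (l.map fun k => if P k = 0 then 1 else a).prod := by
      intro l
      induction l with
      | nil => simp
      | cons k l ih =>
        intro x
        rw [List.foldl_cons, ih, List.map_cons, List.prod_cons]
        split_ifs <;> ring
    rw [h, ← List.ofFn_eq_map, List.prod_ofFn, PauliString.weight, Finset.prod_ite]
    simp
  · simp only [eval_var_succ, eval_var_zero, Data.ofList, Data.snd, Data.fst, PauliString.data,
      List.ofFn_eq_map]
  · rfl
  · intro s k _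
    rw [eval_cond_num (x := ((P k : ℕ) : ℝ)) rfl, eval_times (x := s) (y := a) rfl rfl]
    simp only [pauli_pos_iff, ite_not]
    split_ifs <;> rfl

theorem linearCost_damp : damp.LinearCost 2 := linearCost_fold (by simp) (by simp [Flat]) 2

/-- `[x, p, l, R]`: put the path `p`, with `x` as its damping factor, in front of the list `l` if
`x` exceeds `1 / R ^ 2`. -/
def keepOrDrop : FProg :=
  -- The threshold is cleared of its denominator, in the same form as in `keepAbove`.
  cond (minus (times (times (var 0) (var 3)) (var 3)) (const 1))
    (pair (pair (var 0) (comp snd (var 1))) (var 2)) (var 2)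

theorem flat_keepOrDrop : keepOrDrop.Flat := by simp [keepOrDrop, Flat]

theorem eval_keepOrDrop (ask : Data → Data) {n : ℕ} (a : ℝ) (R : ℕ) (p : Path n)
    (L : List (Path n)) :
    keepOrDrop.eval ask (.ofList [.num (a ^ p.bump.k), p.data a, pathsData a L, .num R]) =
      pathsData a (if keepAbove a R p.bump.k then p.bump :: L else L) := by
  rw [keepOrDrop, eval_cond_num (x := a ^ p.bump.k * R * R - 1)
    (eval_minus (eval_times (eval_times rfl rfl) rfl) (by simp [eval]))]
  simp only [sub_pos, keepAbove, decide_eq_true_eq]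
  split_ifs <;> rfl

/-- `[a, R, l]`: a layer of noise acts on the paths `l`. -/
def noise : FProg :=
  fold (var 2) nil (call keepOrDrop
    [call damp [var 2, comp fst (var 0), comp snd (comp snd (var 0))], var 0, var 1, var 3])

theorem eval_noise_args (ask : Data → Data) {n : ℕ} (a : ℝ) (R : ℕ) (L acc : List (Path n))
    (p : Path n) :
    ([call damp [var 2, comp fst (var 0), comp snd (comp snd (var 0))], var 0, var 1, var 3].map
      fun e => e.eval ask (.node (p.data a) (.node (pathsData a acc)
        (.ofList [.num a, .num R, pathsData a L])))) =
      [.num (a ^ p.bump.k), p.data a, pathsData a acc, .num R] := by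
  have h := eval_damp ask p.P a (a ^ p.k)
  rw [← pow_add] at h
  simp only [List.map_cons, List.map_nil, eval_call]
  rw [Path.bump, ← h]
  rfl

theorem eval_noise (ask : Data → Data) {n : ℕ} (a : ℝ) (R : ℕ) (L : List (Path n)) :
    noise.eval ask (.ofList [.num a, .num R, pathsData a L]) =
      pathsData a (noiseStep (keepAbove a R) L) := by
  rw [noise, eval_fold_eq (pathsData a) (Path.data a)
    (fun acc p => if keepAbove a R p.bump.k then p.bump :: acc else acc) (xs := L) (s₀ := [])
    rfl rfl]
  · rfl
  · intro s p _
    rw [eval_call, eval_noise_args, eval_keepOrDrop]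

theorem cost_noise : ∃ C, ∀ (ask : Data → Data) {n : ℕ} (a : ℝ) (R : ℕ) (L : List (Path n)),
    noise.cost ask (.ofList [.num a, .num R, pathsData a L]) ≤ C * ((L.length + 1) * (n + 1)) := by
  obtain ⟨C, hC⟩ := linearCost_damp
  set es := [var 2, comp fst (var 0), comp snd (comp snd (var 0))] with hes
  have hes' : ∀ e ∈ es, e.Flat := by simp [hes, Flat]
  set S := (es.map fun e => e.size + 1).sum + (var 0).size + (var 1).size + (var 3).size +
    keepOrDrop.size + 8 with hS
  refine ⟨C + (C + S + 18) + ((var 2).size + 13), fun ask n a R L => ?_⟩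
  refine (cost_fold_le (pathsData a) (Path.data a)
    (fun acc p => if keepAbove a R p.bump.k then p.bump :: acc else acc) (xs := L) (s₀ := [])
    rfl rfl ?_ (B := C * n + (C + S)) ?_).trans ?_
  · intro pre p post _
    rw [eval_call, eval_noise_args, eval_keepOrDrop]
  · intro pre p post _
    generalize pre.foldl _ _ = acc
    have h := hC ask (.ofList (es.map fun e => e.eval ask (.node (p.data a)
      (.node (pathsData a acc) (.ofList [.num a, .num R, pathsData a L])))))
    rw [show ((var 2).eval ask (.ofList (es.map fun e => e.eval ask (.node (p.data a)
      (.node (pathsData a acc) (.ofList [.num a, .num R, pathsData a L])))))) = p.P.data from rfl,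
      show p.P.data.toList.length = n by simp [PauliString.data]] at h
    rw [cost_call, flat_keepOrDrop.cost_eq, List.map_cons, ← hes, cost_call_of_flat hes']
    simp only [List.map_cons, List.map_nil, List.sum_cons, List.sum_nil, (flat_var _).cost_eq]
    rw [hS]
    nlinarith
  · rw [(flat_var _).cost_eq]
    simp only [cost]
    refine le_trans (le_of_eq ?_) (add_mul_le_mul L.length n C (C + S + 18) ((var 2).size + 13))
    ring

/-! ### Circuits acting on paths -/

/-- `[a, R, g, l]`: a layer of noise and then the gates `g` act on the paths `l`. -/
def layer : FProg :=
  fold (var 2) (call noise [var 0, var 1, var 3]) (call gate [var 0, var 1])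

/-- The arguments of `layer`. -/
noncomputable def layerEnv {n : ℕ} (a : ℝ) (R : ℕ) (l : Layer n) (L : List (Path n)) : Data :=
  .ofList [.num a, .num R, .ofList (l.gates.map Gate.data), pathsData a L]

section
variable (ask : Data → Data) {n : ℕ} (a : ℝ) (R : ℕ) (l : Layer n) (L : List (Path n))

theorem eval_layer_noise : (call noise [var 0, var 1, var 3]).eval ask (layerEnv a R l L) =
    pathsData a (noiseStep (keepAbove a R) L) := by
  rw [eval_call, ← eval_noise ask]
  rfl

theorem eval_layer_gate (d : Data) (g : Gate n) : (call gate [var 0, var 1]).eval ask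
    (.node g.data (.node (pathsData a L) d)) = pathsData a (gateStep L g) := by
  rw [eval_call, ← eval_gate ask]
  rfl

theorem eval_layer :
    layer.eval ask (layerEnv a R l L) = pathsData a (layerStep (keepAbove a R) L l) := by
  rw [layer, eval_fold_eq (pathsData a) Gate.data gateStep (xs := l.gates)
    (s₀ := noiseStep (keepAbove a R) L) rfl (eval_layer_noise ask a R l L)]
  · rfl
  · exact fun s g _ => eval_layer_gate ask a s _ g

end

/-- Each gate takes time linear in the current number of paths, so `B` has to bound every
intermediate list; `Bounded.of_layerStep` provides this. -/
theorem cost_layer : ∃ C, ∀ (ask : Data → Data) {n : ℕ} (a : ℝ) (R : ℕ) (l : Layer n)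
    (L : List (Path n)) (B : ℕ), L.length ≤ B →
    (∀ pre post, l.gates = pre ++ post →
      (pre.foldl gateStep (noiseStep (keepAbove a R) L)).length ≤ B) →
    layer.cost ask (layerEnv a R l L) ≤ C * ((l.gates.length + 1) * ((B + 1) * (n + 1))) := by
  obtain ⟨C₁, h₁⟩ := cost_noise
  obtain ⟨C₂, h₂⟩ := cost_gate
  have hf₁ : ∀ e ∈ [var 0, var 1, var 3], e.Flat := by simp
  have hf₂ : ∀ e ∈ [var 0, var 1], e.Flat := by simp
  set S₁ := ([var 0, var 1, var 3].map fun e => e.size + 1).sum + 2 with hS₁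
  set S₂ := ([var 0, var 1].map fun e => e.size + 1).sum + 2 with hS₂
  refine ⟨C₁ + C₂ + S₁ + S₂ + (var 2).size + 30, fun ask n a R l L B hL hB => ?_⟩
  refine (cost_fold_le (pathsData a) Gate.data gateStep (xs := l.gates)
    (s₀ := noiseStep (keepAbove a R) L) rfl (eval_layer_noise ask a R l L)
    (fun pre g post _ => eval_layer_gate ask a _ _ g) (B := S₂ + C₂ * ((B + 1) * (n + 1))) ?_).trans ?_
  · intro pre g post h
    have h3 := h₂ ask g a (pre.foldl gateStep (noiseStep (keepAbove a R) L))
    have h4 := hB pre (g :: post) h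
    rw [cost_call_of_flat hf₂, hS₂]
    refine Nat.add_le_add_left (h3.trans (Nat.mul_le_mul_left _ ?_)) _
    gcongr
  · have h3 := h₁ ask a R L
    rw [(flat_var _).cost_eq, cost_call_of_flat hf₁, ← hS₁]
    have h4 : noise.cost ask (.ofList ([var 0, var 1, var 3].map fun e =>
        e.eval ask (layerEnv a R l L))) ≤ C₁ * ((B + 1) * (n + 1)) :=
      h3.trans (Nat.mul_le_mul_left _ (by gcongr))
    set X := (B + 1) * (n + 1) with hX
    have hX1 : 1 ≤ X := Nat.mul_pos (Nat.succ_pos _) (Nat.succ_pos _)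
    set m := l.gates.length
    have h5 : (var 2).size + (S₁ + C₁ * X) + 12 + m * (S₂ + C₂ * X + 18) ≤
        ((var 2).size + S₁ + C₁ + 12) * X + m * ((S₂ + C₂ + 18) * X) := by
      have : m * (S₂ + C₂ * X + 18) ≤ m * ((S₂ + C₂ + 18) * X) :=
        Nat.mul_le_mul_left _ (by nlinarith)
      nlinarith
    calc _ ≤ _ := Nat.add_le_add_right (Nat.add_le_add_right (Nat.add_le_add_left
          (Nat.add_le_add_left h4 _) _) _) _
      _ ≤ _ := h5
      _ ≤ (C₁ + C₂ + S₁ + S₂ + (var 2).size + 30) * X +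
          m * ((C₁ + C₂ + S₁ + S₂ + (var 2).size + 30) * X) := by
        exact Nat.add_le_add (Nat.mul_le_mul_right _ (by omega))
          (Nat.mul_le_mul_left _ (Nat.mul_le_mul_right _ (by omega)))
      _ = _ := by ring

end FProg

theorem NoisyCircuit.length_layers_lt {n : ℕ} {γ : ℝ} (C : NoisyCircuit n γ) :
    C.layers.length + 1 ≤ C.cost := by
  rw [NoisyCircuit.cost]
  have : ∀ l : List (Layer n), l.length ≤ (l.map fun L => 1 + L.gates.length).sum := by
    intro l
    induction l with
    | nil => simp
    | cons a l ih => simp only [List.length_cons, List.map_cons, List.sum_cons]; omega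
  have := this C.layers
  omega

theorem NoisyCircuit.length_gates_lt {n : ℕ} {γ : ℝ} (C : NoisyCircuit n γ) {L : Layer n}
    (hL : L ∈ C.layers) : L.gates.length + 1 ≤ C.cost := by
  have : 1 + L.gates.length ≤ (C.layers.map fun L => 1 + L.gates.length).sum :=
    List.le_sum_of_mem (List.mem_map_of_mem (f := fun L => 1 + L.gates.length) hL)
  rw [NoisyCircuit.cost]
  omega

namespace FProg

/-! ### The simulation of a noisy circuit -/

/-- `[c, o, R]`: the paths of the observable `o` through the noisy circuit `c`, before the first
layer of noise. -/
def evolve : FProg :=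
  fold (call reverse [comp snd (var 0)]) (pair (pair (const 1) (pair (const 1) (var 1))) nil)
    (call layer [comp fst (var 2), var 4, var 0, var 1])

/-- `[c, o, R]`: the truncated Pauli path sum for the observable `o` and the noisy circuit `c`. -/
def simulate : FProg :=
  fold (call noise [comp fst (var 0), var 2, evolve]) (const 0)
    (plus (var 1) (times (times (comp fst (comp snd (var 0))) (comp fst (var 0)))
      (comp query (comp snd (comp snd (var 0))))))

/-- The arguments of `simulate`. -/
noncomputable def simulateEnv {n : ℕ} {γ : ℝ} (C : NoisyCircuit n γ) (O : PauliString n) (R : ℕ) :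
    Data :=
  .ofList [C.data, O.data, .num R]

section
variable (ask : Data → Data) {n : ℕ} {γ : ℝ} (C : NoisyCircuit n γ) (O : PauliString n) (R : ℕ)

theorem eval_evolve_layers : (call reverse [comp snd (var 0)]).eval ask (simulateEnv C O R) =
    .ofList (C.layers.reverse.map fun L => .ofList (L.gates.map Gate.data)) := by
  rw [eval_call, List.map_reverse, ← eval_reverse ask]
  rfl

theorem eval_evolve_init :
    (pair (pair (const 1) (pair (const 1) (var 1))) nil).eval ask (simulateEnv C O R) =
      pathsData (Real.exp (-C.rate)) [⟨O, 0, 1⟩] := by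
  simp [eval, simulateEnv, pathsData, Path.data, Data.ofList, Data.fst, Data.snd]

theorem eval_evolve_step (L : List (Path n)) (l : Layer n) :
    (call layer [comp fst (var 2), var 4, var 0, var 1]).eval ask
      (.node (.ofList (l.gates.map Gate.data)) (.node (pathsData (Real.exp (-C.rate)) L)
        (simulateEnv C O R))) = pathsData (Real.exp (-C.rate))
          (layerStep (keepAbove (Real.exp (-C.rate)) R) L l) := by
  rw [eval_call, ← eval_layer ask]
  rfl

theorem eval_evolve : evolve.eval ask (simulateEnv C O R) = pathsData (Real.exp (-C.rate))
    (C.layers.reverse.foldl (layerStep (keepAbove (Real.exp (-C.rate)) R)) [⟨O, 0, 1⟩]) := by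
  rw [evolve, eval_fold_eq (pathsData (Real.exp (-C.rate)))
    (fun L : Layer n => .ofList (L.gates.map Gate.data)) _
    (eval_evolve_layers ask C O R) (eval_evolve_init ask C O R)
    (fun s l _ => eval_evolve_step ask C O R s l)]

theorem eval_simulate_noise :
    (call noise [comp fst (var 0), var 2, evolve]).eval ask (simulateEnv C O R) =
      pathsData (Real.exp (-C.rate)) (paths (keepAbove (Real.exp (-C.rate)) R) C.layers O) := by
  rw [eval_call, paths, ← eval_noise ask]
  simp only [List.map_cons, List.map_nil, eval_evolve]
  rfl

theorem foldl_add_eq {α : Type*} (f : α → ℝ) (l : List α) (x : ℝ) :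
    l.foldl (fun s p => s + f p) x = x + (l.map f).sum := by
  induction l generalizing x with
  | nil => simp
  | cons a l ih => rw [List.foldl_cons, ih, List.map_cons, List.sum_cons, add_assoc]

theorem eval_simulate {ρ : Op n}
    (hask : ∀ P : PauliString n, ask P.data = .num (ρ * P.op).trace.re) :
    simulate.eval ask (simulateEnv C O R) = .num (pathSum (Real.exp (-C.rate)) ρ
      (paths (keepAbove (Real.exp (-C.rate)) R) C.layers O)) := by
  rw [simulate, eval_fold_eq (σ := ℝ) Data.num (Path.data (Real.exp (-C.rate)))
    (fun s p => s + p.y * Real.exp (-C.rate) ^ p.k * (ρ * p.P.op).trace.re)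
    (eval_simulate_noise ask C O R) (s₀ := 0) (by simp [eval])]
  · rw [foldl_add_eq, zero_add, pathSum]
  · intro s p _
    exact eval_plus rfl (eval_times (eval_times rfl rfl) (hask p.P))

end

theorem bounded_foldl_layerStep {n : ℕ} {keep : ℕ → Bool} {L : List (Path n)}
    (hL : Bounded keep L) (ls : List (Layer n)) : Bounded keep (ls.foldl (layerStep keep) L) := by
  induction ls generalizing L with
  | nil => exact hL
  | cons l ls ih => exact ih (hL.of_layerStep l (post := []) (by simp))

/-- Both the number of layers and the number of gates in a layer are at most the cost of the
circuit, which explains its square. The factor `B + 1` comes from the number of paths and `n + 1`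
from handling one path. -/
theorem cost_evolve : ∃ K, ∀ (ask : Data → Data) {n : ℕ} {γ : ℝ} (C : NoisyCircuit n γ)
    (O : PauliString n) (R B : ℕ), keepAbove (Real.exp (-C.rate)) R 0 →
    (∀ k, keepAbove (Real.exp (-C.rate)) R k → 16 ^ k ≤ B) →
    evolve.cost ask (simulateEnv C O R) ≤ K * (C.cost * (C.cost * ((B + 1) * (n + 1)))) := by
  obtain ⟨C₁, h₁⟩ := linearCost_reverse
  obtain ⟨C₂, h₂⟩ := cost_layer
  have hf₁ : ∀ e ∈ [comp snd (var 0)], e.Flat := by simp [Flat]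
  have hf₂ : ∀ e ∈ [comp fst (var 2), var 4, var 0, var 1], e.Flat := by simp [Flat]
  set z := pair (pair (const 1) (pair (const 1) (var 1))) nil with hz
  set S₁ := ([comp snd (var 0)].map fun e => e.size + 1).sum + 2 with hS₁
  set S₂ := ([comp fst (var 2), var 4, var 0, var 1].map fun e => e.size + 1).sum + 2 with hS₂
  refine ⟨C₁ + S₁ + z.size + 12 + (S₂ + C₂ + 18), fun ask n γ C O R B h0 hB => ?_⟩
  have hbd := fun ls => (bounded_foldl_layerStep (bounded_singleton h0 O) ls)
  set Y := C.cost * ((B + 1) * (n + 1)) with hY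
  have hcost : 1 ≤ C.cost := by rw [NoisyCircuit.cost]; omega
  have hY1 : 1 ≤ Y := Nat.mul_pos hcost (Nat.mul_pos (Nat.succ_pos _) (Nat.succ_pos _))
  refine (cost_fold_le (pathsData (Real.exp (-C.rate)))
    (fun L : Layer n => .ofList (L.gates.map Gate.data)) _
    (eval_evolve_layers ask C O R) (eval_evolve_init ask C O R)
    (fun pre l post _ => eval_evolve_step ask C O R _ l) (B := S₂ + C₂ * Y) ?_).trans ?_
  · intro pre l post h
    have hl : l ∈ C.layers := List.mem_reverse.1 (h ▸ by simp)
    have h3 := h₂ ask (Real.exp (-C.rate)) R l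
      (pre.foldl (layerStep (keepAbove (Real.exp (-C.rate)) R)) [⟨O, 0, 1⟩]) B
      ((hbd pre).length_le hB) fun pre' post' h' => ((hbd pre).of_layerStep l h').length_le hB
    rw [cost_call_of_flat hf₂, hS₂]
    refine Nat.add_le_add_left (h3.trans (Nat.mul_le_mul_left _ ?_)) _
    exact Nat.mul_le_mul_right _ (NoisyCircuit.length_gates_lt C hl)
  · have h3 := h₁ ask (.ofList ([comp snd (var 0)].map fun e => e.eval ask (simulateEnv C O R)))
    rw [show ((var 0).eval ask (.ofList ([comp snd (var 0)].map fun e =>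
      e.eval ask (simulateEnv C O R)))).toList.length = C.layers.length by
        change (Circuit.data C.layers).toList.length = _
        simp [Circuit.data]] at h3
    have hflat : z.Flat := by simp [hz, Flat]
    have hlen := NoisyCircuit.length_layers_lt C
    rw [cost_call_of_flat hf₁, hflat.cost_eq, ← hS₁, List.length_reverse]
    have h4 : C₁ * (C.layers.length + 1) ≤ C₁ * (C.cost * Y) :=
      Nat.mul_le_mul_left _ (hlen.trans (Nat.le_mul_of_pos_right _ hY1))
    have h5 : C.layers.length * (S₂ + C₂ * Y + 18) ≤ (S₂ + C₂ + 18) * (C.cost * Y) := by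
      calc _ ≤ C.cost * ((S₂ + C₂ + 18) * Y) :=
            Nat.mul_le_mul (by omega) (by nlinarith)
        _ = _ := by ring
    have h6 : S₁ + z.size + 12 ≤ (S₁ + z.size + 12) * (C.cost * Y) :=
      Nat.le_mul_of_pos_right _ (Nat.mul_pos hcost hY1)
    calc _ ≤ (S₁ + z.size + 12) * (C.cost * Y) + C₁ * (C.cost * Y) +
          (S₂ + C₂ + 18) * (C.cost * Y) := by omega
      _ = _ := by ring

theorem cost_simulate : ∃ K, ∀ (ask : Data → Data) {n : ℕ} {γ : ℝ} (C : NoisyCircuit n γ)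
    (O : PauliString n) (R B : ℕ), keepAbove (Real.exp (-C.rate)) R 0 →
    (∀ k, keepAbove (Real.exp (-C.rate)) R k → 16 ^ k ≤ B) →
    simulate.cost ask (simulateEnv C O R) ≤ K * (C.cost * (C.cost * ((B + 1) * (n + 1)))) := by
  obtain ⟨C₁, h₁⟩ := cost_evolve
  obtain ⟨C₂, h₂⟩ := cost_noise
  set b := plus (var 1) (times (times (comp fst (comp snd (var 0))) (comp fst (var 0)))
    (comp query (comp snd (comp snd (var 0))))) with hb
  have hbf : b.Flat := by simp [hb, Flat]
  refine ⟨C₁ + C₂ + (comp fst (var 0)).size + (var 2).size + b.size + 40,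
    fun ask n γ C O R B h0 hB => ?_⟩
  have hbd := bounded_foldl_layerStep (bounded_singleton h0 O) C.layers.reverse
  have h3 := h₁ ask C O R B h0 hB
  have h4 := h₂ ask (Real.exp (-C.rate)) R
    (C.layers.reverse.foldl (layerStep (keepAbove (Real.exp (-C.rate)) R)) [⟨O, 0, 1⟩])
  set X := (B + 1) * (n + 1) with hX
  have hcost : 1 ≤ C.cost := by rw [NoisyCircuit.cost]; omega
  have hX1 : B + 1 ≤ X := Nat.le_mul_of_pos_right _ (Nat.succ_pos _)
  have hXZ : X ≤ C.cost * (C.cost * X) :=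
    (Nat.le_mul_of_pos_left _ hcost).trans (Nat.le_mul_of_pos_left _ hcost)
  set Z := C.cost * (C.cost * X)
  have h5 : noise.cost ask (.ofList ([comp fst (var 0), var 2, evolve].map fun e =>
      e.eval ask (simulateEnv C O R))) ≤ C₂ * Z := by
    simp only [List.map_cons, List.map_nil, eval_evolve]
    refine h4.trans (Nat.mul_le_mul_left _ (le_trans ?_ hXZ))
    exact Nat.mul_le_mul_right _ (Nat.succ_le_succ (hbd.length_le hB))
  rw [simulate, cost_fold_of_flat hbf, eval_simulate_noise, cost_call, pathsData,
    Data.toList_ofList, List.length_map]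
  have h6 : (paths (keepAbove (Real.exp (-C.rate)) R) C.layers O).length ≤ Z :=
    (hbd.of_noiseStep.length_le hB).trans (by omega)
  have h7 : (comp fst (var 0)).cost ask (simulateEnv C O R) = (comp fst (var 0)).size :=
    Flat.cost_eq (by simp [Flat]) _ _
  simp only [List.map_cons, List.map_nil, List.sum_cons, List.sum_nil, (flat_var _).cost_eq, h7]
  simp only [List.map_cons, List.map_nil] at h5
  have h8 : (const 0).cost ask (simulateEnv C O R) = 1 := rfl
  rw [h8]
  have h9 := Nat.mul_le_mul_right (b.size + 18) h6
  have hZ1 : 1 ≤ Z := by omega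
  have h10 : (comp fst (var 0)).size + (var 2).size + 20 ≤
      ((comp fst (var 0)).size + (var 2).size + 20) * Z := Nat.le_mul_of_pos_right _ hZ1
  calc _ ≤ ((comp fst (var 0)).size + (var 2).size + 20) * Z + C₁ * Z + C₂ * Z +
        Z * (b.size + 18) := by omega
    _ ≤ _ := by nlinarith

/-! ### Sampling -/

end FProg

/-- A list of bits as data. -/
noncomputable def bitListData (l : List Bool) : Data := .ofList (l.map fun b => .num (if b then 1 else 0))

/-- A list of measurement outcomes as data. -/
noncomputable def outcomeListData (l : List Bool) : Data := .ofList (l.map fun b => .num (sign b))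

theorem bitsData_eq {m : ℕ} (s : Fin m → Bool) : bitsData s = bitListData (List.ofFn s) := by
  rw [bitsData, bitListData, List.map_ofFn]
  rfl

theorem outcomesData_eq {m : ℕ} (r : Fin m → Bool) :
    outcomesData r = outcomeListData (List.ofFn r) := by
  rw [outcomesData, outcomeListData, List.map_ofFn]
  rfl

/-- Comparison of `x` with the number in the unit interval whose first `K` binary digits are the
random bits: the result is positive if and only if `x` is larger. -/
noncomputable def draw : ℕ → ℝ → List Bool → ℝ
  | 0, x, _ => x
  | _ + 1, x, [] => x
  | K + 1, x, b :: l => draw K (2 * x - if b then 1 else 0) l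

/-- Measurement outcomes with expectation values `f`, sampled with `K` random bits each. -/
noncomputable def sampleOutcomes {α : Type*} (f : α → ℝ) (K : ℕ) : List α → List Bool → List Bool
  | [], _ => []
  | c :: cs, l => decide (0 < draw K ((f c + 1) / 2) l) :: sampleOutcomes f K cs (l.drop K)

namespace FProg

/-- `[x, l, k]`: compare `x` with a random number, using one of the bits `l` for each entry of `k`. -/
def sample : FProg :=
  fold (var 2) (pair (var 0) (var 1))
    (pair (minus (times (const 2) (comp fst (var 1))) (comp fst (comp snd (var 1))))
      (comp snd (comp snd (var 1))))

theorem eval_sample (ask : Data → Data) (K : ℕ) (x : ℝ) {l : List Bool} (hl : K ≤ l.length) :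
    sample.eval ask (.ofList [.num x, bitListData l, .ofList (List.replicate K .nil)]) =
      .node (.num (draw K x l)) (bitListData (l.drop K)) := by
  have h : ∀ (d : Data) (K : ℕ) (x : ℝ) (l : List Bool), K ≤ l.length →
      (List.replicate K Data.nil).foldl (fun acc a =>
        (pair (minus (times (const 2) (comp fst (var 1))) (comp fst (comp snd (var 1))))
          (comp snd (comp snd (var 1)))).eval ask (.node a (.node acc d)))
        (.node (.num x) (bitListData l)) = .node (.num (draw K x l)) (bitListData (l.drop K)) := by
    intro d K
    induction K with
    | zero => intro x l _; rfl
    | succ K ih =>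
      intro x l hl
      match l with
      | [] => simp at hl
      | b :: l =>
        rw [List.replicate_succ, List.foldl_cons, draw, List.drop_succ_cons,
          ← ih _ l (by simpa using hl), eval_pair, eval_minus (x := 2 * x)
            (y := if b then 1 else 0) (eval_times (x := 2) (y := x) (by simp [eval]) rfl) rfl]
        rfl
  rw [sample, eval]
  simp only [eval_var_succ, eval_var_zero, Data.ofList, Data.fst, Data.snd, Data.toList_ofList,
    eval_pair]
  exact h _ K x l hl

theorem linearCost_sample : sample.LinearCost 2 := linearCost_fold (by simp [Flat]) (by simp [Flat]) 2

/-- `[s, r]`: record the outcome `s` of sampling in front of the list `r`. -/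
def record : FProg :=
  pair (comp snd (var 0)) (pair (cond (comp fst (var 0)) (const 1) (const (-1))) (var 1))

theorem flat_record : record.Flat := by simp [record, Flat]

/-- The body of `outcomes`. -/
def outcomesBody : FProg :=
  call record [call sample [times (plus (call simulate [var 0, var 4, var 6]) (const 1))
    (const (1 / 2)), comp fst (var 1), var 5], comp snd (var 1)]

/-- `[c, l, o, k, R]`: sample the outcomes of the noisy circuits `c` with the random bits `l`. The
result consists of the remaining bits and the outcomes in reverse order. -/
def outcomes : FProg :=
  fold (var 0) (pair (var 1) nil) outcomesBody

/-- The arguments of `outcomes`. -/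
noncomputable def outcomesEnv {n : ℕ} {γ : ℝ} (Cs : List (NoisyCircuit n γ)) (l : List Bool)
    (O : PauliString n) (R : ℕ) : Data :=
  .ofList [.ofList (Cs.map NoisyCircuit.data), bitListData l, O.data,
    .ofList (List.replicate R .nil), .num R]

/-- The state of `outcomes`: the remaining bits and the outcomes in reverse order. -/
noncomputable def outcomesState (s : List Bool × List Bool) : Data :=
  .node (bitListData s.1) (outcomeListData s.2)

/-- The step of `outcomes`. -/
noncomputable def outcomesStep {α : Type*} (f : α → ℝ) (K : ℕ) (s : List Bool × List Bool) (c : α) :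
    List Bool × List Bool :=
  (s.1.drop K, decide (0 < draw K ((f c + 1) / 2) s.1) :: s.2)

theorem foldl_outcomesStep {α : Type*} (f : α → ℝ) (K : ℕ) (cs : List α) (l r : List Bool) :
    cs.foldl (outcomesStep f K) (l, r) =
      (l.drop (cs.length * K), (sampleOutcomes f K cs l).reverse ++ r) := by
  induction cs generalizing l r with
  | nil => simp [sampleOutcomes]
  | cons c cs ih =>
    rw [List.foldl_cons, outcomesStep, ih, List.drop_drop, sampleOutcomes]
    simp [Nat.add_mul, add_comm]

/-- The truncated Pauli path sum of a noisy circuit. -/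
noncomputable def _root_.QEM.NoisyCircuit.truncatedValue {n : ℕ} {γ : ℝ} (C : NoisyCircuit n γ)
    (O : PauliString n) (R : ℕ) (ρ : Op n) : ℝ :=
  pathSum (Real.exp (-C.rate)) ρ (paths (keepAbove (Real.exp (-C.rate)) R) C.layers O)

section
variable {ask : Data → Data} {n : ℕ} {γ : ℝ} (Cs : List (NoisyCircuit n γ)) (O : PauliString n)
  (R : ℕ) {ρ : Op n}

theorem eval_record (x : ℝ) (l r : List Bool) :
    record.eval ask (.ofList [.node (.num x) (bitListData l), outcomeListData r]) =
      outcomesState (l, decide (0 < x) :: r) := by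
  rw [record, eval_pair, eval_pair, eval_cond_num (x := x) rfl, outcomesState]
  by_cases h : 0 < x <;>
    simp [h, sign, eval, outcomeListData, Data.ofList, Data.fst, Data.snd]

theorem eval_outcomes_args (hask : ∀ P : PauliString n, ask P.data = .num (ρ * P.op).trace.re)
    (l : List Bool) (s : List Bool × List Bool) (C : NoisyCircuit n γ) :
    ([times (plus (call simulate [var 0, var 4, var 6]) (const 1)) (const (1 / 2)),
      comp fst (var 1), var 5].map fun e => e.eval ask
      (.node C.data (.node (outcomesState s) (outcomesEnv Cs l O R)))) =
      [.num ((C.truncatedValue O R ρ + 1) / 2), bitListData s.1,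
        .ofList (List.replicate R .nil)] := by
  have h := eval_simulate ask C O R hask
  rw [← NoisyCircuit.truncatedValue] at h
  have h1 : (call simulate [var 0, var 4, var 6]).eval ask
      (.node C.data (.node (outcomesState s) (outcomesEnv Cs l O R))) =
      .num (C.truncatedValue O R ρ) := by
    rw [eval_call, ← h]
    rfl
  rw [List.map_cons, eval_times (eval_plus h1 (y := 1) (by simp [eval])) (y := 1 / 2)
    (by simp [eval]), ← div_eq_mul_one_div]
  rfl

theorem eval_outcomes_step (hask : ∀ P : PauliString n, ask P.data = .num (ρ * P.op).trace.re)
    (l : List Bool) (s : List Bool × List Bool) (hs : R ≤ s.1.length) (C : NoisyCircuit n γ) :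
    outcomesBody.eval ask (.node C.data (.node (outcomesState s) (outcomesEnv Cs l O R))) =
      outcomesState (outcomesStep (fun C : NoisyCircuit n γ => C.truncatedValue O R ρ) R s C) := by
  rw [outcomesBody, eval_call, List.map_cons, eval_call, eval_outcomes_args Cs O R hask,
    eval_sample ask R _ hs, outcomesStep, ← eval_record (ask := ask)]
  rfl

theorem length_sampleOutcomes {α : Type*} (f : α → ℝ) (K : ℕ) (cs : List α) (l : List Bool) :
    (sampleOutcomes f K cs l).length = cs.length := by
  induction cs generalizing l with
  | nil => rfl
  | cons c cs ih => rw [sampleOutcomes, List.length_cons, List.length_cons, ih]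

/-- At every step, the circuits before the current one have used up `R` bits each, so at least `R`
bits are left for it. -/
theorem eval_outcomes_prefix (hask : ∀ P : PauliString n, ask P.data = .num (ρ * P.op).trace.re)
    {l : List Bool} (hl : Cs.length * R ≤ l.length) (pre : List (NoisyCircuit n γ))
    (C : NoisyCircuit n γ) (post : List (NoisyCircuit n γ)) (h : Cs = pre ++ C :: post) :
    outcomesBody.eval ask (.node C.data (.node (outcomesState (pre.foldl (outcomesStep
      (fun C : NoisyCircuit n γ => C.truncatedValue O R ρ) R) (l, []))) (outcomesEnv Cs l O R))) =
    outcomesState (outcomesStep (fun C : NoisyCircuit n γ => C.truncatedValue O R ρ) R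
      (pre.foldl (outcomesStep
        (fun C : NoisyCircuit n γ => C.truncatedValue O R ρ) R) (l, [])) C) := by
  refine eval_outcomes_step Cs O R hask l _ ?_ C
  rw [foldl_outcomesStep, List.length_drop]
  rw [h, List.length_append, List.length_cons] at hl
  refine Nat.le_sub_of_add_le (le_trans ?_ hl)
  nlinarith [Nat.zero_le (post.length * R)]

theorem eval_comp_snd_outcomes
    (hask : ∀ P : PauliString n, ask P.data = .num (ρ * P.op).trace.re)
    {l : List Bool} (hl : Cs.length * R ≤ l.length) :
    (comp snd outcomes).eval ask (outcomesEnv Cs l O R) = outcomeListData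
      (sampleOutcomes (fun C : NoisyCircuit n γ => C.truncatedValue O R ρ) R Cs l).reverse := by
  have h : outcomes.eval ask (outcomesEnv Cs l O R) = outcomesState (Cs.foldl (outcomesStep
      (fun C : NoisyCircuit n γ => C.truncatedValue O R ρ) R) (l, [])) :=
    eval_fold_eq_of_prefix outcomesState NoisyCircuit.data _ rfl rfl
      (eval_outcomes_prefix Cs O R hask hl)
  rw [eval_comp, h, foldl_outcomesStep, List.append_nil]
  rfl

theorem eval_outcomes (hask : ∀ P : PauliString n, ask P.data = .num (ρ * P.op).trace.re)
    {l : List Bool} (hl : Cs.length * R ≤ l.length) :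
    (call reverse [comp snd outcomes]).eval ask (outcomesEnv Cs l O R) =
      outcomeListData (sampleOutcomes (fun C : NoisyCircuit n γ => C.truncatedValue O R ρ) R Cs l) := by
  rw [eval_call, List.map_singleton, eval_comp_snd_outcomes Cs O R hask hl, outcomeListData,
    eval_reverse, ← List.map_reverse, List.reverse_reverse]
  rfl

end

/-- The costs of simulation and sampling are summed over the circuits. The hypotheses on the oracle
and on the number of bits are needed because the bound follows the states that are actually reached.
-/
theorem cost_outcomes : ∃ K, ∀ (ask : Data → Data) {n : ℕ} {γ : ℝ} (Cs : List (NoisyCircuit n γ))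
    (l : List Bool) (O : PauliString n) (R B T : ℕ) {ρ : Op n},
    (∀ P : PauliString n, ask P.data = .num (ρ * P.op).trace.re) → Cs.length * R ≤ l.length →
    (∀ C ∈ Cs, keepAbove (Real.exp (-C.rate)) R 0 ∧
      (∀ k, keepAbove (Real.exp (-C.rate)) R k → 16 ^ k ≤ B) ∧ C.cost ≤ T) →
    (call reverse [comp snd outcomes]).cost ask (outcomesEnv Cs l O R) ≤
      K * ((Cs.length + 1) * (T * (T * ((B + 1) * (n + 1))) + R + 1)) := by
  obtain ⟨C₁, h₁⟩ := cost_simulate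
  obtain ⟨C₂, h₂⟩ := linearCost_sample
  obtain ⟨C₃, h₃⟩ := linearCost_reverse
  have hf : ∀ e ∈ [var 0, var 4, var 6], e.Flat := by simp
  set S₁ := ([var 0, var 4, var 6].map fun e => e.size + 1).sum + 2 with hS₁
  set S₂ := (comp fst (var 1)).size + (var 5).size + (comp snd (var 1)).size + record.size + 30
    with hS₂
  refine ⟨C₁ + C₂ + C₃ + S₁ + S₂ + (var 0).size + (pair (var 1) nil).size + 60,
    fun ask n γ Cs l O R B T ρ hask hl hC => ?_⟩
  set Z := T * (T * ((B + 1) * (n + 1))) with hZ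
  have hrev : ((var 0).eval ask (.ofList [(comp snd outcomes).eval ask (outcomesEnv Cs l O R)])).toList.length
      = Cs.length := by
    rw [eval_comp_snd_outcomes Cs O R hask hl]
    simp [outcomeListData, Data.ofList, Data.fst, length_sampleOutcomes]
  have h3 := h₃ ask (.ofList [(comp snd outcomes).eval ask (outcomesEnv Cs l O R)])
  rw [hrev] at h3
  have hfold : outcomes.cost ask (outcomesEnv Cs l O R) ≤ (var 0).cost ask (outcomesEnv Cs l O R) +
      (pair (var 1) nil).cost ask (outcomesEnv Cs l O R) + 12 +
      Cs.length * (C₁ * Z + C₂ * (R + 1) + S₁ + S₂ + 18) := by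
    refine cost_fold_le outcomesState NoisyCircuit.data
      (outcomesStep (fun C : NoisyCircuit n γ => C.truncatedValue O R ρ) R) (s₀ := (l, []))
      rfl rfl (eval_outcomes_prefix Cs O R hask hl) ?_
    intro pre C post h
    generalize pre.foldl _ _ = s
    obtain ⟨hC0, hCB, hCT⟩ := hC C (h ▸ by simp)
    have h1 := h₁ ask C O R B hC0 hCB
    have h1' : simulate.cost ask (simulateEnv C O R) ≤ C₁ * Z :=
      h1.trans (Nat.mul_le_mul_left _ (Nat.mul_le_mul hCT (Nat.mul_le_mul_right _ hCT)))
    set d := Data.node C.data (.node (outcomesState s) (outcomesEnv Cs l O R)) with hd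
    have h2 := h₂ ask (.ofList ([times (plus (call simulate [var 0, var 4, var 6]) (const 1))
      (const (1 / 2)), comp fst (var 1), var 5].map fun e => e.eval ask d))
    rw [hd, eval_outcomes_args Cs O R hask] at h2
    rw [show ((var 2).eval ask (.ofList [.num ((C.truncatedValue O R ρ + 1) / 2), bitListData s.1,
        .ofList (List.replicate R .nil)])).toList.length = R by
      simp [Data.ofList, Data.fst, Data.snd]] at h2
    have hsim : (call simulate [var 0, var 4, var 6]).cost ask d ≤ S₁ + C₁ * Z := by
      rw [cost_call_of_flat hf, ← hS₁]
      exact Nat.add_le_add_left h1' _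
    change outcomesBody.cost ask d ≤ _
    rw [outcomesBody, cost_call, flat_record.cost_eq]
    simp only [List.map_cons, List.map_nil, List.sum_cons, List.sum_nil, cost_call sample]
    rw [Flat.cost_eq (p := comp fst (var 1)) (by simp [Flat]),
      Flat.cost_eq (p := comp snd (var 1)) (by simp [Flat]), (flat_var 5).cost_eq]
    have hlist := eval_outcomes_args Cs O R hask l s C
    simp only [List.map_cons, List.map_nil, ← hd] at hlist
    rw [hlist]
    have harith : (times (plus (call simulate [var 0, var 4, var 6]) (const 1))
        (const (1 / 2))).cost ask d = (call simulate [var 0, var 4, var 6]).cost ask d + 8 := by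
      simp only [times, plus, cost]
    rw [harith, hS₂]
    omega
  rw [cost_call, List.map_singleton, List.sum_singleton, List.map_singleton, cost_comp]
  rw [(flat_var 0).cost_eq, Flat.cost_eq (p := pair (var 1) nil) (by simp [Flat])] at hfold
  have hsnd : snd.cost ask (outcomes.eval ask (outcomesEnv Cs l O R)) = 1 := rfl
  rw [hsnd]
  set m := Cs.length
  set V := (m + 1) * (Z + R + 1) with hV
  have hV1 : 1 ≤ V := Nat.mul_pos (Nat.succ_pos _) (Nat.succ_pos _)
  have e1 : m * (C₁ * Z + C₂ * (R + 1) + S₁ + S₂ + 18) ≤ (C₁ + C₂ + S₁ + S₂ + 18) * V := by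
    have : C₁ * Z + C₂ * (R + 1) + S₁ + S₂ + 18 ≤ (C₁ + C₂ + S₁ + S₂ + 18) * (Z + R + 1) := by
      nlinarith [Nat.zero_le (C₁ * (R + 1)), Nat.zero_le (C₂ * Z),
        Nat.zero_le ((S₁ + S₂ + 18) * (Z + R))]
    calc _ ≤ (m + 1) * ((C₁ + C₂ + S₁ + S₂ + 18) * (Z + R + 1)) :=
          Nat.mul_le_mul (Nat.le_succ _) this
      _ = _ := by rw [hV]; ring
  have e2 : C₃ * (m + 1) ≤ C₃ * V :=
    Nat.mul_le_mul_left _ (Nat.le_mul_of_pos_right _ (Nat.succ_pos _))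
  have e3 : (var 0).size + (pair (var 1) nil).size + 30 ≤
      ((var 0).size + (pair (var 1) nil).size + 30) * V := Nat.le_mul_of_pos_right _ hV1
  have e4 : (C₁ + C₂ + S₁ + S₂ + 18) * V + C₃ * V +
      ((var 0).size + (pair (var 1) nil).size + 30) * V ≤
      (C₁ + C₂ + C₃ + S₁ + S₂ + (var 0).size + (pair (var 1) nil).size + 60) * V := by
    rw [← Nat.add_mul, ← Nat.add_mul]
    exact Nat.mul_le_mul_right _ (by omega)
  omega

end FProg

namespace FProg

/-! ### Counting in unary -/

/-- `[l, m]`: a list whose length is the product of the lengths of `l` and `m`. -/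
def unaryMul : FProg := fold (var 0) nil (fold (var 3) (var 1) (pair nil (var 1)))

theorem eval_unaryMul_body (ask : Data → Data) (xs : List Data) (m k : ℕ) (a : Data) :
    (fold (var 3) (var 1) (pair nil (var 1))).eval ask
      (.node a (.node (.ofList (List.replicate k .nil))
        (.ofList [.ofList xs, .ofList (List.replicate m .nil)]))) =
      .ofList (List.replicate (m + k) .nil) := by
  rw [eval_fold_eq (σ := ℕ) (α := Data) (fun k => .ofList (List.replicate k .nil)) (fun a => a)
    (fun s _ => s + 1) (xs := List.replicate m .nil) (s₀ := k)
    (by simp [Data.ofList, Data.fst, Data.snd]) rfl (fun _ _ _ => rfl)]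
  congr 2
  induction m generalizing k with
  | zero => simp
  | succ m ih => rw [List.replicate_succ, List.foldl_cons, ih]; ring

theorem eval_unaryMul_step (ask : Data → Data) (xs : List Data) (m : ℕ) (s : ℕ) (a : Data) :
    (fold (var 3) (var 1) (pair nil (var 1))).eval ask
      (.node a (.node (.ofList (List.replicate s .nil))
        (.ofList [.ofList xs, .ofList (List.replicate m .nil)]))) =
      .ofList (List.replicate ((fun s _ => m + s) s a) .nil) :=
  eval_unaryMul_body ask xs m s a

theorem eval_unaryMul (ask : Data → Data) (xs : List Data) (m : ℕ) :
    unaryMul.eval ask (.ofList [.ofList xs, .ofList (List.replicate m .nil)]) =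
      .ofList (List.replicate (xs.length * m) .nil) := by
  rw [unaryMul, eval_fold_eq (σ := ℕ) (α := Data) (fun k => .ofList (List.replicate k .nil))
    (fun a => a) (fun s _ => m + s) (xs := xs) (s₀ := 0) (by simp [Data.ofList, Data.fst]) rfl
    (fun s a _ => eval_unaryMul_step ask xs m s a)]
  have : ∀ k, xs.foldl (fun s _ => m + s) k = xs.length * m + k := by
    induction xs with
    | nil => simp
    | cons x xs ih => intro k; rw [List.foldl_cons, ih, List.length_cons]; ring
  rw [this, add_zero]

theorem cost_unaryMul : ∃ K, ∀ (ask : Data → Data) (xs : List Data) (m : ℕ),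
    unaryMul.cost ask (.ofList [.ofList xs, .ofList (List.replicate m .nil)]) ≤
      K * ((xs.length + 1) * (m + 1)) := by
  have hb : (pair nil (var 1)).Flat := by simp [Flat]
  set S := (var 3).size + (var 1).size + 12 with hS
  set U := (pair nil (var 1)).size + 18 with hU
  refine ⟨S + U + 40, fun ask xs m => ?_⟩
  refine (cost_fold_le (σ := ℕ) (α := Data) (fun k => .ofList (List.replicate k .nil))
    (fun a => a) (fun s _ => m + s) (xs := xs) (s₀ := 0) (B := S + m * U)
    (by simp [Data.ofList, Data.fst]) rfl
    (fun pre a post _ => eval_unaryMul_step ask xs m _ a) ?_).trans ?_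
  · intro pre a post h
    rw [cost_fold_of_flat hb, (flat_var 3).cost_eq, (flat_var 1).cost_eq,
      show ((var 3).eval ask (.node a (.node (.ofList (List.replicate
        (pre.foldl (fun s _ => m + s) 0) .nil)) (.ofList [.ofList xs, .ofList (List.replicate m .nil)])))) =
        .ofList (List.replicate m .nil) from rfl, Data.toList_ofList, List.length_replicate]
  · change 1 + 1 + 12 + _ ≤ _
    nlinarith [Nat.zero_le (xs.length * m), Nat.zero_le (S * (xs.length * m)), Nat.zero_le (S * m),
      Nat.zero_le (U * xs.length), Nat.zero_le (U * m)]

/-- `[o]`: a list of length `c * (n + 1) ^ d`, where `n` is the length of `o`. -/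
def unary (c : ℕ) : ℕ → FProg
  | 0 => push (List.replicate c nil) nil
  | d + 1 => call unaryMul [pair nil (var 0), unary c d]

/-- Iterations run over lists, so a polynomial number of repetitions requires a list of that length.
Each power multiplies by the length of the input list extended by one entry, hence `n + 1`. -/
theorem eval_unary (ask : Data → Data) (c d : ℕ) (xs : List Data) :
    (unary c d).eval ask (.ofList [.ofList xs]) =
      .ofList (List.replicate (c * (xs.length + 1) ^ d) .nil) := by
  induction d with
  | zero =>
    rw [unary, eval_push _ nil (xs := []) rfl]
    simp [eval]
  | succ d ih =>
    rw [unary, eval_call, List.map_cons, List.map_singleton, ih,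
      show (pair nil (var 0)).eval ask (.ofList [.ofList xs]) = .ofList (.nil :: xs) from rfl,
      eval_unaryMul, List.length_cons]
    ring_nf

theorem cost_unary (c d : ℕ) : ∃ K, ∀ (ask : Data → Data) (xs : List Data),
    (unary c d).cost ask (.ofList [.ofList xs]) ≤ K * (xs.length + 1) ^ d := by
  induction d with
  | zero =>
    refine ⟨(push (List.replicate c nil) nil).size, fun ask xs => ?_⟩
    rw [unary, Flat.cost_eq (Flat.push (by simp +contextual [Flat]) (by simp [Flat]))]
    simp
  | succ d ih =>
    obtain ⟨K₁, h₁⟩ := ih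
    obtain ⟨K₂, h₂⟩ := cost_unaryMul
    refine ⟨K₁ + K₂ * 2 * (c + 1) + 20, fun ask xs => ?_⟩
    have h3 := h₁ ask xs
    have h4 := h₂ ask (.nil :: xs) (c * (xs.length + 1) ^ d)
    rw [unary, cost_call]
    simp only [List.map_cons, List.map_nil, eval_unary, List.sum_cons, List.sum_nil]
    rw [show (pair nil (var 0)).eval ask (.ofList [.ofList xs]) = .ofList (.nil :: xs) from rfl,
      show (pair nil (var 0)).cost ask (.ofList [.ofList xs]) = 3 from rfl]
    rw [List.length_cons] at h4
    have hy : 1 ≤ (xs.length + 1) ^ d := Nat.one_le_pow _ _ (Nat.succ_pos _)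
    rw [pow_succ]
    set y := (xs.length + 1) ^ d
    set x := xs.length
    have h5 : (x + 1 + 1) * (c * y + 1) ≤ (2 * (x + 1)) * ((c + 1) * y) :=
      Nat.mul_le_mul (by omega) (by nlinarith)
    have h6 : K₂ * ((x + 1 + 1) * (c * y + 1)) ≤ K₂ * 2 * (c + 1) * (y * (x + 1)) :=
      (Nat.mul_le_mul_left _ h5).trans_eq (by ring)
    have h7 : y ≤ y * (x + 1) := Nat.le_mul_of_pos_right _ (Nat.succ_pos _)
    have h8 : K₁ * y ≤ K₁ * (y * (x + 1)) := Nat.mul_le_mul_left _ h7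
    rw [Nat.add_mul, Nat.add_mul]
    omega

/-- `[l]`: the length of `l`. -/
def count : FProg := fold (var 0) (const 0) (plus (var 1) (const 1))

theorem eval_count (ask : Data → Data) (xs : List Data) :
    count.eval ask (.ofList [.ofList xs]) = .num (xs.length : ℝ) := by
  rw [count, eval_fold_eq (σ := ℕ) (α := Data) (fun k => .num k)
    (fun a => a) (fun s _ => s + 1) (xs := xs) (s₀ := 0) (by simp [Data.ofList, Data.fst])
    (by simp [eval])]
  · have : ∀ k, xs.foldl (fun s _ => s + 1) k = xs.length + k := by
      induction xs with
      | nil => simp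
      | cons x xs ih => intro k; rw [List.foldl_cons, ih, List.length_cons]; ring
    rw [this, add_zero]
  · intro s a _
    rw [eval_plus (x := s) (y := 1) rfl (by simp [eval])]
    simp

theorem linearCost_count : count.LinearCost 0 := linearCost_fold (by simp [Flat]) (by simp [Flat]) 0

/-- `[u, l]`: remove as many entries from `l` as the square of the length of `u`. -/
def drop : FProg := fold (var 0) (var 1) (fold (var 2) (var 1) (comp snd (var 1)))

theorem eval_drop_step (ask : Data → Data) (R : ℕ) (e : Data) (l : List Data) (a : Data) :
    (fold (var 2) (var 1) (comp snd (var 1))).eval ask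
      (.node a (.node (.ofList l) (.node (.ofList (List.replicate R .nil)) e))) =
      .ofList ((fun l _ => l.drop R) l a) := by
  rw [eval_fold_eq (σ := List Data) (α := Data) Data.ofList (fun a => a)
    (fun s _ => s.drop 1) (xs := List.replicate R .nil) (s₀ := l)
    (by simp [Data.fst, Data.snd]) rfl]
  · congr 1
    induction R generalizing l with
    | zero => simp
    | succ R ih =>
      rw [List.replicate_succ, List.foldl_cons, ih]
      simp only [List.drop_drop, add_comm]
  · intro s b _
    -- The second component of `nil` is `nil`, so dropping from an exhausted list is harmless.
    cases s <;> simp [eval, Data.ofList, Data.fst, Data.snd]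

theorem eval_drop (ask : Data → Data) (R : ℕ) (l : List Data) :
    drop.eval ask (.ofList [.ofList (List.replicate R .nil), .ofList l]) =
      .ofList (l.drop (R * R)) := by
  refine (eval_fold_eq (σ := List Data) (α := Data) Data.ofList (fun a => a)
    (fun s _ => s.drop R) (xs := List.replicate R .nil) (s₀ := l)
    (by simp [Data.ofList, Data.fst]) rfl
    (fun s a _ => eval_drop_step ask R (.ofList [.ofList l]) s a)).trans ?_
  have : ∀ k (l : List Data), (List.replicate k Data.nil).foldl (fun s _ => s.drop R) l =
      l.drop (k * R) := by
    intro k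
    induction k with
    | zero => simp
    | succ k ih =>
      intro l
      rw [List.replicate_succ, List.foldl_cons, ih, List.drop_drop]
      ring_nf
  rw [this]

theorem cost_drop : ∃ K, ∀ (ask : Data → Data) (R : ℕ) (l : List Data),
    drop.cost ask (.ofList [.ofList (List.replicate R .nil), .ofList l]) ≤ K * (R + 1) ^ 2 := by
  have hb : (comp snd (var 1)).Flat := by simp [Flat]
  set S := (var 2).size + (var 1).size + 12 with hS
  set U := (comp snd (var 1)).size + 18 with hU
  refine ⟨S + U + 40, fun ask R l => ?_⟩
  refine (cost_fold_le (σ := List Data) (α := Data) Data.ofList (fun a => a)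
    (fun s _ => s.drop R) (xs := List.replicate R .nil) (s₀ := l) (B := S + R * U)
    (by simp [Data.ofList, Data.fst]) rfl
    (fun pre a post _ => eval_drop_step ask R _ _ a) ?_).trans ?_
  · intro pre a post h
    rw [cost_fold_of_flat hb, (flat_var 2).cost_eq, (flat_var 1).cost_eq]
    simp only [eval_var_succ, eval_var_zero, Data.ofList, Data.fst, Data.snd, Data.toList_ofList,
      List.length_replicate]
    exact le_rfl
  · rw [List.length_replicate]
    change 1 + 3 + 12 + _ ≤ _
    nlinarith [Nat.zero_le (R * R), Nat.zero_le (S * (R * R)), Nat.zero_le (S * R),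
      Nat.zero_le (U * R)]

/-- The restriction of a number to the interval `[-1, 1]`. -/
def clip : FProg :=
  cond (minus id (const 1)) (const 1) (cond (minus (const (-1)) id) (const (-1)) id)

theorem eval_clip (ask : Data → Data) (x : ℝ) :
    clip.eval ask (.num x) = .num (max (-1) (min 1 x)) := by
  rw [clip, eval_cond_num (eval_minus (x := x) (y := 1) rfl (by simp [eval])),
    eval_cond_num (eval_minus (x := -1) (y := x) (by simp [eval]) rfl)]
  simp only [sub_pos]
  split_ifs with h1 h2
  · rw [min_eq_left h1.le, max_eq_right (by norm_num)]; simp [eval]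
  · rw [min_eq_right (not_lt.1 h1), max_eq_left h2.le]; simp [eval]
  · rw [min_eq_right (not_lt.1 h1), max_eq_right (not_lt.1 h2)]; rfl

theorem flat_clip : clip.Flat := by simp [clip, Flat]

end FProg

/-! ### The Pauli coefficients as an oracle -/

theorem Data.ofList_injective : Function.Injective Data.ofList := by
  intro l l' h
  rw [← Data.toList_ofList l, h, Data.toList_ofList]

theorem PauliString.data_injective {n : ℕ} :
    Function.Injective (PauliString.data : PauliString n → Data) := by
  intro P Q h
  have h' := List.ofFn_injective (Data.ofList_injective h)
  funext k
  have hk := Data.num.inj (congrFun h' k)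
  exact Fin.ext (by exact_mod_cast hk)

/-- The oracle chooses some Pauli operator with the given data; injectivity of the encoding makes it
the intended one. -/
theorem coefficients_data {n : ℕ} (ρ : Op n) (P : PauliString n) :
    coefficients ρ P.data = .num (ρ * P.op).trace.re := by
  have h : ∃ Q : PauliString n, Q.data = P.data := ⟨P, rfl⟩
  rw [coefficients, dif_pos h, PauliString.data_injective h.choose_spec]

namespace FProg

/-! ### The inputs of the two programs of a strategy -/

/-- The input of the first program: the classical input and all but `(c * (n + 1) ^ d) ^ 2` of the
random bits. -/
def planInput (c d : ℕ) : FProg :=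
  pair fst (call drop [call (unary c d) [comp (var 2) fst], snd])

/-- From a list of noisy circuits and the input of `planInput`, the input of the second program. -/
def concludeInput (c d : ℕ) : FProg :=
  pair (comp fst snd) (pair
    (call drop [call (unary c d) [comp (var 2) (comp fst snd)], comp snd snd])
    (call (call reverse [comp snd outcomes]) [fst, comp snd snd, comp (var 2) (comp fst snd),
      call (unary c d) [comp (var 2) (comp fst snd)],
      call count [call (unary c d) [comp (var 2) (comp fst snd)]]]))

section
variable (ask : Data → Data) (c d : ℕ) (p : Problem) (γ : ℝ) (l : List Bool)

theorem eval_obs : (var 2).eval ask (p.input γ) = p.obs.data := rfl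

theorem toList_obs : p.obs.data = .ofList (List.ofFn fun k => .num ((p.obs k : ℕ) : ℝ)) := rfl

theorem eval_unary_obs (e : FProg) {x : Data} (he : e.eval ask x = p.input γ) :
    (call (unary c d) [comp (var 2) e]).eval ask x =
      .ofList (List.replicate (c * (p.n + 1) ^ d) .nil) := by
  rw [eval_call, List.map_singleton, eval_comp, he, eval_obs, toList_obs, eval_unary,
    List.length_ofFn]

theorem eval_drop_bitListData (R : ℕ) :
    drop.eval ask (.ofList [.ofList (List.replicate R .nil), bitListData l]) =
      bitListData (l.drop (R * R)) := by
  rw [bitListData, eval_drop, bitListData, List.map_drop]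

/-- The random string starts with R² bits reserved for sampling, where R is `c * (n + 1) ^ d`; the
rest are the coins of the strategy. -/
theorem eval_planInput : (planInput c d).eval ask (.node (p.input γ) (bitListData l)) =
    .node (p.input γ) (bitListData (l.drop (c * (p.n + 1) ^ d * (c * (p.n + 1) ^ d)))) := by
  rw [planInput, eval_pair, eval_call, List.map_cons, List.map_singleton,
    eval_unary_obs ask c d p γ fst rfl, ← eval_drop_bitListData ask]
  rfl

theorem eval_concludeInput_args (Cs : List (NoisyCircuit p.n γ)) :
    ([fst, comp snd snd, comp (var 2) (comp fst snd),
      call (unary c d) [comp (var 2) (comp fst snd)],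
      call count [call (unary c d) [comp (var 2) (comp fst snd)]]].map fun e => e.eval ask
        (.node (.ofList (Cs.map NoisyCircuit.data)) (.node (p.input γ) (bitListData l)))) =
    [.ofList (Cs.map NoisyCircuit.data), bitListData l, p.obs.data,
      .ofList (List.replicate (c * (p.n + 1) ^ d) .nil), .num ((c * (p.n + 1) ^ d : ℕ) : ℝ)] := by
  have h := eval_unary_obs ask c d p γ (comp fst snd)
    (x := .node (.ofList (Cs.map NoisyCircuit.data)) (.node (p.input γ) (bitListData l))) rfl
  simp only [List.map_cons, List.map_nil, h]
  rw [eval_call _ [_], List.map_singleton, h, eval_count, List.length_replicate]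
  rfl

/-- The same `R` is used twice: as a list it sets the number of random bits per outcome, and as a
number it sets the truncation threshold. Sampling reads only an initial part of `l`, so the coins
need not be split off for it. -/
theorem eval_concludeInput {ρ : Op p.n}
    (hask : ∀ P : PauliString p.n, ask P.data = .num (ρ * P.op).trace.re)
    {Cs : List (NoisyCircuit p.n γ)} {R : ℕ} (hR : R = c * (p.n + 1) ^ d)
    (hl : Cs.length * R ≤ l.length) :
    (concludeInput c d).eval ask
      (.node (.ofList (Cs.map NoisyCircuit.data)) (.node (p.input γ) (bitListData l))) =
    .node (p.input γ) (.node (bitListData (l.drop (R * R))) (outcomeListData (sampleOutcomes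
      (fun C : NoisyCircuit p.n γ => C.truncatedValue p.obs R ρ) R Cs l))) := by
  rw [concludeInput, eval_pair, eval_pair, eval_call _ (fst :: _), eval_concludeInput_args, ← hR,
    eval_call drop, List.map_cons, List.map_singleton, eval_unary_obs ask c d p γ _ rfl, ← hR,
    ← eval_drop_bitListData ask, ← eval_outcomes Cs p.obs R hask hl]
  rfl

end

theorem cost_unary_obs (c d : ℕ) (e : FProg) (he : e.Flat) : ∃ K, ∀ (ask : Data → Data)
    (p : Problem) (γ : ℝ) (x : Data), e.eval ask x = p.input γ →
    (call (unary c d) [comp (var 2) e]).cost ask x ≤ K * (p.n + 1) ^ d := by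
  obtain ⟨K, hK⟩ := cost_unary c d
  refine ⟨K + (comp (var 2) e).size + 3, fun ask p γ x hx => ?_⟩
  have h := hK ask (List.ofFn fun k => .num ((p.obs k : ℕ) : ℝ))
  rw [← toList_obs, List.length_ofFn] at h
  have hf : (comp (var 2) e).Flat := by simp [Flat, he]
  rw [cost_call, List.map_singleton, List.map_singleton, List.sum_singleton, hf.cost_eq, eval_comp,
    hx, eval_obs]
  have : 1 ≤ (p.n + 1) ^ d := Nat.one_le_pow _ _ (Nat.succ_pos _)
  nlinarith [Nat.zero_le (comp (var 2) e).size]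

theorem cost_planInput (c d : ℕ) : ∃ K, ∀ (ask : Data → Data) (p : Problem) (γ : ℝ)
    (l : List Bool), (planInput c d).cost ask (.node (p.input γ) (bitListData l)) ≤
      K * ((p.n + 1) ^ d + (c * (p.n + 1) ^ d + 1) ^ 2) := by
  obtain ⟨K₁, h₁⟩ := cost_unary_obs c d fst trivial
  obtain ⟨K₂, h₂⟩ := cost_drop
  refine ⟨K₁ + K₂ + 20, fun ask p γ l => ?_⟩
  have h3 := h₁ ask p γ (.node (p.input γ) (bitListData l)) rfl
  have h4 := h₂ ask (c * (p.n + 1) ^ d) (l.map fun b => .num (if b then 1 else 0))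
  rw [← bitListData] at h4
  rw [planInput, cost_pair, cost_call drop]
  simp only [List.map_cons, List.map_nil, List.sum_cons, List.sum_nil,
    eval_unary_obs ask c d p γ fst (x := .node (p.input γ) (bitListData l)) rfl]
  change 1 + (_ + 1 + (1 + 1 + 0) + 2 + drop.cost ask (.ofList [_, bitListData l])) + 1 ≤ _
  have : 1 ≤ (p.n + 1) ^ d := Nat.one_le_pow _ _ (Nat.succ_pos _)
  nlinarith [Nat.zero_le (K₁ * (c * (p.n + 1) ^ d + 1) ^ 2), Nat.zero_le (K₂ * (p.n + 1) ^ d)]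

theorem cost_concludeInput (c d : ℕ) : ∃ K, ∀ (ask : Data → Data) (p : Problem) (γ : ℝ)
    (l : List Bool) (Cs : List (NoisyCircuit p.n γ)) (R B T : ℕ) {ρ : Op p.n},
    R = c * (p.n + 1) ^ d →
    (∀ P : PauliString p.n, ask P.data = .num (ρ * P.op).trace.re) → Cs.length * R ≤ l.length →
    (∀ C ∈ Cs, keepAbove (Real.exp (-C.rate)) R 0 ∧
      (∀ k, keepAbove (Real.exp (-C.rate)) R k → 16 ^ k ≤ B) ∧ C.cost ≤ T) →
    (concludeInput c d).cost ask
      (.node (.ofList (Cs.map NoisyCircuit.data)) (.node (p.input γ) (bitListData l))) ≤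
      K * ((p.n + 1) ^ d + (R + 1) ^ 2 +
        (Cs.length + 1) * (T * (T * ((B + 1) * (p.n + 1))) + R + 1)) := by
  obtain ⟨K₁, h₁⟩ := cost_unary_obs c d (comp fst snd) (by simp [Flat])
  obtain ⟨K₂, h₂⟩ := cost_drop
  obtain ⟨K₃, h₃⟩ := cost_outcomes
  obtain ⟨K₄, h₄⟩ := linearCost_count
  refine ⟨3 * K₁ + K₂ + K₃ + K₄ + (comp (var 2) (comp fst snd)).size + 50,
    fun ask p γ l Cs R B T ρ hR hask hl hC => ?_⟩
  set x := Data.node (.ofList (Cs.map NoisyCircuit.data)) (.node (p.input γ) (bitListData l)) with hx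
  have h5 := h₁ ask p γ x rfl
  have h6 := h₂ ask R (l.map fun b => .num (if b then 1 else 0))
  rw [← bitListData] at h6
  have h7 := h₃ ask Cs l p.obs R B T hask hl hC
  have h8 := h₄ ask (.ofList [.ofList (List.replicate R .nil)])
  rw [show ((var 0).eval ask (.ofList [.ofList (List.replicate R .nil)])).toList.length = R by
    simp [Data.ofList, Data.fst]] at h8
  have hargs := eval_concludeInput_args ask c d p γ l Cs
  rw [← hR, ← hx] at hargs
  have hu := eval_unary_obs ask c d p γ (comp fst snd) (x := x) rfl
  rw [← hR] at hu
  have hflat : (comp (var 2) (comp fst snd)).Flat := by simp [Flat]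
  rw [concludeInput, cost_pair, cost_pair, cost_call drop, cost_call _ (fst :: _), hargs]
  simp only [List.map_cons, List.map_nil, List.sum_cons, List.sum_nil, hu, hflat.cost_eq]
  rw [cost_call count]
  simp only [List.map_cons, List.map_nil, List.sum_cons, List.sum_nil, hu]
  rw [show (comp snd snd).eval ask x = bitListData l from rfl,
    show (comp fst snd).cost ask x = 3 from rfl, show (comp snd snd).cost ask x = 3 from rfl,
    show fst.cost ask x = 1 from rfl]
  rw [outcomesEnv] at h7
  have hN : 1 ≤ (p.n + 1) ^ d := Nat.one_le_pow _ _ (Nat.succ_pos _)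
  have hR1 : R + 1 ≤ (R + 1) ^ 2 := Nat.le_self_pow (by norm_num) _
  set N := (p.n + 1) ^ d
  set W := (Cs.length + 1) * (T * (T * ((B + 1) * (p.n + 1))) + R + 1)
  set V := (R + 1) ^ 2
  set Y := N + V + W with hY
  have e1 : K₁ * N ≤ K₁ * Y := Nat.mul_le_mul_left _ (by omega)
  have e2 : K₂ * V ≤ K₂ * Y := Nat.mul_le_mul_left _ (by omega)
  have e3 : K₃ * W ≤ K₃ * Y := Nat.mul_le_mul_left _ (by omega)
  have e4 : K₄ * (R + 1) ≤ K₄ * Y := Nat.mul_le_mul_left _ (by omega)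
  have e5 : (comp (var 2) (comp fst snd)).size + 50 ≤
      ((comp (var 2) (comp fst snd)).size + 50) * Y := Nat.le_mul_of_pos_right _ (by omega)
  calc _ ≤ 3 * (K₁ * Y) + K₂ * Y + K₃ * Y + K₄ * Y +
        ((comp (var 2) (comp fst snd)).size + 50) * Y := by omega
    _ = _ := by ring

end FProg

/-! ### Averages over lists of random bits -/

/-- The average over the lists of `k` bits. -/
noncomputable def listMean : ℕ → (List Bool → ℝ) → ℝ
  | 0, f => f []
  | k + 1, f => (listMean k (fun l => f (true :: l)) + listMean k (fun l => f (false :: l))) / 2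

theorem ofFn_consEquiv {k : ℕ} (b : Bool) (x : Fin k → Bool) :
    List.ofFn (Fin.consEquiv (fun _ : Fin (k + 1) => Bool) (b, x)) = b :: List.ofFn x :=
  List.ofFn_cons b x

/-- Averages over lists obey a recursion on the first bit, which suits programs that consume their
bits one after the other. -/
theorem coinMean_ofFn {k : ℕ} (f : List Bool → ℝ) :
    coinMean (fun s : Fin k → Bool => f (List.ofFn s)) = listMean k f := by
  induction k generalizing f with
  | zero => simp [coinMean, listMean]
  | succ k ih =>
    rw [listMean, ← ih, ← ih]
    simp only [coinMean]
    rw [← Equiv.sum_comp (Fin.consEquiv fun _ : Fin (k + 1) => Bool), Fintype.sum_prod_type,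
      Fintype.sum_bool]
    simp only [ofFn_consEquiv]
    field_simp
    ring

theorem listMean_congr {k : ℕ} {f g : List Bool → ℝ} (h : ∀ l, l.length = k → f l = g l) :
    listMean k f = listMean k g := by
  induction k generalizing f g with
  | zero => exact h [] rfl
  | succ k ih =>
    rw [listMean, listMean, ih fun l hl => h (true :: l) (by simp [hl]),
      ih fun l hl => h (false :: l) (by simp [hl])]

theorem listMean_mono {k : ℕ} {f g : List Bool → ℝ} (h : ∀ l, l.length = k → f l ≤ g l) :
    listMean k f ≤ listMean k g := by
  induction k generalizing f g with
  | zero => exact h [] rfl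
  | succ k ih =>
    rw [listMean, listMean]
    have h1 := ih fun l hl => h (true :: l) (by simp [hl])
    have h2 := ih fun l hl => h (false :: l) (by simp [hl])
    linarith

theorem listMean_add (k : ℕ) (f g : List Bool → ℝ) :
    listMean k (fun l => f l + g l) = listMean k f + listMean k g := by
  induction k generalizing f g with
  | zero => rfl
  | succ k ih => simp only [listMean, ih]; ring

theorem listMean_mul (k : ℕ) (a : ℝ) (f : List Bool → ℝ) :
    listMean k (fun l => a * f l) = a * listMean k f := by
  induction k generalizing f with
  | zero => rfl
  | succ k ih => simp only [listMean, ih]; ring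

theorem listMean_const (k : ℕ) (a : ℝ) : listMean k (fun _ => a) = a := by
  induction k with
  | zero => rfl
  | succ k ih => simp only [listMean, ih]; ring

theorem listMean_sum {α : Type*} (s : Finset α) (k : ℕ) (f : α → List Bool → ℝ) :
    listMean k (fun l => ∑ a ∈ s, f a l) = ∑ a ∈ s, listMean k (f a) := by
  induction k generalizing f with
  | zero => rfl
  | succ k ih => simp only [listMean, ih, ← Finset.sum_add_distrib, Finset.sum_div]

theorem listMean_append (j k : ℕ) (f : List Bool → ℝ) :
    listMean (j + k) f = listMean j fun l => listMean k fun l' => f (l ++ l') := by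
  induction j generalizing f with
  | zero => simp [listMean]
  | succ j ih => rw [Nat.succ_add, listMean, listMean, ih, ih]; rfl

theorem listMean_comm (j k : ℕ) (f : List Bool → List Bool → ℝ) :
    (listMean j fun l => listMean k fun l' => f l l') =
      listMean k fun l' => listMean j fun l => f l l' := by
  induction j generalizing f with
  | zero => rfl
  | succ j ih =>
    simp only [listMean, div_eq_inv_mul]
    rw [listMean_mul, listMean_add, ih, ih]

/-- Only the probability of the derived bit matters, since any function of one bit is affine in its
indicator. -/
theorem listMean_bool (k : ℕ) (b : List Bool → Bool) (g : Bool → ℝ) :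
    listMean k (fun l => g (b l)) = listMean k (fun l => if b l then 1 else 0) * g true +
      (1 - listMean k (fun l => if b l then 1 else 0)) * g false := by
  have h : ∀ l, g (b l) = (g true - g false) * (if b l then 1 else 0) + g false := by
    intro l; cases b l <;> simp
  simp only [h]
  rw [listMean_add, listMean_mul, listMean_const]
  ring

/-! ### Sampling -/

theorem draw_append {K : ℕ} (x : ℝ) {l : List Bool} (hl : K ≤ l.length) (l' : List Bool) :
    draw K x (l ++ l') = draw K x l := by
  induction K generalizing x l with
  | zero => rfl
  | succ K ih =>
    match l with
    | [] => simp at hl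
    | b :: l => rw [List.cons_append, draw, draw, ih _ (by simpa using hl)]

theorem sampleOutcomes_append {α : Type*} (f : α → ℝ) (K : ℕ) (cs : List α) {l : List Bool}
    (hl : cs.length * K ≤ l.length) (l' : List Bool) :
    sampleOutcomes f K cs (l ++ l') = sampleOutcomes f K cs l := by
  induction cs generalizing l with
  | nil => rfl
  | cons c cs ih =>
    rw [List.length_cons, Nat.add_mul, Nat.one_mul] at hl
    have hK : K ≤ l.length := by omega
    rw [sampleOutcomes, sampleOutcomes, draw_append _ hK, List.drop_append_of_le_length hK,
      ih (by rw [List.length_drop]; omega)]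

/-- The probability that `draw` returns a positive number. -/
noncomputable def drawProb (K : ℕ) (x : ℝ) : ℝ :=
  listMean K fun l => if 0 < draw K x l then 1 else 0

theorem drawProb_nonneg (K : ℕ) (x : ℝ) : 0 ≤ drawProb K x := by
  refine (listMean_const K 0).symm.trans_le (listMean_mono fun l _ => ?_)
  split_ifs <;> norm_num

theorem drawProb_le_one (K : ℕ) (x : ℝ) : drawProb K x ≤ 1 := by
  refine (listMean_mono fun l _ => ?_).trans_eq (listMean_const K 1)
  split_ifs <;> norm_num

theorem drawProb_succ (K : ℕ) (x : ℝ) :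
    drawProb (K + 1) x = (drawProb K (2 * x - 1) + drawProb K (2 * x)) / 2 := by
  simp only [drawProb, listMean, draw, if_true, Bool.false_eq_true, if_false, sub_zero]

theorem drawProb_of_nonpos (K : ℕ) {x : ℝ} (hx : x ≤ 0) : drawProb K x = 0 := by
  induction K generalizing x with
  | zero => simp [drawProb, listMean, draw, hx.not_gt]
  | succ K ih => rw [drawProb_succ, ih (by linarith), ih (by linarith)]; norm_num

theorem drawProb_of_one_le (K : ℕ) {x : ℝ} (hx : 1 ≤ x) : drawProb K x = 1 := by
  induction K generalizing x with
  | zero => simp [drawProb, listMean, draw, zero_lt_one.trans_le hx]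
  | succ K ih => rw [drawProb_succ, ih (by linarith), ih (by linarith)]; norm_num

/-- Clamping to the unit interval satisfies the recursion of `drawProb_succ`, so the two can be
compared bit by bit. -/
theorem max_min_eq_half_add (x : ℝ) :
    max 0 (min 1 x) = (max 0 (min 1 (2 * x - 1)) + max 0 (min 1 (2 * x))) / 2 := by
  rcases le_total x 0 with h | h
  · rw [min_eq_right (by linarith), min_eq_right (by linarith), min_eq_right (by linarith),
      max_eq_left h, max_eq_left (by linarith), max_eq_left (by linarith)]
    norm_num
  rcases le_total x (1 / 2) with h2 | h2
  · rw [min_eq_right (by linarith), min_eq_right (by linarith), min_eq_right (by linarith),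
      max_eq_right h, max_eq_left (by linarith), max_eq_right (by linarith)]
    ring
  rcases le_total x 1 with h3 | h3
  · rw [min_eq_right h3, min_eq_right (by linarith), min_eq_left (by linarith),
      max_eq_right h, max_eq_right (by linarith), max_eq_right (by norm_num)]
    ring
  · rw [min_eq_left h3, min_eq_left (by linarith), min_eq_left (by linarith),
      max_eq_right (by norm_num)]
    norm_num

/-- Of the two continuations after the first bit, one is already decided without error, so the error
halves with every bit. Arbitrary `x` must be allowed: a truncated expectation value may leave [-1,
1], and sampling then clamps the probability. -/
theorem abs_drawProb_sub_le (K : ℕ) (x : ℝ) :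
    |drawProb K x - max 0 (min 1 x)| ≤ (1 / 2) ^ K := by
  induction K generalizing x with
  | zero =>
    rw [drawProb, listMean, draw, pow_zero, abs_le]
    have h0 : 0 ≤ max 0 (min 1 x) := le_max_left _ _
    have h1 : max 0 (min 1 x) ≤ 1 := max_le zero_le_one (min_le_left _ _)
    split_ifs <;> constructor <;> linarith
  | succ K ih =>
    rw [drawProb_succ, max_min_eq_half_add, pow_succ, add_div, add_div, add_sub_add_comm,
      ← sub_div, ← sub_div]
    rcases le_total x (1 / 2) with h | h
    · rw [drawProb_of_nonpos K (by linarith : 2 * x - 1 ≤ 0),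
        max_eq_left ((min_le_right _ _).trans (by linarith : 2 * x - 1 ≤ 0)), sub_zero, zero_div,
        zero_add, abs_div, abs_two]
      linarith [ih (2 * x)]
    · rw [drawProb_of_one_le K (by linarith : 1 ≤ 2 * x), min_eq_left (by linarith : 1 ≤ 2 * x),
        max_eq_right zero_le_one, sub_self, zero_div, add_zero, abs_div, abs_two]
      linarith [ih (2 * x - 1)]

/-- The average over a list of independent outcomes with the given probabilities of `true`. -/
noncomputable def outcomeMean : List ℝ → (List Bool → ℝ) → ℝ
  | [], h => h []
  | q :: qs, h =>
    q * outcomeMean qs (fun r => h (true :: r)) + (1 - q) * outcomeMean qs (fun r => h (false :: r))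

/-- Different circuits read disjoint blocks of bits, so the sampled outcomes are independent;
surplus bits average out. -/
theorem listMean_sampleOutcomes {α : Type*} (f : α → ℝ) (K : ℕ) (cs : List α) {N : ℕ}
    (hN : cs.length * K ≤ N) (h : List Bool → ℝ) :
    listMean N (fun l => h (sampleOutcomes f K cs l)) =
      outcomeMean (cs.map fun c => drawProb K ((f c + 1) / 2)) h := by
  induction cs generalizing N h with
  | nil => simp only [sampleOutcomes, listMean_const]; rfl
  | cons c cs ih =>
    rw [List.length_cons, Nat.add_mul, Nat.one_mul] at hN
    obtain ⟨N, rfl⟩ := Nat.exists_eq_add_of_le (show K ≤ N by omega)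
    rw [listMean_append, listMean_congr (g := fun l => (fun b => outcomeMean
      (cs.map fun c => drawProb K ((f c + 1) / 2)) fun r => h (b :: r))
      (decide (0 < draw K ((f c + 1) / 2) l)))]
    · refine (listMean_bool K (fun l => decide (0 < draw K ((f c + 1) / 2) l)) (fun b => outcomeMean
        (cs.map fun c => drawProb K ((f c + 1) / 2)) fun r => h (b :: r))).trans ?_
      simp only [decide_eq_true_eq]
      rfl
    · intro l hl
      refine Eq.trans ?_ (ih (N := N) (by omega) _)
      refine listMean_congr fun l' _ => ?_
      rw [sampleOutcomes, draw_append _ hl.ge, ← hl, List.drop_left]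

theorem outcomeMean_mono {qs : List ℝ} (hq : ∀ q ∈ qs, 0 ≤ q ∧ q ≤ 1) {h h' : List Bool → ℝ}
    (hh : ∀ r, r.length = qs.length → h r ≤ h' r) : outcomeMean qs h ≤ outcomeMean qs h' := by
  induction qs generalizing h h' with
  | nil => exact hh [] rfl
  | cons q qs ih =>
    have h1 := ih (fun q hq' => hq q (by simp [hq'])) (fun r hr => hh (true :: r) (by simp [hr]))
    have h2 := ih (fun q hq' => hq q (by simp [hq'])) (fun r hr => hh (false :: r) (by simp [hr]))
    obtain ⟨h3, h4⟩ := hq q (by simp)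
    exact add_le_add (mul_le_mul_of_nonneg_left h1 h3)
      (mul_le_mul_of_nonneg_left h2 (sub_nonneg.2 h4))

theorem outcomeMean_const (qs : List ℝ) (a : ℝ) : outcomeMean qs (fun _ => a) = a := by
  induction qs with
  | nil => rfl
  | cons q qs ih => rw [outcomeMean, ih]; ring

/-- The probabilities are exchanged one at a time. Each exchange changes the mean by the difference
of the two probabilities times a difference of two conditional means, both of which lie between 0
and `B`. -/
theorem outcomeMean_le_add {α : Type*} (cs : List α) {p q : α → ℝ}
    (hp : ∀ c ∈ cs, 0 ≤ p c ∧ p c ≤ 1) (hq : ∀ c ∈ cs, 0 ≤ q c ∧ q c ≤ 1) {B : ℝ}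
    {h : List Bool → ℝ} (h0 : ∀ r, 0 ≤ h r) (hB : ∀ r, h r ≤ B) :
    outcomeMean (cs.map q) h ≤ outcomeMean (cs.map p) h + B * (cs.map fun c => |q c - p c|).sum := by
  induction cs generalizing h with
  | nil => simp [outcomeMean]
  | cons c cs ih =>
    have hp' : ∀ c ∈ cs, 0 ≤ p c ∧ p c ≤ 1 := fun c hc => hp c (by simp [hc])
    have hq' : ∀ c ∈ cs, 0 ≤ q c ∧ q c ≤ 1 := fun c hc => hq c (by simp [hc])
    have hbd : ∀ b, 0 ≤ outcomeMean (cs.map p) (fun r => h (b :: r)) ∧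
        outcomeMean (cs.map p) (fun r => h (b :: r)) ≤ B := by
      intro b
      have hm : ∀ x ∈ cs.map p, 0 ≤ x ∧ x ≤ 1 := by
        intro x hx
        obtain ⟨c, hc, rfl⟩ := List.mem_map.1 hx
        exact hp' c hc
      constructor
      · rw [← outcomeMean_const (cs.map p) 0]
        exact outcomeMean_mono hm fun r _ => h0 _
      · rw [← outcomeMean_const (cs.map p) B]
        exact outcomeMean_mono hm fun r _ => hB _
    have h1 := ih hp' hq' (h := fun r => h (true :: r)) (fun r => h0 _) (fun r => hB _)
    have h2 := ih hp' hq' (h := fun r => h (false :: r)) (fun r => h0 _) (fun r => hB _)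
    obtain ⟨h3, h4⟩ := hq c (by simp)
    obtain ⟨h5, h6⟩ := hbd true
    obtain ⟨h7, h8⟩ := hbd false
    simp only [List.map_cons, outcomeMean, List.sum_cons]
    set a := outcomeMean (cs.map p) (fun r => h (true :: r))
    set b := outcomeMean (cs.map p) (fun r => h (false :: r))
    set W := (cs.map fun c => |q c - p c|).sum
    have h9 := mul_le_mul_of_nonneg_left h1 h3
    have h10 := mul_le_mul_of_nonneg_left h2 (sub_nonneg.2 h4)
    have h11 : (q c - p c) * (a - b) ≤ |q c - p c| * B := by
      refine (le_abs_self _).trans ?_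
      rw [abs_mul]
      exact mul_le_mul_of_nonneg_left (abs_le.2 ⟨by linarith, by linarith⟩) (abs_nonneg _)
    nlinarith

theorem sum_prod_eq_outcomeMean {α : Type*} (cs : List α) (f : α → Bool → ℝ)
    (hf : ∀ c ∈ cs, f c true + f c false = 1) (h : List Bool → ℝ) :
    ∑ r : Fin cs.length → Bool, (∏ m, f (cs.get m) (r m)) * h (List.ofFn r) =
      outcomeMean (cs.map fun c => f c true) h := by
  induction cs generalizing h with
  | nil => simp [outcomeMean]
  | cons c cs ih =>
    have ih' := fun h => ih (fun c hc => hf c (by simp [hc])) h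
    have hc : 1 - f c true = f c false := by linarith [hf c (by simp)]
    rw [List.map_cons, outcomeMean, ← ih', ← ih', hc]
    change ∑ r : Fin (cs.length + 1) → Bool, (∏ m : Fin (cs.length + 1), f ((c :: cs).get m) (r m)) *
      h (List.ofFn r) = _
    rw [← Equiv.sum_comp (Fin.consEquiv fun _ : Fin (cs.length + 1) => Bool), Fintype.sum_prod_type,
      Fintype.sum_bool]
    simp only [ofFn_consEquiv, Fin.prod_univ_succ, Finset.mul_sum]
    simp only [Fin.consEquiv_apply, Fin.cons_zero, Fin.cons_succ]
    simp only [mul_assoc]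
    rfl

/-! ### Restriction to an interval -/

/-- Projection onto an interval that contains `v` does not increase the distance to `v`. Clipping is
indispensable: estimates of the strategy may be huge on unlikely outcomes, and a slightly wrong
outcome distribution could then spoil the mean square error. -/
theorem sq_clip_sub_le {x v : ℝ} (hv : |v| ≤ 1) :
    (max (-1) (min 1 x) - v) ^ 2 ≤ (x - v) ^ 2 := by
  obtain ⟨h1, h2⟩ := abs_le.1 hv
  rcases le_total x 1 with h | h
  · rw [min_eq_right h]
    rcases le_total x (-1) with h' | h'
    · rw [max_eq_left h']; nlinarith
    · rw [max_eq_right h']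
  · rw [min_eq_left h, max_eq_right (by norm_num)]; nlinarith

theorem sq_clip_sub_le_four {x v : ℝ} (hv : |v| ≤ 1) : (max (-1) (min 1 x) - v) ^ 2 ≤ 4 := by
  obtain ⟨h1, h2⟩ := abs_le.1 hv
  have h3 : -1 ≤ max (-1) (min 1 x) := le_max_left _ _
  have h4 : max (-1) (min 1 x) ≤ 1 := max_le (by norm_num) (min_le_left _ _)
  nlinarith

theorem abs_clamp_sub_le {x y : ℝ} (h0 : 0 ≤ y) (h1 : y ≤ 1) :
    |max 0 (min 1 x) - y| ≤ |x - y| := by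
  rcases le_total x 1 with h | h
  · rw [min_eq_right h]
    rcases le_total x 0 with h' | h'
    · rw [max_eq_left h', abs_le]
      constructor <;> linarith [neg_abs_le (x - y), abs_nonneg (x - y)]
    · rw [max_eq_right h']
  · rw [min_eq_left h, max_eq_right (by norm_num), abs_of_nonneg (by linarith),
      abs_of_nonneg (by linarith)]
    linarith

/-- The probability of a sampled outcome is close to the one of an actual outcome. -/
theorem abs_drawProb_sub_bornProb_le {n : ℕ} (O : PauliString n) {σ : Op n} (hσ : IsState σ)
    (K : ℕ) (f : ℝ) : |drawProb K ((f + 1) / 2) - bornProb O σ true| ≤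
      |f - (σ * O.op).trace.re| / 2 + (1 / 2) ^ K := by
  have h1 := bornProb_nonneg O hσ true
  have h2 := bornProb_nonneg O hσ false
  have h3 := bornProb_add O hσ.2
  have h4 : bornProb O σ true = (1 + (σ * O.op).trace.re) / 2 := by
    rw [bornProb_eq O hσ.2]; simp [sign]
  have h5 := abs_drawProb_sub_le K ((f + 1) / 2)
  have h6 := abs_clamp_sub_le (x := (f + 1) / 2) h1 (by linarith)
  have h7 : (f + 1) / 2 - bornProb O σ true = (f - (σ * O.op).trace.re) / 2 := by
    rw [h4]; ring
  rw [h7, abs_div, abs_two] at h6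
  have := abs_sub_le (drawProb K ((f + 1) / 2)) (max 0 (min 1 ((f + 1) / 2))) (bornProb O σ true)
  linarith

/-! ### Averages over an ensemble -/

namespace Ensemble

variable {n : ℕ} (E : Ensemble n)

theorem mean_mono {f g : Fin E.size → ℝ} (h : ∀ ω, f ω ≤ g ω) : E.mean f ≤ E.mean g :=
  mul_le_mul_of_nonneg_left (Finset.sum_le_sum fun ω _ => h ω) (inv_nonneg.2 (Nat.cast_nonneg _))

theorem mean_add (f g : Fin E.size → ℝ) : E.mean (fun ω => f ω + g ω) = E.mean f + E.mean g := by
  rw [mean, Finset.sum_add_distrib, mul_add]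
  rfl

theorem mean_mul (a : ℝ) (f : Fin E.size → ℝ) : E.mean (fun ω => a * f ω) = a * E.mean f := by
  rw [mean, ← Finset.mul_sum, mean]
  ring

theorem mean_const (a : ℝ) : E.mean (fun _ => a) = a := by
  have : (E.size : ℝ) ≠ 0 := Nat.cast_ne_zero.2 E.size_pos.ne'
  rw [mean, Finset.sum_const, Finset.card_univ, Fintype.card_fin, nsmul_eq_mul,
    inv_mul_cancel_left₀ this]

theorem mean_list_sum {α : Type*} (l : List α) (f : α → Fin E.size → ℝ) :
    E.mean (fun ω => (l.map fun a => f a ω).sum) = (l.map fun a => E.mean (f a)).sum := by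
  induction l with
  | nil => simp [mean_const]
  | cons a l ih => simp only [List.map_cons, List.sum_cons, mean_add, ih]

theorem mean_listMean (k : ℕ) (f : Fin E.size → List Bool → ℝ) :
    E.mean (fun ω => listMean k (f ω)) = listMean k fun l => E.mean fun ω => f ω l := by
  simp only [mean]
  rw [listMean_mul, listMean_sum]

end Ensemble

/-! ### The truncation -/

theorem keepAbove_of_le {a : ℝ} (h0 : 0 ≤ a) (h1 : a ≤ 1) {R j k : ℕ} (hjk : j ≤ k)
    (hk : keepAbove a R k) : keepAbove a R j := by
  rw [keepAbove, decide_eq_true_eq] at *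
  refine hk.trans_le ?_
  exact mul_le_mul_of_nonneg_right (mul_le_mul_of_nonneg_right (pow_le_pow_of_le_one h0 h1 hjk)
    (Nat.cast_nonneg _)) (Nat.cast_nonneg _)

theorem keepAbove_zero (a : ℝ) {R : ℕ} (hR : 2 ≤ R) : keepAbove a R 0 := by
  rw [keepAbove, decide_eq_true_eq]
  have : (2 : ℝ) ≤ R := by exact_mod_cast hR
  nlinarith

/-- Choose `D`, depending on `γ` alone, such that the `D`-th power of the damping factor is at most
1/16. A kept path has damping factor above 1/R², and raising this to the power `D` bounds 16^k. This
is where a constant noise rate yields polynomial time. -/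
theorem exists_pow_le_of_keepAbove {γ : ℝ} (hγ : 0 < γ) : ∃ D : ℕ, ∀ {n : ℕ} (C : NoisyCircuit n γ)
    (R k : ℕ), keepAbove (Real.exp (-C.rate)) R k → 16 ^ k ≤ (R * R) ^ D := by
  obtain ⟨D, hD⟩ := exists_pow_lt_of_lt_one (show (0 : ℝ) < 1 / 16 by norm_num)
    (show Real.exp (-γ) < 1 by simpa using hγ)
  refine ⟨D, fun C R k hk => ?_⟩
  rw [keepAbove, decide_eq_true_eq, mul_assoc] at hk
  set a := Real.exp (-C.rate) with ha
  have ha0 : 0 < a := Real.exp_pos _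
  have haD : a ^ D ≤ 1 / 16 := (pow_le_pow_left₀ ha0.le
    (Real.exp_le_exp.2 (by linarith [C.le_rate])) D).trans hD.le
  have h1 : (a ^ k) ^ D ≤ (1 / 16) ^ k := by
    rw [← pow_mul, mul_comm, pow_mul]
    exact pow_le_pow_left₀ (pow_nonneg ha0.le _) haD k
  have h2 : 1 ≤ (a ^ k) ^ D * ((R * R : ℕ) : ℝ) ^ D := by
    rw [← mul_pow]
    exact one_le_pow₀ (by push_cast; exact hk.le)
  have h3 : (1 : ℝ) ≤ (1 / 16) ^ k * ((R * R : ℕ) : ℝ) ^ D :=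
    h2.trans (mul_le_mul_of_nonneg_right h1 (by positivity))
  rw [div_pow, one_pow, div_mul_eq_mul_div, one_mul, le_div_iff₀ (by positivity), one_mul] at h3
  exact_mod_cast h3

/-- The mean square bound is applied with `θ = 1 / R²`, the threshold of `keepAbove`. Outcome
probabilities need a bound on the mean absolute error instead. -/
theorem mean_abs_truncation_le {n : ℕ} {γ : ℝ} (C : NoisyCircuit n γ) (hγ : 0 < γ)
    (O : PauliString n) {E : Ensemble n} {c : ℝ} (hE : E.IsLowAverage c) {R : ℕ} (hR : 2 ≤ R) :
    E.mean (fun ω => |C.truncatedValue O R (E.state ω) - (C.run (E.state ω) * O.op).trace.re|) ≤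
      (1 + c / (1 - Real.exp (-γ))) / (2 * R) := by
  have hR0 : (0 : ℝ) < R := by exact_mod_cast (show 0 < R by omega)
  have ha0 := (Real.exp_pos (-C.rate)).le
  have ha1 : Real.exp (-C.rate) ≤ 1 := Real.exp_le_one_iff.2 (by linarith [C.le_rate])
  have h := mean_sq_truncation_le C hγ O hE (keep := keepAbove (Real.exp (-C.rate)) R)
    (fun j k hjk => keepAbove_of_le ha0 ha1 hjk) (keepAbove_zero _ hR)
    (θ := 1 / (R * R)) (by positivity) (fun k hk => by
      rw [keepAbove, decide_eq_true_eq, not_lt, mul_assoc] at hk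
      rwa [le_div_iff₀ (by positivity)])
  -- The inequality x ≤ (R x² + 1/R) / 2 balances the two terms at order 1/R and avoids square
  -- roots.
  have hpt : ∀ ω, |C.truncatedValue O R (E.state ω) - (C.run (E.state ω) * O.op).trace.re| ≤
      R / 2 * ((C.run (E.state ω) * O.op).trace.re - pathSum (Real.exp (-C.rate)) (E.state ω)
        (paths (keepAbove (Real.exp (-C.rate)) R) C.layers O)) ^ 2 + 1 / (2 * R) := by
    intro ω
    rw [← NoisyCircuit.truncatedValue, abs_sub_comm, ← sq_abs]
    set x := |(C.run (E.state ω) * O.op).trace.re - C.truncatedValue O R (E.state ω)|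
    have h1 : R / 2 * x ^ 2 + 1 / (2 * R) - x = (R * x - 1) ^ 2 / (2 * R) := by field_simp; ring
    have h2 : 0 ≤ (R * x - 1) ^ 2 / (2 * R) := by positivity
    linarith
  refine (E.mean_mono hpt).trans ?_
  rw [E.mean_add, E.mean_mul, E.mean_const]
  refine (add_le_add_left (mul_le_mul_of_nonneg_left h (by positivity)) _).trans_eq ?_
  have : 1 - Real.exp (-γ) ≠ 0 := by
    have : Real.exp (-γ) < 1 := by simpa using hγ
    linarith
  field_simp
  ring

/-! ### The classical algorithm -/

theorem ofFn_getD {α : Type*} {m : ℕ} {l : List α} (hl : l.length = m) (a : α) :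
    List.ofFn (fun k : Fin m => l.getD k a) = l := by
  subst hl
  refine List.ext_getElem (by simp) fun k h1 h2 => ?_
  simp [List.getD]

/-- The strings of bits given by lists. -/
def toBits (m : ℕ) (l : List Bool) : Fin m → Bool := fun k => l.getD k false

theorem toBits_ofFn {m : ℕ} (s : Fin m → Bool) : toBits m (List.ofFn s) = s := by
  funext k
  simp [toBits, List.getD]

theorem bitsData_toBits {m : ℕ} {l : List Bool} (hl : l.length = m) :
    bitsData (toBits m l) = bitListData l := by
  rw [bitsData_eq]
  exact congrArg _ (ofFn_getD hl false)

theorem outcomesData_toBits {m : ℕ} {l : List Bool} (hl : l.length = m) :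
    outcomesData (toBits m l) = outcomeListData l := by
  rw [outcomesData_eq]
  exact congrArg _ (ofFn_getD hl false)

namespace MitigationStrategy

variable {ι : Type*} {p : ι → Problem} {γ : ℝ} (S : MitigationStrategy p γ)

/-- The number of random bits that the strategy uses. -/
abbrev bits (i : ι) : ℕ := S.coins.eval (p i).n

/-- The estimate of the strategy, restricted to `[-1, 1]`, for the outcomes sampled with `K` random
bits each. -/
noncomputable def sampledEstimate (K : ℕ) (i : ι) (ω : Fin (p i).ensemble.size)
    (s : Fin (S.bits i) → Bool) (l : List Bool) : ℝ :=
  max (-1) (min 1 (S.estimate i ω s (toBits _ (sampleOutcomes (fun C : NoisyCircuit (p i).n γ =>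
    C.truncatedValue (p i).obs K ((p i).ensemble.state ω)) K (S.circuits i s) l))))

/-- The estimate of the classical algorithm: the first `K * K` random bits are used to sample the
measurement outcomes, with `K` random bits each. -/
noncomputable def classicalEstimate (K : ℕ) (i : ι) (ω : Fin (p i).ensemble.size)
    (l : List Bool) : ℝ :=
  S.sampledEstimate K i ω (toBits _ (l.drop (K * K))) l

theorem length_circuits_le (i : ι) (s : Fin (S.bits i) → Bool) :
    (S.circuits i s).length ≤ S.time.eval (p i).n := by
  -- The cost of the circuits does not involve the state or the outcomes, so any choice of these
  -- gives the bound.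
  obtain ⟨t₁, t₂, -, -, h⟩ := S.spec i ⟨0, (p i).ensemble.size_pos⟩ s fun _ => false
  have : ∀ l : List (NoisyCircuit (p i).n γ), l.length ≤ (l.map NoisyCircuit.cost).sum := by
    intro l
    induction l with
    | nil => simp
    | cons C l ih =>
      rw [List.length_cons, List.map_cons, List.sum_cons, NoisyCircuit.cost]
      omega
  have := this (S.circuits i s)
  omega

theorem cost_circuit_le (i : ι) (s : Fin (S.bits i) → Bool) {C : NoisyCircuit (p i).n γ}
    (hC : C ∈ S.circuits i s) : C.cost ≤ S.time.eval (p i).n := by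
  obtain ⟨t₁, t₂, -, -, h⟩ := S.spec i ⟨0, (p i).ensemble.size_pos⟩ s fun _ => false
  have : C.cost ≤ ((S.circuits i s).map NoisyCircuit.cost).sum :=
    List.le_sum_of_mem (List.mem_map_of_mem hC)
  omega

/-- The classical program. -/
def classicalProg (c d : ℕ) : Prog :=
  .comp FProg.clip.compile (.comp S.conclude (.comp (FProg.concludeInput c d).compile
    -- The plan is paired with the original input, since the reserved random bits and the observable
    -- are still needed for sampling.
    (.pair (.comp S.plan.withoutQueries (FProg.planInput c d).compile) .id)))

/-- One parameter `R` is the truncation parameter, the number of bits per outcome and a bound for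
the number of circuits; the last use guarantees that R² bits suffice for all outcomes. -/
theorem runsWithin_classicalProg (hγ : 0 < γ) (c d : ℕ) (hR2 : ∀ n, 2 ≤ c * (n + 1) ^ d)
    (hRT : ∀ n, S.time.eval n ≤ c * (n + 1) ^ d) :
    ∃ K₁ K₂ D : ℕ, ∀ (i : ι) (ω : Fin (p i).ensemble.size) (l : List Bool) (n R T : ℕ),
      n = (p i).n → R = c * (n + 1) ^ d → T = S.time.eval n → l.length = R * R + S.bits i →
      RunsWithin (coefficients ((p i).ensemble.state ω)) (S.classicalProg c d)
        (.node ((p i).input γ) (bitListData l)) (.num (S.classicalEstimate R i ω l))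
        (K₁ * ((n + 1) ^ d + (R + 1) ^ 2) + K₂ * ((n + 1) ^ d + (R + 1) ^ 2 +
          (T + 1) * (T * (T * (((R * R) ^ D + 1) * (n + 1))) + R + 1)) + 2 * T +
          FProg.clip.size + 10) := by
  obtain ⟨K₁, h₁⟩ := FProg.cost_planInput c d
  obtain ⟨K₂, h₂⟩ := FProg.cost_concludeInput c d
  obtain ⟨D, hD⟩ := exists_pow_le_of_keepAbove hγ
  refine ⟨K₁, K₂, D, fun i ω l n R T hn hR hT hl => ?_⟩
  subst hn
  set s := toBits (S.bits i) (l.drop (R * R)) with hs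
  set ask := coefficients ((p i).ensemble.state ω) with hask
  set Cs := S.circuits i s with hCs
  set r := sampleOutcomes (fun C : NoisyCircuit (p i).n γ =>
    C.truncatedValue (p i).obs R ((p i).ensemble.state ω)) R Cs l with hr
  have hlen : Cs.length ≤ T := hT ▸ S.length_circuits_le i s
  have hTR : T ≤ R := by rw [hT, hR]; exact hRT _
  have hlR : Cs.length * R ≤ l.length :=
    (Nat.mul_le_mul_right R (hlen.trans hTR)).trans (by omega)
  have hbits : bitsData s = bitListData (l.drop (R * R)) :=
    bitsData_toBits (by rw [List.length_drop, hl]; omega)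
  have hout : outcomesData (toBits Cs.length r) = outcomeListData r :=
    outcomesData_toBits (FProg.length_sampleOutcomes _ _ _ _)
  obtain ⟨t₁, t₂, hplan, hconc, ht⟩ := S.spec i ω s (toBits Cs.length r)
  rw [hbits] at hplan hconc
  rw [hout] at hconc
  rw [← hT] at ht
  have hplan' := hplan.withoutQueries ask
  have e1 := (FProg.planInput c d).runsWithin_compile ask (.node ((p i).input γ) (bitListData l))
  rw [FProg.eval_planInput, ← hR] at e1
  have e2 : RunsWithin ask S.plan.withoutQueries _ _ t₁ := ⟨t₁, le_rfl, hplan'⟩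
  have e3 : RunsWithin ask .id (.node ((p i).input γ) (bitListData l)) _ 1 := ⟨1, le_rfl, .id _⟩
  have e4 := (FProg.concludeInput c d).runsWithin_compile ask
    (.node (.ofList (Cs.map NoisyCircuit.data)) (.node ((p i).input γ) (bitListData l)))
  rw [FProg.eval_concludeInput ask c d (p i) γ l (coefficients_data _) hR hlR] at e4
  have e5 : RunsWithin ask S.conclude _ _ t₂ := ⟨t₂, le_rfl, hconc⟩
  have e6 := FProg.clip.runsWithin_compile ask (.num (S.estimate i ω s (toBits Cs.length r)))
  rw [FProg.eval_clip, FProg.flat_clip.cost_eq] at e6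
  have c1 := h₁ ask (p i) γ l
  rw [← hR] at c1
  have c2 := h₂ ask (p i) γ l Cs R ((R * R) ^ D) T hR (coefficients_data _) hlR fun C hC =>
    ⟨keepAbove_zero _ (hR ▸ hR2 _), hD C R, hT ▸ S.cost_circuit_le i s hC⟩
  have c3 : K₂ * (((p i).n + 1) ^ d + (R + 1) ^ 2 + (Cs.length + 1) *
      (T * (T * (((R * R) ^ D + 1) * ((p i).n + 1))) + R + 1)) ≤
      K₂ * (((p i).n + 1) ^ d + (R + 1) ^ 2 + (T + 1) *
      (T * (T * (((R * R) ^ D + 1) * ((p i).n + 1))) + R + 1)) := by gcongr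
  refine ((((e1.comp e2).pair e3).comp e4).comp e5 |>.comp e6).mono ?_
  omega

/-- The polynomial that bounds the running time of the classical algorithm. -/
noncomputable def timeBound (c d K₁ K₂ D : ℕ) : Polynomial ℕ :=
  let N : Polynomial ℕ := (Polynomial.X + 1) ^ d
  let R : Polynomial ℕ := Polynomial.C c * N
  Polynomial.C K₁ * (N + (R + 1) ^ 2) + Polynomial.C K₂ * (N + (R + 1) ^ 2 +
    (S.time + 1) * (S.time * (S.time * (((R * R) ^ D + 1) * (Polynomial.X + 1))) + R + 1)) +
    2 * S.time + Polynomial.C FProg.clip.size + 10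

theorem exists_classicalAlgorithm (hγ : 0 < γ) (c d : ℕ) (hR2 : ∀ n, 2 ≤ c * (n + 1) ^ d)
    (hRT : ∀ n, S.time.eval n ≤ c * (n + 1) ^ d) :
    ∃ A : ClassicalAlgorithm p γ,
      (∀ i, A.coins.eval (p i).n =
        c * ((p i).n + 1) ^ d * (c * ((p i).n + 1) ^ d) + S.bits i) ∧
      ∀ i ω s, A.estimate i ω s =
        S.classicalEstimate (c * ((p i).n + 1) ^ d) i ω (List.ofFn s) := by
  obtain ⟨K₁, K₂, D, h⟩ := S.runsWithin_classicalProg hγ c d hR2 hRT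
  set coins : Polynomial ℕ := Polynomial.C c * (Polynomial.X + 1) ^ d *
    (Polynomial.C c * (Polynomial.X + 1) ^ d) + S.coins with hcoins
  have hev : ∀ n, coins.eval n = c * (n + 1) ^ d * (c * (n + 1) ^ d) + S.coins.eval n := by
    intro n
    simp [hcoins]
  refine ⟨⟨S.classicalProg c d, coins, S.timeBound c d K₁ K₂ D, fun i ω s =>
    S.classicalEstimate (c * ((p i).n + 1) ^ d) i ω (List.ofFn s), fun i ω s => ?_⟩,
    fun i => hev _, fun i ω s => rfl⟩
  obtain ⟨t, ht, hrun⟩ := h i ω (List.ofFn s) _ _ _ rfl rfl rfl (by rw [List.length_ofFn, hev])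
  rw [← bitsData_eq] at hrun
  refine ⟨t, hrun, ht.trans_eq ?_⟩
  simp [timeBound]

/-! ### The error of the classical algorithm -/

theorem abs_value_le_one (q : Problem) (ω : Fin q.ensemble.size) : |q.value ω| ≤ 1 :=
  abs_trace_mul_op_le_one q.obs ((q.ensemble.isState ω).ideal q.circuit)

/-- For a fixed state and fixed coins, exchanging true for sampled probabilities costs at most 4
times their differences. Each difference is at most half the truncation error plus 2^(-K), which
gives the coefficients 2 and 4. -/
theorem listMean_sampledEstimate_le (hγ : 0 < γ) (K N : ℕ) (i : ι) (ω : Fin (p i).ensemble.size)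
    (s : Fin (S.bits i) → Bool) (hN : (S.circuits i s).length * K ≤ N) :
    listMean N (fun l => (S.sampledEstimate K i ω s l - (p i).value ω) ^ 2) ≤
      ∑ r, outcomeProb (p i).obs ((p i).ensemble.state ω) (S.circuits i s) r *
        (S.estimate i ω s r - (p i).value ω) ^ 2 +
      ((S.circuits i s).map fun C =>
        2 * |C.truncatedValue (p i).obs K ((p i).ensemble.state ω) -
          (C.run ((p i).ensemble.state ω) * (p i).obs.op).trace.re| + 4 * (1 / 2) ^ K).sum := by
  set O := (p i).obs
  set ρ := (p i).ensemble.state ω with hρ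
  have hst : ∀ C : NoisyCircuit (p i).n γ, IsState (C.run ρ) := fun C =>
    ((p i).ensemble.isState ω).run hγ.le C
  set Cs := S.circuits i s with hCs
  set v := (p i).value ω
  have hv : |v| ≤ 1 := abs_value_le_one (p i) ω
  set e : List Bool → ℝ := fun r => S.estimate i ω s (toBits _ r) with he
  set q : NoisyCircuit (p i).n γ → ℝ := fun C => drawProb K ((C.truncatedValue O K ρ + 1) / 2)
    with hq
  set b : NoisyCircuit (p i).n γ → ℝ := fun C => bornProb O (C.run ρ) true with hb
  have hb01 : ∀ C ∈ Cs, 0 ≤ b C ∧ b C ≤ 1 := fun C _ =>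
    ⟨bornProb_nonneg O (hst C) true, by
      linarith [bornProb_nonneg O (hst C) false, bornProb_add O (hst C).2]⟩
  have h1 : listMean N (fun l => (S.sampledEstimate K i ω s l - v) ^ 2) =
      outcomeMean (Cs.map q) fun r => (max (-1) (min 1 (e r)) - v) ^ 2 :=
    listMean_sampleOutcomes (fun C : NoisyCircuit (p i).n γ => C.truncatedValue O K ρ) K Cs hN
      fun r => (max (-1) (min 1 (e r)) - v) ^ 2
  have h2 := outcomeMean_le_add Cs (p := b) (q := q) hb01
    (fun C _ => ⟨drawProb_nonneg _ _, drawProb_le_one _ _⟩) (B := 4)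
    (h := fun r => (max (-1) (min 1 (e r)) - v) ^ 2) (fun r => sq_nonneg _)
    (fun r => sq_clip_sub_le_four hv)
  have h3 : outcomeMean (Cs.map b) (fun r => (max (-1) (min 1 (e r)) - v) ^ 2) ≤
      outcomeMean (Cs.map b) fun r => (e r - v) ^ 2 := by
    refine outcomeMean_mono ?_ fun r _ => sq_clip_sub_le hv
    intro x hx
    obtain ⟨C, hC, rfl⟩ := List.mem_map.1 hx
    exact hb01 C hC
  have h4 := sum_prod_eq_outcomeMean Cs (fun C => bornProb O (C.run ρ))
    (fun C _ => bornProb_add O (hst C).2) fun r => (e r - v) ^ 2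
  simp only [he, toBits_ofFn] at h4
  have h5 : 4 * (Cs.map fun C => |q C - b C|).sum ≤ (Cs.map fun C =>
      2 * |C.truncatedValue O K ρ - (C.run ρ * O.op).trace.re| + 4 * (1 / 2) ^ K).sum := by
    rw [← List.sum_map_mul_left]
    refine List.sum_le_sum fun C _ => ?_
    have := abs_drawProb_sub_bornProb_le O (hst C) K (C.truncatedValue O K ρ)
    linarith
  rw [h1]
  refine h2.trans (add_le_add (h3.trans_eq ?_) h5)
  exact h4.symm

/-- The circuits depend on the coins but not on the state. Hence the average over the ensemble can
be taken for each circuit with the coins fixed, which is the only form in which truncation is known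
to be accurate. -/
theorem mean_classicalEstimate_le (hγ : 0 < γ) {c : ℝ} {i : ι} (hc : (p i).ensemble.IsLowAverage c)
    {R : ℕ} (hR : 2 ≤ R) (hT : S.time.eval (p i).n ≤ R) :
    (p i).ensemble.mean (fun ω => listMean (R * R + S.bits i) fun l =>
      (S.classicalEstimate R i ω l - (p i).value ω) ^ 2) ≤
    S.rmsError i ^ 2 + S.time.eval (p i).n * ((5 + c / (1 - Real.exp (-γ))) / R) := by
  set E := (p i).ensemble
  set T := S.time.eval (p i).n with hTdef
  set c' := c / (1 - Real.exp (-γ)) with hc'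
  set F : Fin E.size → (Fin (S.bits i) → Bool) → ℝ := fun ω s =>
    ∑ r, outcomeProb (p i).obs (E.state ω) (S.circuits i s) r *
      (S.estimate i ω s r - (p i).value ω) ^ 2 with hF
  set G : (Fin (S.bits i) → Bool) → NoisyCircuit (p i).n γ → Fin E.size → ℝ := fun s C ω =>
    2 * |C.truncatedValue (p i).obs R (E.state ω) -
      (C.run (E.state ω) * (p i).obs.op).trace.re| + 4 * (1 / 2) ^ R with hG
  have hlen := S.length_circuits_le i
  have hR0 : (0 : ℝ) < R := by exact_mod_cast (show 0 < R by omega)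
  have h1 : ∀ ω, listMean (R * R + S.bits i) (fun l =>
      (S.classicalEstimate R i ω l - (p i).value ω) ^ 2) ≤
      coinMean (F ω) + listMean (S.bits i) fun l' =>
        ((S.circuits i (toBits _ l')).map fun C => G (toBits _ l') C ω).sum := by
    intro ω
    have hFω : coinMean (F ω) = listMean (S.bits i) fun l' => F ω (toBits _ l') := by
      rw [← coinMean_ofFn]
      simp only [toBits_ofFn]
    -- The sampling bits come first in the string, but the estimate fixes the coins and averages
    -- over the sampling bits, so the two averages are exchanged.
    rw [hFω, ← listMean_add, listMean_append, listMean_comm]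
    refine listMean_mono fun l' hl' => ?_
    have hN : (S.circuits i (toBits _ l')).length * R ≤ R * R :=
      Nat.mul_le_mul_right R ((hlen _).trans hT)
    refine le_trans (le_of_eq ?_) (S.listMean_sampledEstimate_le hγ R (R * R) i ω
      (toBits _ l') hN)
    refine listMean_congr fun l hl => ?_
    have hd : (l ++ l').drop (R * R) = l' := by rw [← hl, List.drop_left]
    rw [classicalEstimate, hd, sampledEstimate, sampledEstimate,
      sampleOutcomes_append _ _ _ (by rw [hl]; exact hN)]
  refine (E.mean_mono h1).trans ?_
  rw [E.mean_add, E.mean_listMean]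
  refine add_le_add (le_of_eq ?_) ?_
  · rw [rmsError, Real.sq_sqrt]
    refine (E.mean_const 0).symm.trans_le (E.mean_mono fun ω => ?_)
    refine mul_nonneg (by positivity) (Finset.sum_nonneg fun s _ => Finset.sum_nonneg fun r _ =>
      mul_nonneg (Finset.prod_nonneg fun m _ => ?_) (sq_nonneg _))
    exact bornProb_nonneg _ ((E.isState ω).run hγ.le _) _
  · refine (listMean_mono fun l' _ => ?_).trans_eq (listMean_const (S.bits i) _)
    rw [E.mean_list_sum]
    have hG' : ∀ s C, E.mean (G s C) ≤ (5 + c') / R := by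
      intro s C
      rw [hG]
      simp only
      rw [E.mean_add, E.mean_mul, E.mean_const]
      have h2 := mean_abs_truncation_le C hγ (p i).obs hc hR
      have h3 : (1 / 2 : ℝ) ^ R ≤ 1 / R := by
        rw [div_pow, one_pow]
        exact one_div_le_one_div_of_le hR0 (by exact_mod_cast Nat.lt_two_pow_self.le)
      -- Twice the mean truncation error contributes `(1 + c') / R`, and the finite number of random
      -- bits contributes at most `4 / R`.
      have h4 : (5 + c') / R = 2 * ((1 + c') / (2 * R)) + 4 * (1 / R) := by field_simp; ring
      rw [h4]
      linarith
    -- The sign of `c` is not assumed; nonnegativity is read off from the error bound for the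
    -- circuit without layers.
    have hpos : 0 ≤ (5 + c') / R := by
      refine le_trans ?_ (hG' (fun _ => false) ⟨[], γ, le_rfl⟩)
      refine (E.mean_const 0).symm.trans_le (E.mean_mono fun ω => ?_)
      rw [hG]
      positivity
    refine (List.sum_le_card_nsmul _ ((5 + c') / R) ?_).trans ?_
    · intro x hx
      obtain ⟨C, -, rfl⟩ := List.mem_map.1 hx
      exact hG' (toBits _ l') C
    · rw [List.length_map, nsmul_eq_mul]
      exact mul_le_mul_of_nonneg_right (by exact_mod_cast hlen _) hpos

end MitigationStrategy

/-! ### Choice of the truncation parameter and the final error bound -/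

theorem exists_eval_le (P : Polynomial ℕ) : ∃ c d : ℕ, ∀ n, P.eval n ≤ c * (n + 1) ^ d := by
  refine ⟨∑ k ∈ Finset.range (P.natDegree + 1), P.coeff k, P.natDegree, fun n => ?_⟩
  rw [Polynomial.eval_eq_sum_range, Finset.sum_mul]
  refine Finset.sum_le_sum fun k hk => Nat.mul_le_mul_left _ ?_
  exact (Nat.pow_le_pow_left (Nat.le_succ n) k).trans
    (Nat.pow_le_pow_right (Nat.succ_pos n) (Nat.lt_succ_iff.1 (Finset.mem_range.1 hk)))

end QEM

open QEM
theorem corollary1 {ι : Type*} (p : ι → Problem) (γ : ℝ) (hγ : 0 < γ)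
    (c : ℝ) (hc : ∀ i, (p i).ensemble.IsLowAverage c)
    (ε : ι → ℝ) (hε : ∀ i, 0 < ε i)
    (q : Polynomial ℕ) (hq : ∀ i, (ε i)⁻¹ ≤ ((q.eval (p i).n : ℕ) : ℝ))
    (S : MitigationStrategy p γ) (hS : ∀ i, S.rmsError i ≤ ε i / 2) :
    ∃ A : ClassicalAlgorithm p γ, ∀ i, A.rmsError i ≤ ε i := by
  set c' := 5 + c / (1 - Real.exp (-γ)) with hc'
  obtain ⟨m, hm⟩ := exists_nat_ge c'
  -- The parameter `b * (n + 1) ^ d` must be at least 2 so that weight 0 is kept, at least the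
  -- running time so that the reserved bits suffice, and at least `2 * m * T * q ^ 2` for accuracy.
  -- The sum of the three dominates each.
  obtain ⟨b, d, hbd⟩ := exists_eval_le (2 + S.time + 2 * Polynomial.C m * S.time * q ^ 2)
  have hev : ∀ n, 2 + S.time.eval n + 2 * m * S.time.eval n * q.eval n ^ 2 ≤ b * (n + 1) ^ d := by
    intro n
    refine le_trans (le_of_eq ?_) (hbd n)
    simp
  have hR2 : ∀ n, 2 ≤ b * (n + 1) ^ d := fun n => le_trans (by omega) (hev n)
  have hRT : ∀ n, S.time.eval n ≤ b * (n + 1) ^ d := fun n => le_trans (by omega) (hev n)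
  obtain ⟨A, hcoins, hA⟩ := S.exists_classicalAlgorithm hγ b d hR2 hRT
  refine ⟨A, fun i => ?_⟩
  have h := S.mean_classicalEstimate_le hγ (hc i) (hR2 (p i).n) (hRT (p i).n)
  have h1 := hev (p i).n
  set R := b * ((p i).n + 1) ^ d with hR
  set T := S.time.eval (p i).n
  have hR0 : (0 : ℝ) < R := by exact_mod_cast (show 0 < R from lt_of_lt_of_le two_pos (hR2 _))
  have hmean : ∀ ω, coinMean (fun s => (A.estimate i ω s - (p i).value ω) ^ 2) =
      listMean (R * R + S.bits i) fun l => (S.classicalEstimate R i ω l - (p i).value ω) ^ 2 := by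
    intro ω
    rw [← hcoins, ← coinMean_ofFn]
    simp only [hA]
    rfl
  rw [ClassicalAlgorithm.rmsError, Real.sqrt_le_left (hε i).le]
  simp only [hmean]
  refine h.trans ?_
  have h2 : S.rmsError i ^ 2 ≤ (ε i / 2) ^ 2 := pow_le_pow_left₀ (Real.sqrt_nonneg _) (hS i) 2
  have hq1 : 1 ≤ ε i * q.eval (p i).n := by
    have := mul_le_mul_of_nonneg_left (hq i) (hε i).le
    rwa [mul_inv_cancel₀ (hε i).ne'] at this
  -- Since `q` bounds `1 / ε`, the choice gives `R ≥ 2 * m * T / ε ^ 2`, while `c' ≤ m`.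
  have h3 : (T : ℝ) * (c' / R) ≤ ε i ^ 2 / 2 := by
    have h4 : (2 * m * T * q.eval (p i).n ^ 2 : ℝ) ≤ R := by
      exact_mod_cast (show 2 * m * T * q.eval (p i).n ^ 2 ≤ R by omega)
    have h5 : (T : ℝ) * c' ≤ T * m := mul_le_mul_of_nonneg_left hm (Nat.cast_nonneg _)
    have h6 : 1 ≤ (ε i * q.eval (p i).n) ^ 2 := one_le_pow₀ hq1
    rw [← mul_div_assoc, div_le_iff₀ hR0]
    have h7 : ε i ^ 2 / 2 * (2 * m * T * q.eval (p i).n ^ 2 : ℝ) ≤ ε i ^ 2 / 2 * R :=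
      mul_le_mul_of_nonneg_left h4 (by positivity)
    have h8 : (T * m : ℝ) * 1 ≤ T * m * (ε i * q.eval (p i).n) ^ 2 :=
      mul_le_mul_of_nonneg_left h6 (by positivity)
    nlinarith
  -- The mean square error is at most ε²/4 from the strategy plus ε²/2 from the simulation, which is
  -- below ε².
  nlinarith [sq_nonneg (ε i)]
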